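/- **Proposition (Stabilized bubble smoother).** Let $d\in\{2,3\}$, let $\Omega\subseteq\mathbb R^d$ be an open bounded polygonal/polyhedral set with Lipschitz boundary, let $\mathcal M$ be a matching simplicial mesh of $\Omega$, and let $p\ge 0$ be an integer. For a simplex $K$ let $h_K$, $r_K$, $m_K$ be its diameter, inradius and barycenter, and let $h_F,m_F$ be the diameter and the barycenter of a face $F$. Let $\gamma=\gamma(\mathcal M)$ be the smallest nonnegative real number with $h_K\le\gamma r_K$ for all $K\in\mathcal M$. Let $\mathcal F=\mathcal F^i\cup\mathcal F^b$ be the set of faces (interfaces and boundary faces), $\mathcal F_K$ the set of faces of $K$, $\Sigma$ the union of all faces, and $n_K$ the outer unit normal of $K$. Write $\mathbb P_m$ for polynomials of total degree $\le m$, with $\mathbb P_{-1}=\{0\}$, and $\mathbb P_m(\mathcal M)$ for element-wise polynomials. Let $\hat S=\mathbb P_p(\mathcal M)\times\mathbb P_p(\Sigma)$, where $\mathbb P_p(\Sigma)$ consists of the functions that are in $\mathbb P_p(F)$ on each face $F$ and vanish on each boundary face. *Reconstruction.* For $\hat\sigma=(\sigma_{\mathcal M},\sigma_\Sigma)\in\hat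 S$ let $\mathcal R\hat\sigma\in\mathbb P_{p+1}(\mathcal M)$ be determined, for all $K\in\mathcal M$ and $q\in\mathbb P_{p+1}(K)$, by $$\int_K\nabla\mathcal R\hat\sigma\cdot\nabla q=-\int_K\sigma_{\mathcal M}\Delta q+\int_{\partial K}\sigma_\Sigma\nabla q\cdot n_K,\qquad \int_K\mathcal R\hat\sigma=\int_K\sigma_{\mathcal M}.$$ *Averaging.* Let $$A\hat\sigma=\sum_{z}\Big(\frac1{\#\omega_z}\sum_{K\in\omega_z}(\mathcal R\hat\sigma)_{|K}(z)\Big)\Phi_z,$$ where $z$ runs over the Lagrange nodes of degree $p+1$ of $\mathcal M$ not lying on $\partial\Omega$, $\omega_z$ is the set of the simplices of $\mathcal M$ containing $z$, and $\Phi_z$ is the Lagrange basis function of degree $p+1$ at $z$. Let $\hat A\hat\sigma=(A\hat\sigma,(A\hat\sigma)_{|\Sigma})$. *Bubble smoother.* For $K\in\mathcal M$ let $\Phi_K\in H^1_0(\Omega)$ be the function that vanishes outside $K$, is in $\mathbb P_{d+1}$ on $K$, and has $\Phi_K(m_K)=1$. For $F=K_1\cap K_2\in\mathcal F^i$ let $\Phi_F\in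 H^1_0(\Omega)$ be the function that vanishes outside $K_1\cup K_2$, is in $\mathbb P_d$ on $K_1$ and on $K_2$, and has $\Phi_F(m_F)=1$. Define $B_Kv\in\mathbb P_{p-1}(K)$ and $B_Fv\in\mathbb P_p(F)$ by $$\int_Kq\,(B_Kv)\,\Phi_K=\int_Kq\,v\quad\forall q\in\mathbb P_{p-1}(K),\qquad \int_Fr\,(B_Fv)\,\Phi_F=\int_Fr\,v\quad\forall r\in\mathbb P_p(F).$$ Put $B_{\mathcal M}v=\sum_{K\in\mathcal M}(B_Kv)\Phi_K$. Put $B_\Sigma v=\sum_{F\in\mathcal F^i}\sum_{z}(B_Fv)(z)\,\Phi_z\Phi_F$ if $p\ge1$, where $z$ runs over the Lagrange nodes of degree $p$ of $\mathcal M$ in $F$ and $\Phi_z$ is the Lagrange basis function of degree $p$ at $z$; if $p=0$, put $B_\Sigma v=\sum_{F\in\mathcal F^i}(B_Fv)\Phi_F$, with the constant $B_Fv$ extended as a constant. Finally let $B(v_{\mathcal M},v_\Sigma)=B_\Sigma v_\Sigma+B_{\mathcal M}(v_{\mathcal M}-B_\Sigma v_\Sigma)$. *Claim.* The operator $E_H\hat\sigma:=A\hat\sigma+B(\hat\sigma-\hat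 A\hat\sigma)$ is linear from $\hat S$ into $H^1_0(\Omega)$ and, for all $\hat\sigma=(\sigma_{\mathcal M},\sigma_\Sigma)\in\hat S$, $$\int_Kq\,E_H\hat\sigma=\int_Kq\,\sigma_{\mathcal M}\quad\forall K\in\mathcal M,\ q\in\mathbb P_{p-1}(K),\qquad \int_Fr\,E_H\hat\sigma=\int_Fr\,\sigma_\Sigma\quad\forall F\in\mathcal F^i,\ r\in\mathbb P_p(F).$$ Moreover, there is a function $(\gamma,p)\mapsto C_{\gamma,p}$, nondecreasing in each argument and independent of $\Omega$, $\mathcal M$ and $\hat\sigma$, such that $$\|\nabla_{\mathcal M}(\mathcal R\hat\sigma-E_H\hat\sigma)\|_{L^2(\Omega)}^2\le C_{\gamma,p}\sum_{K\in\mathcal M}\sum_{F\in\mathcal F_K}h_F^{-1}\|\sigma_\Sigma-(\sigma_{\mathcal M})_{|K}\|_{L^2(F)}^2$$ for all $\hat\sigma\in\hat S$, where $\nabla_{\mathcal M}$ is the element-wise gradient. -/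

import Mathlib

open MeasureTheory
open scoped NNReal ENNReal ContDiff InnerProductSpace

noncomputable section

namespace HHO

/-- The Euclidean space `ℝ^d`. -/
abbrev Point (d : ℕ) := EuclideanSpace ℝ (Fin d)

/-- Real polynomials in `d` variables. -/
abbrev Poly (d : ℕ) := MvPolynomial (Fin d) ℝ

/-- The value of a polynomial at a point. -/
def ev {d : ℕ} (q : Poly d) (x : Point d) : ℝ := MvPolynomial.eval (fun i => x i) q

/-- Polynomials of total degree at most `m`, for an integer `m`; the zero space if `m < 0`. -/
def polySpace (d : ℕ) (m : ℤ) : Submodule ℝ (Poly d) :=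
  MvPolynomial.restrictSupport ℝ {n | (n.degree : ℤ) ≤ m}

/-- The polynomial `∇q · ∇r`. -/
def gradDot {d : ℕ} (q r : Poly d) : Poly d :=
  ∑ i, MvPolynomial.pderiv i q * MvPolynomial.pderiv i r

/-- The Laplacian of a polynomial. -/
def lapl {d : ℕ} (q : Poly d) : Poly d :=
  ∑ i, MvPolynomial.pderiv i (MvPolynomial.pderiv i q)

/-- The polynomial `∇q · n` for a fixed vector `n`. -/
def normalDeriv {d : ℕ} (n : Point d) (q : Poly d) : Poly d :=
  ∑ i, MvPolynomial.C (n i) * MvPolynomial.pderiv i q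

/-- Simplices (cells and faces) are represented by their finite sets of vertices; this is the
closed simplex with the given vertices. -/
def hull {d : ℕ} (S : Finset (Point d)) : Set (Point d) := convexHull ℝ (S : Set (Point d))

/-- The diameter of a simplex. -/
def size {d : ℕ} (S : Finset (Point d)) : ℝ := Metric.diam (hull S)

/-- The radius of the largest ball contained in a simplex. -/
def inradius {d : ℕ} (K : Finset (Point d)) : ℝ :=
  sSup {r | 0 ≤ r ∧ ∃ x, Metric.ball x r ⊆ hull K}

/-- The volume integral over a simplex. -/
def cellInt {d : ℕ} (K : Finset (Point d)) (f : Point d → ℝ) : ℝ :=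
  ∫ x in hull K, f x

/-- The integral over a face with respect to the `(d-1)`-dimensional surface measure. -/
def faceInt {d : ℕ} (F : Finset (Point d)) (f : Point d → ℝ) : ℝ :=
  ∫ x in hull F, f x ∂(μHE[d - 1] : Measure (Point d))

/-- `n` is the unit normal vector on the face `F` of the simplex `K` pointing out of `K`. -/
def IsOuterNormal {d : ℕ} (K F : Finset (Point d)) (n : Point d) : Prop :=
  ‖n‖ = 1 ∧ (∀ x ∈ F, ∀ y ∈ F, ⟪n, y - x⟫_ℝ = 0) ∧
    ∀ x ∈ F, ∀ y ∈ K, y ∉ F → ⟪n, y - x⟫_ℝ < 0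

/-- The outer unit normal vector of the simplex `K` on its face `F`. -/
def outerNormal {d : ℕ} (K F : Finset (Point d)) : Point d :=
  Classical.epsilon (IsOuterNormal K F)

/-- The boundary of `Ω` is locally the graph of a Lipschitz function, in suitable orthogonal
coordinates with vertical direction `e`, and `Ω` lies locally on one side of it. -/
def HasLipschitzBoundary {d : ℕ} (Ω : Set (Point d)) : Prop :=
  ∀ x ∈ frontier Ω, ∃ ρ > 0, ∃ e : Point d, ‖e‖ = 1 ∧ ∃ (L : ℝ≥0) (g : Point d → ℝ),
    LipschitzWith L g ∧
      ∀ y ∈ Metric.ball x ρ, y ∈ Ω ↔ g (y - ⟪e, y⟫_ℝ • e) < ⟪e, y⟫_ℝ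

/-- The space `H¹₀(Ω)`: `u` is the limit in the norm of `H¹(Ω)` of smooth functions with compact
support in `Ω` (and then `g` is the weak gradient of `u`). -/
def MemH10 {d : ℕ} (Ω : Set (Point d)) (u : Point d → ℝ) : Prop :=
  MemLp u 2 (volume.restrict Ω) ∧ ∃ g : Point d → Point d, MemLp g 2 (volume.restrict Ω) ∧
    ∀ ε : ℝ, 0 < ε → ∃ φ : Point d → ℝ, ContDiff ℝ ∞ φ ∧ HasCompactSupport φ ∧
      tsupport φ ⊆ Ω ∧
      eLpNorm (fun x => φ x - u x) 2 (volume.restrict Ω) ≤ ENNReal.ofReal ε ∧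
      eLpNorm (fun x => gradient φ x - g x) 2 (volume.restrict Ω) ≤ ENNReal.ofReal ε

/-- A matching simplicial mesh of `Ω`. -/
structure Mesh (d : ℕ) (Ω : Set (Point d)) where
  /-- the vertex sets of the cells -/
  cells : Finset (Finset (Point d))
  card_cell : ∀ K ∈ cells, K.card = d + 1
  nondegenerate : ∀ K ∈ cells, AffineIndependent ℝ ((↑) : K → Point d)
  matching : ∀ K₁ ∈ cells, ∀ K₂ ∈ cells, ∃ S ⊆ K₁, hull K₁ ∩ hull K₂ = hull S
  cover : ⋃ K ∈ cells, hull K = closure Ω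

/-- The polynomial of total degree at most `m` with value `1` at `z` and `0` at the other points
of `N` (for `m` and `N` such that these values determine a polynomial). -/
def nodalPoly {d : ℕ} (m : ℕ) (N : Finset (Point d)) (z : Point d) : Poly d :=
  Classical.epsilon fun φ => φ ∈ polySpace d m ∧
    (∀ y ∈ N, y = z → ev φ y = 1) ∧ (∀ y ∈ N, y ≠ z → ev φ y = 0)

open Classical in
/-- The Lagrange nodes of degree `m` of a simplex: the points whose barycentric coordinates are
integer multiples of `1 / m`. -/
def lagrangeNodes {d : ℕ} (m : ℕ) (K : Finset (Point d)) : Finset (Point d) :=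
  (K.piAntidiag m).image fun α => ∑ a ∈ K, ((α a : ℝ) / (m : ℝ)) • a

/-- The restriction to the simplex `K` of the Lagrange basis function of degree `m` associated with
the evaluation at the node `z`. It is zero if `z` is not in `K`. -/
def lagrangeBasis {d : ℕ} (m : ℕ) (K : Finset (Point d)) (z : Point d) : Poly d :=
  nodalPoly m (lagrangeNodes m K) z

/-- The barycentric coordinate of the simplex `K` associated with its vertex `a`. -/
def baryCoord {d : ℕ} (K : Finset (Point d)) (a : Point d) : Poly d := nodalPoly 1 K a

/-- The element bubble of `K`, restricted to `K`: the polynomial of degree at most `d + 1` that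
vanishes on the boundary of `K` and has value `1` at the barycenter of `K`. -/
def elementBubble {d : ℕ} (K : Finset (Point d)) : Poly d :=
  MvPolynomial.C (((d : ℝ) + 1) ^ (d + 1)) * ∏ a ∈ K, baryCoord K a

open Classical in
/-- The face bubble of `F`, restricted to the cell `K`. If `F` is a face of `K`, this is the
polynomial of degree at most `d` that vanishes on the other faces of `K` and has value `1` at the
barycenter of `F`. Otherwise it is zero. -/
def faceBubble {d : ℕ} (K F : Finset (Point d)) : Poly d :=
  if F ⊆ K then MvPolynomial.C ((d : ℝ) ^ d) * ∏ a ∈ F, baryCoord K a else 0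

namespace Mesh

variable {d : ℕ} {Ω : Set (Point d)}

/-- The cells of the mesh. -/
abbrev Cell (T : Mesh d Ω) := {K : Finset (Point d) // K ∈ T.cells}

open Classical in
/-- The vertex sets of the faces of the mesh. -/
def faces (T : Mesh d Ω) : Finset (Finset (Point d)) :=
  T.cells.biUnion fun K => K.powersetCard d

/-- The faces of the mesh. -/
abbrev Face (T : Mesh d Ω) := {F : Finset (Point d) // F ∈ T.faces}

/-- `F` is a common face of two different cells. -/
def IsInterface (T : Mesh d Ω) (F : T.Face) : Prop :=
  ∃ K₁ K₂ : T.Cell, K₁ ≠ K₂ ∧ F.1 ⊆ K₁.1 ∧ F.1 ⊆ K₂.1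

/-- `F` lies on the boundary of the domain. -/
def IsBoundaryFace (T : Mesh d Ω) (F : T.Face) : Prop := hull F.1 ⊆ frontier Ω

open Classical in
/-- The faces of a cell. -/
def facesOf (T : Mesh d Ω) (K : T.Cell) : Finset T.Face :=
  Finset.univ.filter fun F => F.1 ⊆ K.1

open Classical in
/-- The interfaces of the mesh. -/
def interfaces (T : Mesh d Ω) : Finset T.Face :=
  Finset.univ.filter fun F => T.IsInterface F

/-- The shape parameter of the mesh: the smallest `γ` with `h_K ≤ γ r_K` for all cells `K`. -/
def shapeParameter (T : Mesh d Ω) : ℝ :=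
  sInf {γ : ℝ | 0 ≤ γ ∧ ∀ K : T.Cell, size K.1 ≤ γ * inradius K.1}

/-- Element-wise polynomials on the mesh: `u K` is the restriction to the cell `K`. -/
abbrev CellPoly (T : Mesh d Ω) := T.Cell → Poly d

/-- Face-wise polynomials on the skeleton: the restriction to the face `F` is that of `u F`. -/
abbrev FacePoly (T : Mesh d Ω) := T.Face → Poly d

open Classical in
/-- An element-wise polynomial as a function on the closure of `Ω`. The value at a point is taken
from some cell containing it; the cell does not matter off the skeleton, and nowhere if the
element-wise polynomial is continuous. -/
def toFun (T : Mesh d Ω) (u : T.CellPoly) (x : Point d) : ℝ :=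
  if h : ∃ K : T.Cell, x ∈ hull K.1 then ev (u h.choose) x else 0

/-- The HHO space of degree `p`: pairs of an element-wise and a face-wise polynomial of degree at
most `p`, the latter vanishing on the boundary faces. -/
def hhoSpace (T : Mesh d Ω) (p : ℕ) : Submodule ℝ (T.CellPoly × T.FacePoly) where
  carrier := {s | (∀ K, s.1 K ∈ polySpace d p) ∧ (∀ F, s.2 F ∈ polySpace d p) ∧
    ∀ F, T.IsBoundaryFace F → ∀ x ∈ hull F.1, ev (s.2 F) x = 0}
  add_mem' := by
    rintro s t ⟨h1, h2, h3⟩ ⟨k1, k2, k3⟩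
    refine ⟨fun K => Submodule.add_mem _ (h1 K) (k1 K),
      fun F => Submodule.add_mem _ (h2 F) (k2 F), fun F hF x hx => ?_⟩
    have a := h3 F hF x hx
    have b := k3 F hF x hx
    simp only [ev] at a b
    simp [ev, a, b]
  zero_mem' := by
    refine ⟨fun K => Submodule.zero_mem _, fun F => Submodule.zero_mem _, fun F hF x hx => ?_⟩
    simp [ev]
  smul_mem' := by
    rintro c s ⟨h1, h2, h3⟩
    refine ⟨fun K => Submodule.smul_mem _ c (h1 K),
      fun F => Submodule.smul_mem _ c (h2 F), fun F hF x hx => ?_⟩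
    have a := h3 F hF x hx
    simp only [ev] at a
    simp [ev, a]

/-- The conditions that determine the higher-order reconstruction of `s` in the cell `K`. -/
def IsReconstruction (T : Mesh d Ω) (p : ℕ) (s : T.CellPoly × T.FacePoly) (K : T.Cell)
    (r : Poly d) : Prop :=
  r ∈ polySpace d (p + 1) ∧
  (∀ q ∈ polySpace d (p + 1),
    cellInt K.1 (fun x => ev (gradDot r q) x) =
      -cellInt K.1 (fun x => ev (s.1 K) x * ev (lapl q) x) +
        ∑ F ∈ T.facesOf K,
          faceInt F.1 (fun x => ev (s.2 F) x * ev (normalDeriv (outerNormal K.1 F.1) q) x)) ∧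
  cellInt K.1 (fun x => ev r x) = cellInt K.1 (fun x => ev (s.1 K) x)

/-- The higher-order reconstruction operator `R`. -/
def reconstruction (T : Mesh d Ω) (p : ℕ) (s : T.CellPoly × T.FacePoly) : T.CellPoly :=
  fun K => Classical.epsilon (T.IsReconstruction p s K)

/-- The local operator `B_K`, with values in the polynomials of degree at most `p - 1`. -/
def bubbleCell (T : Mesh d Ω) (p : ℕ) (K : T.Cell) (v : Point d → ℝ) : Poly d :=
  Classical.epsilon fun b => b ∈ polySpace d ((p : ℤ) - 1) ∧
    ∀ q ∈ polySpace d ((p : ℤ) - 1),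
      cellInt K.1 (fun x => ev q x * ev b x * ev (elementBubble K.1) x) =
        cellInt K.1 (fun x => ev q x * v x)

/-- The operator `B_M`, restricted to the cell `K`. -/
def bubbleMesh (T : Mesh d Ω) (p : ℕ) (v : T.Cell → Point d → ℝ) : T.CellPoly :=
  fun K => T.bubbleCell p K (v K) * elementBubble K.1

/-- The local operator `B_F`, with values in the polynomials of degree at most `p` on `F`. The
restriction to `F` of the face bubble is the same from all cells containing `F`. -/
def bubbleFace (T : Mesh d Ω) (p : ℕ) (F : T.Face) (v : Point d → ℝ) : Poly d :=
  Classical.epsilon fun b => b ∈ polySpace d p ∧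
    ∀ K : T.Cell, F.1 ⊆ K.1 → ∀ r ∈ polySpace d p,
      faceInt F.1 (fun x => ev r x * ev b x * ev (faceBubble K.1 F.1) x) =
        faceInt F.1 (fun x => ev r x * v x)

open Classical in
/-- The Lagrange nodes of degree `m` of the mesh. -/
def nodes (T : Mesh d Ω) (m : ℕ) : Finset (Point d) := T.cells.biUnion (lagrangeNodes m)

open Classical in
/-- The Lagrange nodes of degree `m` not lying on the boundary of the domain. -/
def interiorNodes (T : Mesh d Ω) (m : ℕ) : Finset (Point d) :=
  (T.nodes m).filter fun z => z ∉ frontier Ω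

open Classical in
/-- The operator `B_Σ`, restricted to the cell `K`. For `p = 0` the constant `B_F v` is extended
as a constant. -/
def bubbleSkeleton (T : Mesh d Ω) (p : ℕ) (v : T.Face → Point d → ℝ) : T.CellPoly :=
  fun K =>
    if p = 0 then
      ∑ F ∈ T.interfaces, T.bubbleFace p F (v F) * faceBubble K.1 F.1
    else
      ∑ F ∈ T.interfaces, ∑ z ∈ (T.nodes p).filter (fun z => z ∈ hull F.1),
        MvPolynomial.C (ev (T.bubbleFace p F (v F)) z) * lagrangeBasis p K.1 z *
          faceBubble K.1 F.1

/-- The bubble smoother `B`, applied to a function `vM` on the cells and a function `vS` on the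
faces. -/
def bubbleSmoother (T : Mesh d Ω) (p : ℕ) (vM : T.Cell → Point d → ℝ)
    (vS : T.Face → Point d → ℝ) : T.CellPoly :=
  T.bubbleSkeleton p vS +
    T.bubbleMesh p (fun K x => vM K x - ev (T.bubbleSkeleton p vS K) x)

open Classical in
/-- The cells to which the point `z` belongs. -/
def patch (T : Mesh d Ω) (z : Point d) : Finset T.Cell :=
  Finset.univ.filter fun K => z ∈ hull K.1

/-- The averaging operator `A`. -/
def averaging (T : Mesh d Ω) (p : ℕ) (s : T.CellPoly × T.FacePoly) : T.CellPoly :=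
  fun K => ∑ z ∈ T.interiorNodes (p + 1),
    MvPolynomial.C (((T.patch z).card : ℝ)⁻¹ *
        ∑ K₁ ∈ T.patch z, ev (T.reconstruction p s K₁) z) *
      lagrangeBasis (p + 1) K.1 z

/-- The stabilized bubble smoother `A σ + B (σ - (A σ, (A σ)|_Σ))`. -/
def smoother (T : Mesh d Ω) (p : ℕ) (s : T.CellPoly × T.FacePoly) : T.CellPoly :=
  T.averaging p s +
    T.bubbleSmoother p
      (fun K x => ev (s.1 K) x - ev (T.averaging p s K) x)
      (fun F x => ev (s.2 F) x - T.toFun (T.averaging p s) x)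

/-- The square of the `L²(Ω)` norm of the broken gradient of an element-wise polynomial. -/
def brokenGradSq (T : Mesh d Ω) (u : T.CellPoly) : ℝ :=
  ∑ K : T.Cell, cellInt K.1 (fun x => ev (gradDot (u K) (u K)) x)

end Mesh

end HHO

end

/-! Moments and conformity are built into the construction; the work lies in the estimate.

Moments. On an interface F the element bubbles and all other face bubbles vanish, and the Lagrange
sum in B_Σ interpolates B_F v. So the bubble part has on F exactly the moments of σ_Σ - Aσ
(`ev_skeletonOf_face`, `smoother_face_moment`). The element bubbles then repair the cell moments
without touching the faces (`smoother_cell_moment`).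

Conformity. All ingredients are continuous element-wise polynomials that vanish on ∂Ω
(`Conforming`), because traces on a common face are determined by data on that face. Such functions
are Lipschitz. Soft thresholding gives them compact support in Ω, and mollification then yields
smooth approximations (`memH10_of_lipschitzWith`).

Stability. Everything is measured in maximum norms, with D_K bounding |σ_Σ - σ_M| on the boundary of
K. Testing the reconstruction with Rσ - σ_M and subtracting Green's identity for σ_M bounds |Rσ -
σ_M| on K by a multiple of D_K (`exists_abs_reconstruction_sub_le`). Hence the values of Rσ at a
node z from two cells with a common face through z are close, since both are close to σ_Σ(z). The
cells at a node in Ω are connected through such faces, and each cell at a boundary node is connected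
to a boundary face, on which σ_Σ = 0 (`reachable_of_mem`, `exists_reachable_not_isInterface`). Both
facts follow from a generic segment that avoids the faces of codimension two
(`iUnion_hull_mem_nhds`). A volume argument bounds the number of cells at a node (`card_patch_le`),
so chaining controls Rσ - Aσ at the nodes and thereby on K. The bubble operators are bounded in the
maximum norm (`exists_abs_le_of_weighted_moment`), so Rσ - E_Hσ is bounded on K by a sum of D over
nearby cells.

Markov's inequality turns this into a gradient bound. Since D_K² is at most a multiple of h_K^(2-d)
times the stabilization on K, all powers of h cancel, and finite overlap permits summation over the
mesh (`exists_brokenGradSq_le`). The norm equivalences come from finite dimension on the unit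
simplex and are uniform because the factor of an affine map cancels (`exists_sq_mul_area_le`). -/

noncomputable section

namespace HHO

/-! ### Evaluation and gradients of polynomials -/

section Evaluation

variable {d : ℕ}

@[simp] lemma ev_zero (x : Point d) : ev (0 : Poly d) x = 0 := by simp [ev]
@[simp] lemma ev_one (x : Point d) : ev (1 : Poly d) x = 1 := by simp [ev]
@[simp] lemma ev_C (c : ℝ) (x : Point d) : ev (MvPolynomial.C c : Poly d) x = c := by simp [ev]
@[simp] lemma ev_natCast (n : ℕ) (x : Point d) : ev (n : Poly d) x = n := by simp [ev]
@[simp] lemma ev_X (i : Fin d) (x : Point d) : ev (MvPolynomial.X i : Poly d) x = x i := by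
  simp [ev]
@[simp] lemma ev_add (q r : Poly d) (x : Point d) : ev (q + r) x = ev q x + ev r x := by simp [ev]
@[simp] lemma ev_sub (q r : Poly d) (x : Point d) : ev (q - r) x = ev q x - ev r x := by simp [ev]
@[simp] lemma ev_mul (q r : Poly d) (x : Point d) : ev (q * r) x = ev q x * ev r x := by simp [ev]
@[simp] lemma ev_pow (q : Poly d) (n : ℕ) (x : Point d) : ev (q ^ n) x = ev q x ^ n := by simp [ev]
@[simp] lemma ev_smul (c : ℝ) (q : Poly d) (x : Point d) : ev (c • q) x = c * ev q x := by
  simp [ev]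
@[simp] lemma ev_sum {ι : Type*} (s : Finset ι) (f : ι → Poly d) (x : Point d) :
    ev (∑ i ∈ s, f i) x = ∑ i ∈ s, ev (f i) x := by simp [ev]
@[simp] lemma ev_prod {ι : Type*} (s : Finset ι) (f : ι → Poly d) (x : Point d) :
    ev (∏ i ∈ s, f i) x = ∏ i ∈ s, ev (f i) x := by simp [ev]

lemma continuous_ev (q : Poly d) : Continuous (ev q) :=
  (MvPolynomial.continuous_eval q).comp (by fun_prop)

/-- The gradient of a polynomial at a point. -/
def grad (q : Poly d) (x : Point d) : Point d :=
  WithLp.toLp 2 fun i => ev (MvPolynomial.pderiv i q) x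

lemma grad_apply (q : Poly d) (x : Point d) (i : Fin d) :
    grad q x i = ev (MvPolynomial.pderiv i q) x := rfl

lemma continuous_grad (q : Poly d) : Continuous (grad q) :=
  (PiLp.continuous_toLp 2 _).comp (continuous_pi fun _ => continuous_ev _)

lemma inner_eq_sum (x y : Point d) : ⟪x, y⟫_ℝ = ∑ i, x i * y i := by
  simp [PiLp.inner_apply, mul_comm]

lemma ev_gradDot (q r : Poly d) (x : Point d) : ev (gradDot q r) x = ⟪grad q x, grad r x⟫_ℝ := by
  simp [gradDot, inner_eq_sum, grad_apply]

lemma ev_gradDot_self (q : Poly d) (x : Point d) : ev (gradDot q q) x = ‖grad q x‖ ^ 2 := by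
  rw [ev_gradDot, real_inner_self_eq_norm_sq]

lemma ev_normalDeriv (n : Point d) (q : Poly d) (x : Point d) :
    ev (normalDeriv n q) x = ⟪n, grad q x⟫_ℝ := by
  simp [normalDeriv, inner_eq_sum, grad_apply]

@[simp] lemma grad_add (q r : Poly d) (x : Point d) : grad (q + r) x = grad q x + grad r x := by
  ext i; simp [grad_apply]
@[simp] lemma grad_sub (q r : Poly d) (x : Point d) : grad (q - r) x = grad q x - grad r x := by
  ext i; simp [grad_apply]
@[simp] lemma grad_C (c : ℝ) (x : Point d) : grad (MvPolynomial.C c : Poly d) x = 0 := by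
  ext i; simp [grad_apply]
lemma grad_mul (q r : Poly d) (x : Point d) :
    grad (q * r) x = ev q x • grad r x + ev r x • grad q x := by
  ext i; simp [grad_apply]
lemma grad_X (i : Fin d) (x : Point d) :
    grad (MvPolynomial.X i : Poly d) x = EuclideanSpace.single i 1 := by
  ext j
  simp only [grad_apply, MvPolynomial.pderiv_X, PiLp.single_apply, Pi.single_apply]
  split_ifs <;> simp_all

lemma hasFDerivAt_ev (q : Poly d) (x : Point d) :
    HasFDerivAt (ev q) (innerSL ℝ (grad q x)) x := by
  induction q using MvPolynomial.induction_on with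
  | C c =>
    have h : ev (MvPolynomial.C c : Poly d) = fun _ => c := by ext; simp
    rw [h, grad_C, map_zero]
    exact hasFDerivAt_const _ _
  | add q r hq hr =>
    have h : ev (q + r) = fun y => ev q y + ev r y := by ext; simp
    rw [h, grad_add, map_add]
    exact hq.add hr
  | mul_X q i hq =>
    have h : ev (q * MvPolynomial.X i) = fun y => ev q y * y i := by ext; simp
    have hX : HasFDerivAt (fun y : Point d => y i) (innerSL ℝ (EuclideanSpace.single i (1 : ℝ))) x := by
      have : (fun y : Point d => y i) = innerSL ℝ (EuclideanSpace.single i (1 : ℝ)) := by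
        ext y; simp [inner_eq_sum]
      rw [this]
      exact ContinuousLinearMap.hasFDerivAt _
    rw [h, grad_mul, grad_X, ev_X, map_add, map_smul, map_smul]
    exact hq.mul hX

lemma hasDerivAt_ev_line (q : Poly d) (x v : Point d) (t : ℝ) :
    HasDerivAt (fun s : ℝ => ev q (x + s • v)) ⟪grad q (x + t • v), v⟫_ℝ t := by
  have h1 : HasDerivAt (fun s : ℝ => x + s • v) v t := by
    simpa using ((hasDerivAt_id t).smul_const v).const_add x
  exact (hasFDerivAt_ev q (x + t • v)).comp_hasDerivAt t h1

lemma abs_ev_sub_le {S : Set (Point d)} (hS : Convex ℝ S) (q : Poly d) {G : ℝ}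
    (hG : ∀ x ∈ S, ‖grad q x‖ ≤ G) {x y : Point d} (hx : x ∈ S) (hy : y ∈ S) :
    |ev q y - ev q x| ≤ G * ‖y - x‖ := by
  refine hS.norm_image_sub_le_of_norm_hasFDerivWithin_le
    (fun z _ => (hasFDerivAt_ev q z).hasFDerivWithinAt) (fun z hz => ?_) hx hy
  rw [innerSL_apply_norm]
  exact hG z hz

/-- An open set contains a product of intervals, and a polynomial is determined by its values on a
product of infinite sets. -/
lemma eq_of_ev_eqOn {S : Set (Point d)} (hS : (interior S).Nonempty) {q r : Poly d}
    (h : ∀ x ∈ S, ev q x = ev r x) : q = r := by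
  obtain ⟨x, hx⟩ := hS
  let e : (Fin d → ℝ) ≃ₜ Point d := (PiLp.homeomorph 2 _).symm
  have ho : IsOpen (e ⁻¹' interior S) := isOpen_interior.preimage e.continuous
  have hx' : e.symm x ∈ e ⁻¹' interior S := by simpa using hx
  obtain ⟨ε, hε, hb⟩ := Metric.isOpen_iff.1 ho _ hx'
  refine MvPolynomial.funext_set (fun i => Metric.ball (e.symm x i) ε) (fun i => ?_) fun y hy => ?_
  · rw [Real.ball_eq_Ioo]
    exact Set.Ioo_infinite (by linarith)
  · have hy' : y ∈ Metric.ball (e.symm x) ε := by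
      rw [ball_pi _ hε]; exact hy
    exact h _ (interior_subset (hb hy'))

end Evaluation

/-! ### Spaces of polynomials of bounded degree -/

section Degree

variable {d : ℕ}

lemma polySpace_mono {m n : ℤ} (h : m ≤ n) : polySpace d m ≤ polySpace d n :=
  MvPolynomial.restrictSupport_mono ℝ fun _ hs => le_trans hs h

lemma mem_polySpace_natCast {m : ℕ} {q : Poly d} :
    q ∈ polySpace d m ↔ q.totalDegree ≤ m := by
  rw [MvPolynomial.totalDegree, Finset.sup_le_iff, polySpace, MvPolynomial.mem_restrictSupport_iff]
  simp only [Set.subset_def, Finset.mem_coe, Set.mem_ofPred_eq, Nat.cast_le]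
  rfl

lemma polySpace_of_neg {m : ℤ} (h : m < 0) : polySpace d m = ⊥ := by
  rw [polySpace, MvPolynomial.restrictSupport_eq_span]
  have : {n : Fin d →₀ ℕ | (n.degree : ℤ) ≤ m} = ∅ := by
    ext n; simp only [Set.mem_ofPred_eq, Set.mem_empty_iff_false, iff_false]; omega
  simp [this]

@[elab_as_elim]
lemma polySpace_induction {m : ℤ} {P : Poly d → Prop}
    (mon : ∀ s : Fin d →₀ ℕ, (s.degree : ℤ) ≤ m → P (MvPolynomial.monomial s 1))
    (zero : P 0) (add : ∀ q r, P q → P r → P (q + r)) (smul : ∀ (c : ℝ) q, P q → P (c • q))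
    {q : Poly d} (hq : q ∈ polySpace d m) : P q := by
  rw [polySpace, MvPolynomial.restrictSupport_eq_span] at hq
  induction hq using Submodule.span_induction with
  | mem x h => obtain ⟨s, hs, rfl⟩ := h; exact mon s hs
  | zero => exact zero
  | add x y _ _ hx hy => exact add x y hx hy
  | smul a x _ hx => exact smul a x hx

lemma C_mem_polySpace (c : ℝ) {m : ℤ} (hm : 0 ≤ m) : (MvPolynomial.C c : Poly d) ∈ polySpace d m := by
  lift m to ℕ using hm
  rw [mem_polySpace_natCast]; simp

lemma one_mem_polySpace {m : ℤ} (hm : 0 ≤ m) : (1 : Poly d) ∈ polySpace d m :=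
  C_mem_polySpace 1 hm

lemma X_mem_polySpace (i : Fin d) {m : ℤ} (hm : 1 ≤ m) :
    (MvPolynomial.X i : Poly d) ∈ polySpace d m := by
  refine polySpace_mono hm ?_
  exact_mod_cast (mem_polySpace_natCast (m := 1)).2 (by simp)

lemma mul_mem_polySpace {m n : ℤ} {q r : Poly d} (hq : q ∈ polySpace d m) (hr : r ∈ polySpace d n) :
    q * r ∈ polySpace d (m + n) := by
  rcases lt_or_ge m 0 with hm | hm
  · rw [polySpace_of_neg hm, Submodule.mem_bot] at hq
    simp [hq]
  rcases lt_or_ge n 0 with hn | hn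
  · rw [polySpace_of_neg hn, Submodule.mem_bot] at hr
    simp [hr]
  lift m to ℕ using hm
  lift n to ℕ using hn
  rw [mem_polySpace_natCast] at hq hr
  exact_mod_cast mem_polySpace_natCast.2
    ((MvPolynomial.totalDegree_mul q r).trans (Nat.add_le_add hq hr))

lemma prod_mem_polySpace {ι : Type*} (s : Finset ι) {f : ι → Poly d} {m : ι → ℕ}
    (h : ∀ i ∈ s, f i ∈ polySpace d (m i)) : ∏ i ∈ s, f i ∈ polySpace d ((∑ i ∈ s, m i : ℕ) : ℤ) := by
  rw [mem_polySpace_natCast]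
  refine (MvPolynomial.totalDegree_finsetProd _ _).trans (Finset.sum_le_sum fun i hi => ?_)
  exact mem_polySpace_natCast.1 (h i hi)

lemma pderiv_mem_polySpace {m : ℤ} {q : Poly d} (hq : q ∈ polySpace d m) (i : Fin d) :
    MvPolynomial.pderiv i q ∈ polySpace d (m - 1) := by
  refine polySpace_induction (fun s hs => ?_) ?_ (fun q r hq hr => ?_) (fun c q hq => ?_) hq
  · rw [MvPolynomial.pderiv_monomial, polySpace, MvPolynomial.monomial_mem_restrictSupport]
    by_cases h : s i = 0
    · right; simp [h]
    · left
      have h1 : (Finsupp.single i 1 : Fin d →₀ ℕ) ≤ s := by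
        rw [Finsupp.single_le_iff]; omega
      have h2 : (s - Finsupp.single i 1).degree + 1 = s.degree := by
        conv_rhs => rw [← tsub_add_cancel_of_le h1]
        simp
      simp only [Set.mem_ofPred_eq]
      omega
  · simp
  · rw [map_add]; exact Submodule.add_mem _ hq hr
  · rw [Derivation.map_smul]; exact Submodule.smul_mem _ _ hq

instance (m : ℤ) : FiniteDimensional ℝ (polySpace d m) := by
  rcases lt_or_ge m 0 with hm | hm
  · rw [polySpace_of_neg hm]; infer_instance
  lift m to ℕ using hm
  have hf : {n : Fin d →₀ ℕ | (n.degree : ℤ) ≤ m}.Finite := by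
    refine (Finsupp.finite_of_degree_le m).subset fun n hn => ?_
    simpa using hn
  have := hf.to_subtype
  exact Module.Finite.of_basis (MvPolynomial.basisRestrictSupport ℝ {n : Fin d →₀ ℕ | (n.degree : ℤ) ≤ m})

/-- Only the monomials 1 and `X i` need checking. The weights may have either sign, so this covers
extrapolation as well as convex combinations. -/
lemma ev_affine {q : Poly d} (hq : q ∈ polySpace d 1) {ι : Type*} (s : Finset ι) (w : ι → ℝ)
    (p : ι → Point d) (hw : ∑ i ∈ s, w i = 1) :
    ev q (∑ i ∈ s, w i • p i) = ∑ i ∈ s, w i * ev q (p i) := by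
  refine polySpace_induction (fun n hn => ?_) ?_ (fun q r hq hr => ?_) (fun c q hq => ?_) hq
  · have hn' : n.degree ≤ 1 := by exact_mod_cast hn
    interval_cases h : n.degree
    · rw [Finsupp.degree_eq_zero_iff] at h
      subst h
      have : (MvPolynomial.monomial 0 1 : Poly d) = 1 := rfl
      simp [this, hw]
    · obtain ⟨i, rfl⟩ : ∃ i, n = Finsupp.single i 1 := by
        have h0 : n ≠ 0 := by rintro rfl; simp at h
        obtain ⟨i, hi⟩ := Finsupp.ne_iff.1 h0
        have h1 : Finsupp.single i 1 ≤ n := Finsupp.single_le_iff.2 (Nat.one_le_iff_ne_zero.2 hi)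
        have h2 : (n - Finsupp.single i 1).degree + 1 = n.degree := by
          conv_rhs => rw [← tsub_add_cancel_of_le h1]
          simp
        have h3 : n - Finsupp.single i 1 = 0 := (Finsupp.degree_eq_zero_iff _).1 (by omega)
        exact ⟨i, by rw [← tsub_add_cancel_of_le h1, h3, zero_add]⟩
      have : (MvPolynomial.monomial (Finsupp.single i 1) 1 : Poly d) = MvPolynomial.X i := rfl
      simp [this, Finset.sum_apply]
  · simp
  · simp [hq, hr, mul_add, Finset.sum_add_distrib]
  · simp only [ev_smul, hq, Finset.mul_sum]
    exact Finset.sum_congr rfl fun i _ => by ring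

/-- Reduces Markov's inequality and the study of level sets to one variable. -/
lemma exists_line_polynomial {m : ℕ} {q : Poly d} (hq : q ∈ polySpace d m) (x v : Point d) :
    ∃ p : Polynomial ℝ, p.natDegree ≤ m ∧ ∀ t, p.eval t = ev q (x + t • v) := by
  refine ⟨MvPolynomial.aeval (fun i => Polynomial.C (x i) + Polynomial.C (v i) * Polynomial.X) q,
    ?_, fun t => ?_⟩
  · have := MvPolynomial.aeval_natDegree_le q (mem_polySpace_natCast.1 hq)
      (fun i => Polynomial.C (x i) + Polynomial.C (v i) * Polynomial.X) (n := 1) (fun i => by compute_degree)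
    simpa using this
  · clear hq
    induction q using MvPolynomial.induction_on with
    | C c => simp
    | add q r hq hr => simp [hq, hr]
    | mul_X q i hq =>
      rw [map_mul, Polynomial.eval_mul, hq, ev_mul, ev_X, MvPolynomial.aeval_X]
      simp only [Polynomial.eval_add, Polynomial.eval_C, Polynomial.eval_mul, Polynomial.eval_X,
        PiLp.add_apply, PiLp.smul_apply, smul_eq_mul, mul_comm]

end Degree

/-! ### Symmetric forms on finite-dimensional spaces -/

section FiniteDimensional

/-- A linear functional that vanishes on the isotropic vectors of a positive semidefinite symmetric
form on a finite-dimensional space is represented by it. -/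
lemma exists_representer {V : Type*} [AddCommGroup V] [Module ℝ V] [FiniteDimensional ℝ V]
    (B : LinearMap.BilinForm ℝ V) (hs : ∀ u v, B u v = B v u)
    (l : V →ₗ[ℝ] ℝ) (hl : ∀ v, B v v = 0 → l v = 0) : ∃ w, ∀ v, B w v = l v := by
  have h1 : l ∈ (LinearMap.ker B).dualAnnihilator := by
    rw [Submodule.mem_dualAnnihilator]
    intro v hv
    exact hl v (by rw [LinearMap.mem_ker.1 hv]; rfl)
  -- The annihilator of the kernel is the range of the dual map, and by reflexivity each element of
  -- the bidual is the evaluation at some `w`.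
  rw [← LinearMap.range_dualMap_eq_dualAnnihilator_ker] at h1
  obtain ⟨f, hf⟩ := h1
  obtain ⟨w, rfl⟩ := (Module.evalEquiv ℝ V).surjective f
  exact ⟨w, fun v => by rw [hs, ← hf]; rfl⟩

/-- Cauchy–Schwarz against the representer `w` of `l`, whence the constant `B w w`. -/
lemma exists_sq_le {V : Type*} [AddCommGroup V] [Module ℝ V] [FiniteDimensional ℝ V]
    (B : LinearMap.BilinForm ℝ V) (hs : ∀ u v, B u v = B v u) (h0 : ∀ v, 0 ≤ B v v)
    (l : V →ₗ[ℝ] ℝ) (hl : ∀ v, B v v = 0 → l v = 0) : ∃ C, 0 ≤ C ∧ ∀ v, l v ^ 2 ≤ C * B v v := by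
  obtain ⟨w, hw⟩ := exists_representer B hs l hl
  refine ⟨B w w, h0 w, fun v => ?_⟩
  rw [← hw]
  exact B.apply_sq_le_of_symm h0 ⟨hs⟩ w v

end FiniteDimensional

/-! ### Inverse inequalities of Markov type -/

section Markov

/-- Markov's inequality at an end point of the unit interval. -/
lemma exists_markov (m : ℕ) : ∃ C : ℝ, 0 < C ∧ ∀ p : Polynomial ℝ, p.natDegree ≤ m → ∀ M : ℝ,
    (∀ t ∈ Set.Icc (0 : ℝ) 1, |p.eval t| ≤ M) → |p.derivative.eval 0| ≤ C * M := by
  -- Equispaced interpolation nodes in the unit interval: the derivative at 0 is a fixed linear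
  -- combination of the values there.
  let v : ℕ → ℝ := fun k => k / (m + 1)
  let s := Finset.range (m + 1)
  have hv : Set.InjOn v s := by
    intro a _ b _ hab
    have : (m + 1 : ℝ) ≠ 0 := by positivity
    simpa [v, div_left_inj' this] using hab
  refine ⟨∑ k ∈ s, |(Lagrange.basis s v k).derivative.eval 0| + 1, by positivity, fun p hp M hM => ?_⟩
  have hM0 : 0 ≤ M := (abs_nonneg _).trans (hM 0 (by simp))
  have hdeg : p.degree < s.card := by
    rw [Finset.card_range]
    exact lt_of_le_of_lt Polynomial.degree_le_natDegree (by exact_mod_cast Nat.lt_succ_of_le hp)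
  have hp' := Lagrange.eq_interpolate hv hdeg
  rw [hp', Lagrange.interpolate_apply, Polynomial.derivative_sum, Polynomial.eval_finsetSum]
  refine (Finset.abs_sum_le_sum_abs _ _).trans ?_
  rw [add_mul, Finset.sum_mul]
  refine le_add_of_le_of_nonneg (Finset.sum_le_sum fun k hk => ?_) (by simpa using hM0)
  rw [Polynomial.derivative_C_mul, Polynomial.eval_C_mul, abs_mul, mul_comm]
  gcongr
  refine hM _ ⟨by positivity, ?_⟩
  rw [div_le_one (by positivity)]
  have : k < m + 1 := Finset.mem_range.1 hk
  exact_mod_cast this.le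

/-- A gradient bound for polynomials on a convex set containing a ball. -/
lemma exists_norm_grad_le (m : ℕ) : ∃ C : ℝ, 0 < C ∧ ∀ (d : ℕ) (S : Set (Point d)), Convex ℝ S →
    ∀ (x₀ : Point d) (r : ℝ), 0 < r → Metric.ball x₀ r ⊆ S → ∀ u ∈ polySpace d m, ∀ M : ℝ,
      (∀ x ∈ S, |ev u x| ≤ M) → ∀ x ∈ S, ‖grad u x‖ ≤ C * M / r := by
  obtain ⟨C, hC, hmark⟩ := exists_markov m
  refine ⟨2 * C, by positivity, fun d S hS x₀ r hr hball u hu M hM x hx => ?_⟩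
  have hM0 : 0 ≤ M := (abs_nonneg _).trans (hM x hx)
  -- Restriction to the segment from `x` to `y`, which stays in `S`; its derivative at 0 is the
  -- directional derivative.
  have key : ∀ y ∈ S, |⟪grad u x, y - x⟫_ℝ| ≤ C * M := by
    intro y hy
    obtain ⟨p, hp, hpe⟩ := exists_line_polynomial hu x (y - x)
    have hd : p.derivative.eval 0 = ⟪grad u x, y - x⟫_ℝ := by
      have h1 := p.hasDerivAt 0
      have h2 := hasDerivAt_ev_line u x (y - x) 0
      rw [show (fun s : ℝ => ev u (x + s • (y - x))) = fun s => p.eval s from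
        funext fun s => (hpe s).symm] at h2
      simpa using h1.unique h2
    rw [← hd]
    refine hmark p hp M fun t ht => ?_
    rw [hpe]
    exact hM _ (hS.add_smul_sub_mem hx hy ht)
  set g := grad u x with hg
  rcases eq_or_ne g 0 with h0 | h0
  · rw [h0, norm_zero]; positivity
  have hgn : 0 < ‖g‖ := norm_pos_iff.2 h0
  -- Antipodal points of the ball in the direction of the gradient. The two inner products differ by
  -- r‖g‖ and are each at most CM in modulus, which is where the 2 in the constant comes from.
  set e : Point d := (r / (2 * ‖g‖)) • g with he
  have hen : ‖e‖ = r / 2 := by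
    rw [he, norm_smul, Real.norm_of_nonneg (by positivity)]; field_simp
  have h1 := key (x₀ + e) (hball (by rw [mem_ball_iff_norm, add_sub_cancel_left, hen]; linarith))
  have h2 := key (x₀ - e) (hball (by
    rw [mem_ball_iff_norm, sub_sub_cancel_left, norm_neg, hen]; linarith))
  have h3 : ⟪g, x₀ + e - x⟫_ℝ - ⟪g, x₀ - e - x⟫_ℝ = r * ‖g‖ := by
    rw [← inner_sub_right, show x₀ + e - x - (x₀ - e - x) = (2 : ℝ) • e by
      rw [two_smul]; abel, he, smul_smul, inner_smul_right, real_inner_self_eq_norm_sq]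
    field_simp
  rw [le_div_iff₀ hr]
  have := abs_le.1 h1
  have := abs_le.1 h2
  nlinarith

end Markov

/-! ### Barycentric coordinates of simplices -/

section Barycentric

variable {d : ℕ}

/-- The finite set `K` is the vertex set of a nondegenerate simplex of full dimension. -/
structure IsSimplex (K : Finset (Point d)) : Prop where
  card : K.card = d + 1
  indep : AffineIndependent ℝ ((↑) : K → Point d)

lemma exists_affine_poly (f : Point d →ᵃ[ℝ] ℝ) : ∃ q ∈ polySpace d 1, ∀ x, ev q x = f x := by
  refine ⟨MvPolynomial.C (f 0) +
    ∑ i, f.linear (EuclideanSpace.single i 1) • MvPolynomial.X i, ?_, fun x => ?_⟩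
  · refine Submodule.add_mem _ (C_mem_polySpace _ zero_le_one) (Submodule.sum_mem _ fun i _ => ?_)
    exact Submodule.smul_mem _ _ (X_mem_polySpace i le_rfl)
  · have h1 : f x = f.linear x + f 0 := by
      simpa using congrFun f.decomp x
    have h2 : x = ∑ i, x i • EuclideanSpace.single i (1 : ℝ) := by
      ext j
      simp [Finset.sum_apply, Pi.single_apply]
    rw [h1]
    conv_rhs => rw [h2]
    simp [add_comm, mul_comm]

namespace IsSimplex

variable {K : Finset (Point d)}

/-- The vertices of a simplex as an affine basis. -/
def basis (hK : IsSimplex K) : AffineBasis K ℝ (Point d) where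
  toFun := (↑)
  ind' := hK.indep
  tot' := by
    rw [hK.indep.affineSpan_eq_top_iff_card_eq_finrank_add_one]
    simp [hK.card]

lemma basis_apply (hK : IsSimplex K) (a : K) : hK.basis a = a := rfl

lemma ev_eq_sum_coord (hK : IsSimplex K) {q : Poly d} (hq : q ∈ polySpace d 1) (x : Point d) :
    ev q x = ∑ a : K, hK.basis.coord a x * ev q a := by
  conv_lhs => rw [← hK.basis.linear_combination_coord_eq_self x]
  exact ev_affine hq _ _ _ (hK.basis.sum_coord_apply_eq_one x)

/-- `baryCoord` is a choice, so existence has to be supplied, by the coordinate of the affine basis.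
Uniqueness holds because a polynomial of degree at most one is determined by its values at the
vertices. -/
lemma baryCoord_spec (hK : IsSimplex K) {a : Point d} (ha : a ∈ K) :
    baryCoord K a ∈ polySpace d 1 ∧ ∀ x, ev (baryCoord K a) x = hK.basis.coord ⟨a, ha⟩ x := by
  obtain ⟨q, hq, hqe⟩ := exists_affine_poly (hK.basis.coord ⟨a, ha⟩)
  have hval : ∀ y (hy : y ∈ K), ev q y = if y = a then 1 else 0 := by
    intro y hy
    have := hK.basis.coord_apply ⟨a, ha⟩ ⟨y, hy⟩
    rw [basis_apply] at this
    rw [hqe, this]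
    simp [eq_comm]
  have hex : ∃ φ : Poly d, φ ∈ polySpace d (1 : ℕ) ∧
      (∀ y ∈ K, y = a → ev φ y = 1) ∧ (∀ y ∈ K, y ≠ a → ev φ y = 0) :=
    ⟨q, by exact_mod_cast hq, fun y hy h => by rw [hval y hy, if_pos h],
      fun y hy h => by rw [hval y hy, if_neg h]⟩
  obtain ⟨h1, h2, h3⟩ := Classical.epsilon_spec hex
  have h1' : baryCoord K a ∈ polySpace d 1 := by exact_mod_cast h1
  refine ⟨h1', fun x => ?_⟩
  rw [← hqe, hK.ev_eq_sum_coord h1', hK.ev_eq_sum_coord hq]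
  refine Finset.sum_congr rfl fun y _ => ?_
  congr 1
  rw [hval y y.2]
  split_ifs with h
  · exact h2 y y.2 h
  · exact h3 y y.2 h

lemma baryCoord_mem (hK : IsSimplex K) {a : Point d} (ha : a ∈ K) :
    baryCoord K a ∈ polySpace d 1 := (hK.baryCoord_spec ha).1

lemma ev_baryCoord_vertex (hK : IsSimplex K) {a b : Point d} (ha : a ∈ K) (hb : b ∈ K) :
    ev (baryCoord K a) b = if a = b then 1 else 0 := by
  have := hK.basis.coord_apply ⟨a, ha⟩ ⟨b, hb⟩
  rw [basis_apply] at this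
  rw [(hK.baryCoord_spec ha).2, this]
  simp

lemma ev_eq_sum (hK : IsSimplex K) {q : Poly d} (hq : q ∈ polySpace d 1) (x : Point d) :
    ev q x = ∑ a ∈ K, ev (baryCoord K a) x * ev q a := by
  rw [hK.ev_eq_sum_coord hq, ← Finset.sum_coe_sort K fun a => ev (baryCoord K a) x * ev q a]
  exact Finset.sum_congr rfl fun a _ => by rw [(hK.baryCoord_spec a.2).2]

lemma sum_baryCoord (hK : IsSimplex K) (x : Point d) : ∑ a ∈ K, ev (baryCoord K a) x = 1 := by
  simpa using (hK.ev_eq_sum (one_mem_polySpace zero_le_one) x).symm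

lemma sum_baryCoord_smul (hK : IsSimplex K) (x : Point d) :
    ∑ a ∈ K, ev (baryCoord K a) x • a = x := by
  ext i
  simpa [Finset.sum_apply] using (hK.ev_eq_sum (X_mem_polySpace i le_rfl) x).symm

lemma baryCoord_combination (hK : IsSimplex K) {S : Finset (Point d)} (hS : S ⊆ K)
    {w : Point d → ℝ} (hw : ∑ a ∈ S, w a = 1) {b : Point d} (hb : b ∈ K) :
    ev (baryCoord K b) (∑ a ∈ S, w a • a) = ∑ a ∈ S, if b = a then w a else 0 := by
  refine (ev_affine (hK.baryCoord_mem hb) S w id hw).trans (Finset.sum_congr rfl fun a ha => ?_)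
  rw [id, hK.ev_baryCoord_vertex hb (hS ha)]
  simp

/-- All faces of `K` are described by the coordinates of `K` itself; the incidence arguments for
meshes rest on this. -/
lemma mem_hull_iff (hK : IsSimplex K) {S : Finset (Point d)} (hS : S ⊆ K) {x : Point d} :
    x ∈ hull S ↔ (∀ a ∈ K, 0 ≤ ev (baryCoord K a) x) ∧ ∀ a ∈ K, a ∉ S → ev (baryCoord K a) x = 0 := by
  classical
  rw [hull, Finset.mem_convexHull']
  constructor
  · rintro ⟨w, hw0, hw1, rfl⟩
    refine ⟨fun a ha => ?_, fun a ha haS => ?_⟩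
    · rw [hK.baryCoord_combination hS hw1 ha]
      exact Finset.sum_nonneg fun b hb => by split_ifs <;> simp [hw0 b hb]
    · rw [hK.baryCoord_combination hS hw1 ha, Finset.sum_ite_eq, if_neg haS]
  · rintro ⟨h1, h2⟩
    refine ⟨fun a => ev (baryCoord K a) x, fun a ha => h1 a (hS ha), ?_, ?_⟩
    · rw [← hK.sum_baryCoord x]
      exact Finset.sum_subset hS fun a ha haS => h2 a ha haS
    · conv_rhs => rw [← hK.sum_baryCoord_smul x]
      exact Finset.sum_subset hS fun a ha haS => by simp [h2 a ha haS]

lemma mem_hull_self_iff (hK : IsSimplex K) {x : Point d} :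
    x ∈ hull K ↔ ∀ a ∈ K, 0 ≤ ev (baryCoord K a) x := by
  rw [hK.mem_hull_iff subset_rfl]
  exact and_iff_left fun a ha h => absurd ha h

lemma baryCoord_nonneg (hK : IsSimplex K) {x : Point d} (hx : x ∈ hull K) {a : Point d}
    (ha : a ∈ K) : 0 ≤ ev (baryCoord K a) x := hK.mem_hull_self_iff.1 hx a ha

lemma baryCoord_le_one (hK : IsSimplex K) {x : Point d} (hx : x ∈ hull K) {a : Point d}
    (ha : a ∈ K) : ev (baryCoord K a) x ≤ 1 := by
  rw [← hK.sum_baryCoord x]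
  exact Finset.single_le_sum (f := fun a => ev (baryCoord K a) x)
    (fun b hb => hK.baryCoord_nonneg hx hb) ha

lemma interior_hull (hK : IsSimplex K) :
    interior (hull K) = {x | ∀ a ∈ K, 0 < ev (baryCoord K a) x} := by
  have h : Set.range hK.basis = (K : Set (Point d)) := by
    ext x; simp [Set.mem_range, basis_apply]
  have := hK.basis.interior_convexHull
  rw [h] at this
  rw [hull, this]
  ext x
  simp only [Set.mem_ofPred_eq, Subtype.forall]
  exact forall₂_congr fun a ha => by rw [(hK.baryCoord_spec ha).2]

lemma interior_hull_nonempty (hK : IsSimplex K) : (interior (hull K)).Nonempty := by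
  classical
  have hc : (K.card : ℝ) ≠ 0 := by rw [hK.card]; positivity
  have hw : ∑ _a ∈ K, (K.card : ℝ)⁻¹ = 1 := by simp [hc]
  refine ⟨∑ a ∈ K, (K.card : ℝ)⁻¹ • a, ?_⟩
  rw [hK.interior_hull]
  intro a ha
  rw [hK.baryCoord_combination subset_rfl hw ha]
  rw [Finset.sum_ite_eq, if_pos ha, inv_pos, hK.card]
  positivity

lemma nonempty (hK : IsSimplex K) : K.Nonempty := Finset.card_pos.1 (by rw [hK.card]; omega)

end IsSimplex

lemma subset_hull (S : Finset (Point d)) : (S : Set (Point d)) ⊆ hull S := subset_convexHull ℝ _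
lemma hull_mono {S T : Finset (Point d)} (h : S ⊆ T) : hull S ⊆ hull T :=
  convexHull_mono (by exact_mod_cast h)
lemma convex_hull (S : Finset (Point d)) : Convex ℝ (hull S) := convex_convexHull ℝ _
lemma isCompact_hull (S : Finset (Point d)) : IsCompact (hull S) :=
  S.finite_toSet.isCompact_convexHull ℝ
lemma isClosed_hull (S : Finset (Point d)) : IsClosed (hull S) := (isCompact_hull S).isClosed
lemma measurableSet_hull (S : Finset (Point d)) : MeasurableSet (hull S) :=
  (isClosed_hull S).measurableSet

lemma dist_le_size {S : Finset (Point d)} {x y : Point d} (hx : x ∈ hull S) (hy : y ∈ hull S) :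
    dist x y ≤ size S := Metric.dist_le_diam_of_mem (isCompact_hull S).isBounded hx hy

lemma size_nonneg (S : Finset (Point d)) : 0 ≤ size S := Metric.diam_nonneg

end Barycentric

/-! ### Lagrange nodes and nodal bases -/

section Lagrange

variable {d m : ℕ}

/-- The point with barycentric coordinates `α / m`. -/
def nodePoint (m : ℕ) (K : Finset (Point d)) (α : Point d → ℕ) : Point d :=
  ∑ a ∈ K, ((α a : ℝ) / (m : ℝ)) • a

/-- The Lagrange basis polynomial as a product of linear factors. -/
def lagrangeProd (m : ℕ) (K : Finset (Point d)) (α : Point d → ℕ) : Poly d :=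
  ∏ a ∈ K, ∏ k ∈ Finset.range (α a),
    MvPolynomial.C ((k + 1 : ℝ)⁻¹) * (MvPolynomial.C (m : ℝ) * baryCoord K a - MvPolynomial.C (k : ℝ))

lemma mem_lagrangeNodes {K : Finset (Point d)} {z : Point d} :
    z ∈ lagrangeNodes m K ↔ ∃ α : Point d → ℕ, ∑ a ∈ K, α a = m ∧ (∀ a, α a ≠ 0 → a ∈ K) ∧
      nodePoint m K α = z := by
  classical
  simp only [lagrangeNodes, Finset.mem_image, Finset.mem_piAntidiag, nodePoint, and_assoc]

lemma sum_node_weights (hm : m ≠ 0) {K : Finset (Point d)} {α : Point d → ℕ}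
    (hα : ∑ a ∈ K, α a = m) : ∑ a ∈ K, ((α a : ℝ) / (m : ℝ)) = 1 := by
  rw [← Finset.sum_div, ← Nat.cast_sum, hα, div_self (by exact_mod_cast hm)]

lemma nodePoint_mem_hull (hm : m ≠ 0) {K : Finset (Point d)} {α : Point d → ℕ}
    (hα : ∑ a ∈ K, α a = m) : nodePoint m K α ∈ hull K := by
  rw [hull, Finset.mem_convexHull']
  exact ⟨_, fun a _ => by positivity, sum_node_weights hm hα, rfl⟩

lemma lagrangeNodes_subset_hull (hm : m ≠ 0) {K : Finset (Point d)} {z : Point d}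
    (hz : z ∈ lagrangeNodes m K) : z ∈ hull K := by
  obtain ⟨α, h1, -, rfl⟩ := mem_lagrangeNodes.1 hz
  exact nodePoint_mem_hull hm h1

lemma lagrangeNodes_mono {S K : Finset (Point d)} (h : S ⊆ K) :
    lagrangeNodes m S ⊆ lagrangeNodes m K := by
  intro z hz
  obtain ⟨α, h1, h2, rfl⟩ := mem_lagrangeNodes.1 hz
  have h0 : ∀ a ∈ K, a ∉ S → α a = 0 := fun a _ ha => by
    by_contra h; exact ha (h2 a h)
  refine mem_lagrangeNodes.2 ⟨α, ?_, fun a ha => h (h2 a ha), ?_⟩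
  · rw [← h1]; exact (Finset.sum_subset h h0).symm
  · exact (Finset.sum_subset h fun a ha haS => by rw [h0 a ha haS]; simp).symm

namespace IsSimplex

variable {K : Finset (Point d)}

lemma baryCoord_nodePoint (hK : IsSimplex K) (hm : m ≠ 0) {α : Point d → ℕ}
    (hα : ∑ a ∈ K, α a = m) {b : Point d} (hb : b ∈ K) :
    ev (baryCoord K b) (nodePoint m K α) = α b / m := by
  classical
  rw [nodePoint, hK.baryCoord_combination subset_rfl (sum_node_weights hm hα) hb,
    Finset.sum_ite_eq, if_pos hb]

lemma lagrangeProd_mem (hK : IsSimplex K) {α : Point d → ℕ} (hα : ∑ a ∈ K, α a = m) :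
    lagrangeProd m K α ∈ polySpace d m := by
  rw [← hα, lagrangeProd]
  refine prod_mem_polySpace _ fun a ha => ?_
  have := prod_mem_polySpace (d := d) (Finset.range (α a)) (m := fun _ => 1)
    (f := fun k => MvPolynomial.C ((k + 1 : ℝ)⁻¹) *
      (MvPolynomial.C ((∑ a ∈ K, α a : ℕ) : ℝ) * baryCoord K a - MvPolynomial.C (k : ℝ))) fun k _ => by
    rw [← zero_add ((1 : ℕ) : ℤ)]
    refine mul_mem_polySpace (C_mem_polySpace _ le_rfl) (Submodule.sub_mem _ ?_ ?_)
    · rw [← zero_add ((1 : ℕ) : ℤ)]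
      exact mul_mem_polySpace (C_mem_polySpace _ le_rfl) (by exact_mod_cast hK.baryCoord_mem ha)
    · exact C_mem_polySpace _ (by simp)
  simpa using this

lemma ev_lagrangeProd (α : Point d → ℕ) (x : Point d) : ev (lagrangeProd m K α) x =
    ∏ a ∈ K, ∏ k ∈ Finset.range (α a), ((m : ℝ) * ev (baryCoord K a) x - k) / (k + 1) := by
  simp only [lagrangeProd, ev_prod, ev_mul, ev_sub, ev_C, div_eq_inv_mul]

/-- The vertex `a` contributes the product of (α a - k)/(k + 1) over k < α a, with the same
factorial in numerator and denominator, in opposite orders. -/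
lemma ev_lagrangeProd_self (hK : IsSimplex K) (hm : m ≠ 0) {α : Point d → ℕ}
    (hα : ∑ a ∈ K, α a = m) : ev (lagrangeProd m K α) (nodePoint m K α) = 1 := by
  rw [ev_lagrangeProd]
  refine Finset.prod_eq_one fun a ha => ?_
  rw [hK.baryCoord_nodePoint hm hα ha, mul_div_cancel₀ _ (by exact_mod_cast hm : (m : ℝ) ≠ 0),
    Finset.prod_div_distrib, div_eq_one_iff_eq
      (Finset.prod_ne_zero_iff.2 fun k _ => by positivity),
    ← Finset.prod_range_reflect (fun k : ℕ => (k : ℝ) + 1)]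
  refine Finset.prod_congr rfl fun k hk => ?_
  have := Finset.mem_range.1 hk
  rw [Nat.cast_sub (by omega), Nat.cast_sub (by omega)]
  push_cast
  ring

/-- Different multi-indices of equal sum have a vertex with β a < α a, and there the factor with k =
β a vanishes. -/
lemma ev_lagrangeProd_ne (hK : IsSimplex K) (hm : m ≠ 0) {α β : Point d → ℕ}
    (hα : ∑ a ∈ K, α a = m) (hβ : ∑ a ∈ K, β a = m) (hne : ∃ a ∈ K, α a ≠ β a) :
    ev (lagrangeProd m K α) (nodePoint m K β) = 0 := by
  obtain ⟨a, ha, hlt⟩ : ∃ a ∈ K, β a < α a := by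
    by_contra! hle
    obtain ⟨a, ha, hab⟩ := hne
    have := Finset.sum_lt_sum hle ⟨a, ha, lt_of_le_of_ne (hle a ha) hab⟩
    omega
  rw [ev_lagrangeProd]
  refine Finset.prod_eq_zero ha (Finset.prod_eq_zero (Finset.mem_range.2 hlt) ?_)
  rw [hK.baryCoord_nodePoint hm hβ ha, mul_div_cancel₀ _ (by exact_mod_cast hm : (m : ℝ) ≠ 0)]
  simp

lemma lagrangeBasis_spec (hK : IsSimplex K) (hm : m ≠ 0) (z : Point d) :
    lagrangeBasis m K z ∈ polySpace d m ∧
      ∀ y ∈ lagrangeNodes m K, ev (lagrangeBasis m K z) y = if y = z then 1 else 0 := by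
  have hex : ∃ φ : Poly d, φ ∈ polySpace d m ∧ (∀ y ∈ lagrangeNodes m K, y = z → ev φ y = 1) ∧
      (∀ y ∈ lagrangeNodes m K, y ≠ z → ev φ y = 0) := by
    by_cases hz : z ∈ lagrangeNodes m K
    · obtain ⟨α, h1, h2, rfl⟩ := mem_lagrangeNodes.1 hz
      refine ⟨lagrangeProd m K α, hK.lagrangeProd_mem h1, ?_, fun y hy hne => ?_⟩
      · rintro y - rfl
        exact hK.ev_lagrangeProd_self hm h1
      · obtain ⟨β, k1, k2, rfl⟩ := mem_lagrangeNodes.1 hy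
        refine hK.ev_lagrangeProd_ne hm h1 k1 ?_
        by_contra! h
        exact hne (Finset.sum_congr rfl fun a ha => by rw [h a ha])
    · exact ⟨0, Submodule.zero_mem _, fun y hy h => absurd (h ▸ hy) hz, by simp⟩
  obtain ⟨h1, h2, h3⟩ := Classical.epsilon_spec hex
  refine ⟨h1, fun y hy => ?_⟩
  split_ifs with h
  · exact h2 y hy h
  · exact h3 y hy h

lemma lagrangeBasis_mem (hK : IsSimplex K) (hm : m ≠ 0) (z : Point d) :
    lagrangeBasis m K z ∈ polySpace d m := (hK.lagrangeBasis_spec hm z).1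

/-- Monomials of degree at most `m` in `d` variables inject into the nodes: the slack m - |s| serves
as the exponent of the remaining vertex. -/
lemma finrank_polySpace_le (hK : IsSimplex K) (hm : m ≠ 0) :
    Module.finrank ℝ (polySpace d m) ≤ (lagrangeNodes m K).card := by
  classical
  have hf : {n : Fin d →₀ ℕ | (n.degree : ℤ) ≤ m}.Finite :=
    (Finsupp.finite_of_degree_le m).subset fun n hn => by simpa using hn
  have := hf.fintype
  rw [polySpace, Module.finrank_eq_card_basis (MvPolynomial.basisRestrictSupport ℝ _),
    ← Set.toFinset_card]
  let e : K ≃ Fin (d + 1) := K.equivFinOfCardEq hK.card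
  let A : (Fin d →₀ ℕ) → Point d → ℕ := fun s a =>
    if h : a ∈ K then (Fin.cons (m - s.degree) s : Fin (d + 1) → ℕ) (e ⟨a, h⟩) else 0
  have hA : ∀ s a (h : a ∈ K), A s a = (Fin.cons (m - s.degree) s : Fin (d + 1) → ℕ) (e ⟨a, h⟩) :=
    fun s a h => dif_pos h
  have hsum : ∀ s : Fin d →₀ ℕ, s.degree ≤ m → ∑ a ∈ K, A s a = m := by
    intro s hs
    rw [← Finset.sum_coe_sort]
    simp only [hA _ _ (Subtype.prop _), Subtype.coe_eta]
    rw [Equiv.sum_comp e (Fin.cons (m - s.degree) s : Fin (d + 1) → ℕ), Fin.sum_univ_succ]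
    simp only [Fin.cons_zero, Fin.cons_succ]
    rw [← Finsupp.degree_eq_sum]
    omega
  refine Finset.card_le_card_of_injOn (fun s => nodePoint m K (A s)) (fun s hs => ?_)
    fun s hs t ht hst => ?_
  · have hs' : s.degree ≤ m := by simpa using hs
    exact mem_lagrangeNodes.2 ⟨_, hsum s hs', fun a ha => by
      by_contra h; exact ha (dif_neg h), rfl⟩
  · have hs' : s.degree ≤ m := by simpa using hs
    have ht' : t.degree ≤ m := by simpa using ht
    ext i
    have ha := (e.symm i.succ).2
    have h1 := hK.baryCoord_nodePoint hm (hsum s hs') ha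
    have hst' : nodePoint m K (A s) = nodePoint m K (A t) := hst
    rw [hst', hK.baryCoord_nodePoint hm (hsum t ht') ha, hA _ _ ha, hA _ _ ha] at h1
    have hm' : (m : ℝ) ≠ 0 := by exact_mod_cast hm
    field_simp at h1
    have h2 := (Nat.cast_injective h1 : _)
    simpa using h2.symm

/-- A polynomial of degree at most `m` that vanishes at the Lagrange nodes is zero. -/
lemma eq_zero_of_nodes (hK : IsSimplex K) (hm : m ≠ 0) {q : Poly d} (hq : q ∈ polySpace d m)
    (h : ∀ z ∈ lagrangeNodes m K, ev q z = 0) : q = 0 := by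
  classical
  let f : polySpace d m →ₗ[ℝ] (lagrangeNodes m K → ℝ) :=
    { toFun := fun q z => ev q.1 z
      map_add' := fun q r => by ext; simp
      map_smul' := fun c q => by ext; simp }
  -- The nodal basis makes evaluation at the nodes surjective; the dimension count then makes it
  -- injective.
  have hsurj : LinearMap.range f = ⊤ := by
    rw [LinearMap.range_eq_top]
    intro g
    refine ⟨∑ z, g z • ⟨lagrangeBasis m K z, hK.lagrangeBasis_mem hm z⟩, ?_⟩
    ext y
    change ev ((∑ z, g z • (⟨lagrangeBasis m K z, hK.lagrangeBasis_mem hm z⟩ : polySpace d m) :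
      polySpace d m) : Poly d) y = g y
    rw [Submodule.coe_sum, ev_sum, Finset.sum_eq_single y]
    · simp [(hK.lagrangeBasis_spec hm _).2 y y.2]
    · intro z _ hz
      have : (y : Point d) ≠ z := fun h => hz (Subtype.ext h.symm)
      simp [(hK.lagrangeBasis_spec hm _).2 y y.2, this]
    · simp
  have hr := LinearMap.finrank_range_add_finrank_ker f
  rw [hsurj, finrank_top, Module.finrank_fintype_fun_eq_card, Fintype.card_coe] at hr
  have h0 := hK.finrank_polySpace_le (m := m) hm
  have hker : LinearMap.ker f = ⊥ := Submodule.finrank_eq_zero.1 (by omega)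
  have : (⟨q, hq⟩ : polySpace d m) ∈ LinearMap.ker f := by
    rw [LinearMap.mem_ker]
    ext z
    exact h z z.2
  rw [hker, Submodule.mem_bot] at this
  exact congrArg Subtype.val this

lemma eq_sum_lagrangeBasis (hK : IsSimplex K) (hm : m ≠ 0) {q : Poly d} (hq : q ∈ polySpace d m) :
    q = ∑ z ∈ lagrangeNodes m K, MvPolynomial.C (ev q z) * lagrangeBasis m K z := by
  classical
  rw [← sub_eq_zero]
  refine hK.eq_zero_of_nodes hm (Submodule.sub_mem _ hq (Submodule.sum_mem _ fun z _ => ?_))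
    fun y hy => ?_
  · rw [← zero_add (m : ℤ)]
    exact mul_mem_polySpace (C_mem_polySpace _ le_rfl) (hK.lagrangeBasis_mem hm z)
  · simp only [ev_sub, ev_sum, ev_mul, ev_C, (hK.lagrangeBasis_spec hm _).2 y hy]
    simp [hy]

lemma lagrangeBasis_eq_zero (hK : IsSimplex K) (hm : m ≠ 0) {z : Point d}
    (hz : z ∉ lagrangeNodes m K) : lagrangeBasis m K z = 0 := by
  refine hK.eq_zero_of_nodes hm (hK.lagrangeBasis_mem hm z) fun y hy => ?_
  rw [(hK.lagrangeBasis_spec hm z).2 y hy, if_neg]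
  rintro rfl; exact hz hy

lemma lagrangeBasis_nodePoint (hK : IsSimplex K) (hm : m ≠ 0) {α : Point d → ℕ}
    (hα : ∑ a ∈ K, α a = m) :
    lagrangeBasis m K (nodePoint m K α) = lagrangeProd m K α := by
  rw [← sub_eq_zero]
  refine hK.eq_zero_of_nodes hm (Submodule.sub_mem _ (hK.lagrangeBasis_mem hm _)
    (hK.lagrangeProd_mem hα)) fun y hy => ?_
  rw [ev_sub, (hK.lagrangeBasis_spec hm _).2 y hy]
  split_ifs with h
  · rw [h, hK.ev_lagrangeProd_self hm hα, sub_self]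
  · obtain ⟨β, k1, k2, rfl⟩ := mem_lagrangeNodes.1 hy
    rw [hK.ev_lagrangeProd_ne hm hα k1, sub_self]
    by_contra! h'
    exact h (Finset.sum_congr rfl fun a ha => by rw [h' a ha])

lemma mem_lagrangeNodes_of_mem_hull (hK : IsSimplex K) (hm : m ≠ 0) {S : Finset (Point d)}
    (hS : S ⊆ K) {z : Point d} (hz : z ∈ lagrangeNodes m K) (hzS : z ∈ hull S) :
    z ∈ lagrangeNodes m S := by
  obtain ⟨α, h1, h2, rfl⟩ := mem_lagrangeNodes.1 hz
  have h0 : ∀ a ∈ K, a ∉ S → α a = 0 := by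
    intro a ha haS
    have := ((hK.mem_hull_iff hS).1 hzS).2 a ha haS
    rw [hK.baryCoord_nodePoint hm h1 ha, div_eq_zero_iff] at this
    rcases this with h | h
    · exact_mod_cast h
    · exact absurd (by exact_mod_cast h) hm
  refine mem_lagrangeNodes.2 ⟨α, ?_, fun a ha => ?_, ?_⟩
  · rw [← h1]; exact Finset.sum_subset hS h0
  · by_contra haS; exact ha (h0 a (h2 a ha) haS)
  · exact Finset.sum_subset hS fun a ha haS => by rw [h0 a ha haS]; simp

/-- A node off the face has α a ≠ 0 for some vertex `a` outside `S`. The factor with k = 0 is then a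
multiple of the coordinate of `a`, which vanishes on the face. -/
lemma lagrangeBasis_eq_zero_on (hK : IsSimplex K) (hm : m ≠ 0) {S : Finset (Point d)} (hS : S ⊆ K)
    {z : Point d} (hz : z ∉ hull S) {x : Point d} (hx : x ∈ hull S) :
    ev (lagrangeBasis m K z) x = 0 := by
  by_cases hzK : z ∈ lagrangeNodes m K
  · obtain ⟨α, h1, h2, rfl⟩ := mem_lagrangeNodes.1 hzK
    obtain ⟨a, ha, haS, hα⟩ : ∃ a ∈ K, a ∉ S ∧ α a ≠ 0 := by
      by_contra! h
      refine hz ((hK.mem_hull_iff hS).2 ⟨fun a ha => ?_, fun a ha haS => ?_⟩)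
      · rw [hK.baryCoord_nodePoint hm h1 ha]; positivity
      · rw [hK.baryCoord_nodePoint hm h1 ha, h a ha haS]; simp
    rw [hK.lagrangeBasis_nodePoint hm h1, ev_lagrangeProd]
    refine Finset.prod_eq_zero ha (Finset.prod_eq_zero
      (Finset.mem_range.2 (Nat.pos_of_ne_zero hα)) ?_)
    simp [((hK.mem_hull_iff hS).1 hx).2 a ha haS]
  · rw [hK.lagrangeBasis_eq_zero hm hzK, ev_zero]

/-- The restriction of a polynomial to a sub-simplex is determined by its values at the nodes. -/
lemma ev_eq_zero_of_nodes (hK : IsSimplex K) (hm : m ≠ 0) {S : Finset (Point d)} (hS : S ⊆ K)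
    {q : Poly d} (hq : q ∈ polySpace d m) (h : ∀ z ∈ lagrangeNodes m S, ev q z = 0) {x : Point d}
    (hx : x ∈ hull S) : ev q x = 0 := by
  rw [hK.eq_sum_lagrangeBasis hm hq, ev_sum]
  refine Finset.sum_eq_zero fun z hz => ?_
  by_cases hzS : z ∈ hull S
  · simp [h z (hK.mem_lagrangeNodes_of_mem_hull hm hS hz hzS)]
  · simp [hK.lagrangeBasis_eq_zero_on hm hS hzS hx]

/-- There are `m` factors (mλ - k)/(k + 1), each at most `m` in modulus because 0 ≤ λ ≤ 1 and 0 ≤ k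
≤ m. The bound does not see the shape of the simplex. -/
lemma abs_lagrangeBasis_le (hK : IsSimplex K) (hm : m ≠ 0) (z : Point d) {x : Point d}
    (hx : x ∈ hull K) : |ev (lagrangeBasis m K z) x| ≤ (m : ℝ) ^ m := by
  have hm1 : (1 : ℝ) ≤ m := by exact_mod_cast Nat.one_le_iff_ne_zero.2 hm
  by_cases hzK : z ∈ lagrangeNodes m K
  · obtain ⟨α, h1, h2, rfl⟩ := mem_lagrangeNodes.1 hzK
    rw [hK.lagrangeBasis_nodePoint hm h1, ev_lagrangeProd, Finset.abs_prod]
    calc ∏ a ∈ K, |∏ k ∈ Finset.range (α a), ((m : ℝ) * ev (baryCoord K a) x - k) / (k + 1)|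
        ≤ ∏ a ∈ K, (m : ℝ) ^ α a := by
          refine Finset.prod_le_prod (fun _ _ => abs_nonneg _) fun a ha => ?_
          rw [Finset.abs_prod]
          refine (Finset.prod_le_prod (g := fun _ => (m : ℝ)) (fun _ _ => abs_nonneg _)
            fun k hk => ?_).trans_eq (by simp)
          have hk' : (k : ℝ) ≤ m := by
            have h3 : α a ≤ m := h1 ▸ Finset.single_le_sum (fun _ _ => Nat.zero_le _) ha
            exact_mod_cast (Finset.mem_range.1 hk).le.trans h3
          have h4 := hK.baryCoord_nonneg hx ha
          have h5 := hK.baryCoord_le_one hx ha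
          have h6 : (0 : ℝ) ≤ k := by positivity
          rw [abs_div, abs_of_pos (by positivity : (0 : ℝ) < k + 1), div_le_iff₀ (by positivity),
            abs_le]
          constructor <;> nlinarith
      _ = (m : ℝ) ^ m := by rw [Finset.prod_pow_eq_pow_sum, h1]
  · rw [hK.lagrangeBasis_eq_zero hm hzK]; simp

end IsSimplex

lemma card_lagrangeNodes_le (m : ℕ) (K : Finset (Point d)) :
    (lagrangeNodes m K).card ≤ (m + 1) ^ K.card := by
  classical
  refine Finset.card_image_le.trans ?_
  have : (m + 1) ^ K.card = (Fintype.piFinset fun _ : K => Finset.range (m + 1)).card := by simp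
  rw [this]
  refine Finset.card_le_card_of_injOn (fun α a => α a) (fun α hα => ?_) fun α hα β hβ h => ?_
  · have hα' := Finset.mem_piAntidiag.1 hα
    simp only [Finset.mem_coe, Fintype.mem_piFinset, Finset.mem_range]
    intro a
    have := Finset.single_le_sum (f := α) (fun _ _ => Nat.zero_le _) a.2
    rw [hα'.1] at this
    omega
  · have hα' := Finset.mem_piAntidiag.1 hα
    have hβ' := Finset.mem_piAntidiag.1 hβ
    funext a
    by_cases ha : a ∈ K
    · exact congrFun h ⟨a, ha⟩
    · rw [not_imp_comm.1 (hα'.2 a) ha, not_imp_comm.1 (hβ'.2 a) ha]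

end Lagrange

/-! ### Weighted norms on the unit simplex -/

section ReferenceSimplex

/-- The unit simplex in `ℝ^n`. -/
def refSimplex (n : ℕ) : Set (Point n) := {x | (∀ i, 0 ≤ x i) ∧ ∑ i, x i ≤ 1}

/-- The product of the barycentric coordinates of the unit simplex. -/
def refWeight {n : ℕ} (x : Point n) : ℝ := (1 - ∑ i, x i) * ∏ i, x i

variable {n : ℕ}

lemma isClosed_refSimplex : IsClosed (refSimplex n) := by
  have h1 : refSimplex n = (⋂ i, {x : Point n | 0 ≤ x i}) ∩ {x : Point n | ∑ i, x i ≤ 1} := by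
    ext x; simp [refSimplex]
  rw [h1]
  refine (isClosed_iInter fun i => isClosed_le continuous_const (by fun_prop)).inter
    (isClosed_le (by fun_prop) continuous_const)

lemma coord_le_one_of_mem_refSimplex {x : Point n} (hx : x ∈ refSimplex n) (i : Fin n) : x i ≤ 1 :=
  (Finset.single_le_sum (f := fun i => x i) (fun j _ => hx.1 j) (Finset.mem_univ i)).trans hx.2

lemma isCompact_refSimplex : IsCompact (refSimplex n) := by
  refine Metric.isCompact_of_isClosed_isBounded isClosed_refSimplex
    ((Metric.isBounded_closedBall (x := 0) (r := √n)).subset fun x hx => ?_)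
  rw [mem_closedBall_zero_iff, EuclideanSpace.norm_eq]
  refine Real.sqrt_le_sqrt ?_
  calc ∑ i, ‖x i‖ ^ 2 ≤ ∑ _i : Fin n, (1 : ℝ) := Finset.sum_le_sum fun i _ => by
        rw [Real.norm_of_nonneg (hx.1 i)]
        exact pow_le_one₀ (hx.1 i) (coord_le_one_of_mem_refSimplex hx i)
    _ = n := by simp

/-- The interior of the unit simplex. -/
def refInterior (n : ℕ) : Set (Point n) := {x | (∀ i, 0 < x i) ∧ ∑ i, x i < 1}

lemma isOpen_refInterior : IsOpen (refInterior n) := by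
  have h1 : refInterior n = (⋂ i, {x : Point n | 0 < x i}) ∩ {x : Point n | ∑ i, x i < 1} := by
    ext x; simp [refInterior]
  rw [h1]
  refine (isOpen_iInter_of_finite fun i => isOpen_lt continuous_const (by fun_prop)).inter
    (isOpen_lt (by fun_prop) continuous_const)

lemma refInterior_nonempty : (refInterior n).Nonempty := by
  refine ⟨WithLp.toLp 2 fun _ => (n + 1 : ℝ)⁻¹, fun i => by simp; positivity, ?_⟩
  simp only [Finset.sum_const, Finset.card_univ, Fintype.card_fin, nsmul_eq_mul]
  rw [← div_eq_mul_inv, div_lt_one (by positivity)]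
  linarith

lemma refInterior_subset : refInterior n ⊆ refSimplex n :=
  fun _ hx => ⟨fun i => (hx.1 i).le, hx.2.le⟩

lemma volume_refSimplex_pos : 0 < (volume : Measure (Point n)).real (refSimplex n) := by
  refine ENNReal.toReal_pos (ne_of_gt ?_) isCompact_refSimplex.measure_lt_top.ne
  exact (isOpen_refInterior.measure_pos _ refInterior_nonempty).trans_le
    (measure_mono refInterior_subset)

lemma continuous_refWeight : Continuous (refWeight (n := n)) := by
  unfold refWeight; fun_prop

lemma refWeight_nonneg {x : Point n} (hx : x ∈ refSimplex n) : 0 ≤ refWeight x :=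
  mul_nonneg (by linarith [hx.2]) (Finset.prod_nonneg fun i _ => hx.1 i)

lemma refWeight_pos {x : Point n} (hx : x ∈ refInterior n) : 0 < refWeight x :=
  mul_pos (by linarith [hx.2]) (Finset.prod_pos fun i _ => hx.1 i)

lemma integrableOn_refSimplex {f : Point n → ℝ} (hf : Continuous f) :
    IntegrableOn f (refSimplex n) := hf.continuousOn.integrableOn_compact isCompact_refSimplex

/-- Weighted `L²` norms control the maximum norm of polynomials on the unit simplex. -/
lemma exists_sq_le_refSimplex (n m : ℕ) : ∃ C : ℝ, 0 ≤ C ∧ ∀ Q ∈ polySpace n m, ∀ x ∈ refSimplex n,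
    ev Q x ^ 2 ≤ C * ∫ y in refSimplex n, ev Q y ^ 2 * refWeight y := by
  let V := polySpace n m
  have hint : ∀ P Q : Poly n, IntegrableOn (fun y => ev P y * ev Q y * refWeight y) (refSimplex n) :=
    fun P Q => integrableOn_refSimplex
      (((continuous_ev P).mul (continuous_ev Q)).mul continuous_refWeight)
  let B : LinearMap.BilinForm ℝ V := LinearMap.mk₂ ℝ
    (fun P Q => ∫ y in refSimplex n, ev P.1 y * ev Q.1 y * refWeight y)
    (fun P P' Q => by
      rw [← integral_add (hint _ _) (hint _ _)]
      congr 1; ext y; simp; ring)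
    (fun c P Q => by
      rw [smul_eq_mul, ← integral_const_mul]
      congr 1; ext y; simp; ring)
    (fun P Q Q' => by
      rw [← integral_add (hint _ _) (hint _ _)]
      congr 1; ext y; simp; ring)
    (fun c P Q => by
      rw [smul_eq_mul, ← integral_const_mul]
      congr 1; ext y; simp; ring)
  have hB : ∀ P Q : V, B P Q = ∫ y in refSimplex n, ev P.1 y * ev Q.1 y * refWeight y :=
    fun _ _ => rfl
  have hs : ∀ P Q, B P Q = B Q P := fun P Q => by
    rw [hB, hB]; congr 1; ext y; ring
  have hnn : ∀ Q : V, 0 ≤ᵐ[volume.restrict (refSimplex n)]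
      fun y => ev Q.1 y * ev Q.1 y * refWeight y := fun Q => by
    filter_upwards [ae_restrict_mem isClosed_refSimplex.measurableSet] with y hy
    exact mul_nonneg (mul_self_nonneg _) (refWeight_nonneg hy)
  have h0 : ∀ Q, 0 ≤ B Q Q := fun Q => integral_nonneg_of_ae (hnn Q)
  -- The weight is positive in the interior, so `Q` vanishes on an open set.
  have hdef : ∀ Q : V, B Q Q = 0 → Q = 0 := by
    intro Q hQ
    rw [hB, setIntegral_eq_zero_iff_of_nonneg_ae (hnn Q) (hint _ _)] at hQ
    have h1 := Measure.eqOn_open_of_ae_eq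
      (ae_restrict_of_ae_restrict_of_subset refInterior_subset hQ) isOpen_refInterior
      (((continuous_ev Q.1).mul (continuous_ev Q.1)).mul continuous_refWeight).continuousOn
      continuousOn_const
    refine Subtype.ext (eq_of_ev_eqOn (S := refInterior n)
      (by rw [isOpen_refInterior.interior_eq]; exact refInterior_nonempty) fun x hx => ?_)
    have h2 : ev Q.1 x * ev Q.1 x * refWeight x = 0 := h1 hx
    simpa [(refWeight_pos hx).ne'] using h2
  have hf : {s : Fin n →₀ ℕ | (s.degree : ℤ) ≤ m}.Finite :=
    (Finsupp.finite_of_degree_le m).subset fun n hn => by simpa using hn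
  let D := hf.toFinset
  -- Each coefficient is a linear functional and hence controlled by the definite form; on the unit
  -- simplex the monomials are at most 1.
  have hcoef : ∀ s : Fin n →₀ ℕ, ∃ C, 0 ≤ C ∧ ∀ Q : V, MvPolynomial.coeff s Q.1 ^ 2 ≤ C * B Q Q := by
    intro s
    refine exists_sq_le B hs h0 ((MvPolynomial.lcoeff ℝ s).comp V.subtype) fun Q hQ => ?_
    rw [hdef Q hQ, map_zero]
  choose c hc0 hc using hcoef
  refine ⟨D.card * ∑ s ∈ D, c s, mul_nonneg (by positivity) (Finset.sum_nonneg fun s _ => hc0 s),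
    fun Q hQ x hx => ?_⟩
  have h1 : ∫ y in refSimplex n, ev Q y ^ 2 * refWeight y = B ⟨Q, hQ⟩ ⟨Q, hQ⟩ := by
    rw [hB]; congr 1; ext y; ring
  have h2 : ev Q x = ∑ s ∈ D, MvPolynomial.coeff s Q * ∏ i, x i ^ s i := by
    rw [ev, MvPolynomial.eval_eq']
    refine Finset.sum_subset (fun s hs => ?_) fun s _ hs => ?_
    · exact hf.mem_toFinset.2 ((MvPolynomial.mem_restrictSupport_iff ℝ).1 hQ hs)
    · rw [MvPolynomial.notMem_support_iff.1 hs, zero_mul]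
  rw [h1, h2, mul_assoc, Finset.sum_mul]
  refine sq_sum_le_card_mul_sum_sq.trans ?_
  gcongr with s hs
  rw [mul_pow]
  have h3 : ∏ i, x i ^ s i ≤ 1 := Finset.prod_le_one (fun i _ => pow_nonneg (hx.1 i) _)
    fun i _ => pow_le_one₀ (hx.1 i) (coord_le_one_of_mem_refSimplex hx i)
  have h4 : 0 ≤ ∏ i, x i ^ s i := Finset.prod_nonneg fun i _ => pow_nonneg (hx.1 i) _
  calc MvPolynomial.coeff s Q ^ 2 * (∏ i, x i ^ s i) ^ 2
      ≤ MvPolynomial.coeff s Q ^ 2 * 1 := by gcongr; exact pow_le_one₀ h4 h3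
    _ ≤ c s * B ⟨Q, hQ⟩ ⟨Q, hQ⟩ := by rw [mul_one]; exact hc s ⟨Q, hQ⟩

end ReferenceSimplex

/-! ### Affine maps from the unit simplex -/

section Parametrization

variable {d n : ℕ}

/-- The linear part of the affine parametrization of the simplex with vertices `a`. -/
def paramLin (a : Fin (n + 1) → Point d) : Point n →ₗ[ℝ] Point d where
  toFun x := ∑ i, x i • (a i.succ - a 0)
  map_add' x y := by simp [add_smul, Finset.sum_add_distrib]
  map_smul' c x := by simp [Finset.smul_sum, smul_smul]

/-- The affine parametrization of the simplex with vertices `a` over the unit simplex. -/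
def param (a : Fin (n + 1) → Point d) (x : Point n) : Point d := a 0 + paramLin a x

lemma continuous_param (a : Fin (n + 1) → Point d) : Continuous (param a) :=
  continuous_const.add (paramLin a).continuous_of_finiteDimensional

lemma param_eq_sum (a : Fin (n + 1) → Point d) (x : Point n) :
    param a x = ∑ j, (Fin.cons (1 - ∑ i, x i) x : Fin (n + 1) → ℝ) j • a j := by
  simp only [param, paramLin, LinearMap.coe_mk, AddHom.coe_mk, Fin.sum_univ_succ, Fin.cons_zero,
    Fin.cons_succ, smul_sub, Finset.sum_sub_distrib, sub_smul, one_smul, Finset.sum_smul]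
  abel

lemma sum_cons_eq_one (x : Point n) :
    ∑ j, (Fin.cons (1 - ∑ i, x i) x : Fin (n + 1) → ℝ) j = 1 := by
  rw [Fin.sum_univ_succ]; simp

lemma exists_poly_comp_param {m : ℕ} (a : Fin (n + 1) → Point d) {u : Poly d}
    (hu : u ∈ polySpace d m) : ∃ Q ∈ polySpace n m, ∀ x, ev Q x = ev u (param a x) := by
  let l : Fin d → Poly n := fun i =>
    MvPolynomial.C (a 0 i) + ∑ j, MvPolynomial.C (a j.succ i - a 0 i) * MvPolynomial.X j
  have hl : ∀ i, l i ∈ polySpace n (1 : ℕ) := fun i => by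
    refine Submodule.add_mem _ (C_mem_polySpace _ (by simp)) (Submodule.sum_mem _ fun j _ => ?_)
    rw [← zero_add ((1 : ℕ) : ℤ)]
    exact mul_mem_polySpace (C_mem_polySpace _ le_rfl) (X_mem_polySpace _ (by simp))
  refine ⟨MvPolynomial.aeval l u, ?_, fun x => ?_⟩
  · refine polySpace_induction (fun s hs => ?_) ?_ (fun q r hq hr => ?_) (fun c q hq => ?_) hu
    · rw [MvPolynomial.aeval_monomial, map_one, one_mul,
        Finsupp.prod_fintype _ _ (fun i => pow_zero _)]
      refine polySpace_mono hs ?_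
      rw [Finsupp.degree_eq_sum]
      refine prod_mem_polySpace _ fun i _ => ?_
      have := prod_mem_polySpace (Finset.range (s i)) (f := fun _ => l i) (m := fun _ => 1)
        fun _ _ => hl i
      simpa using this
    · rw [map_zero]; exact Submodule.zero_mem _
    · rw [map_add]; exact Submodule.add_mem _ hq hr
    · rw [map_smul]; exact Submodule.smul_mem _ _ hq
  · clear hu
    induction u using MvPolynomial.induction_on with
    | C c => simp
    | add q r hq hr => rw [map_add, ev_add, hq, hr, ev_add]
    | mul_X q i hq =>
      rw [map_mul, ev_mul, hq, ev_mul, ev_X, MvPolynomial.aeval_X]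
      congr 1
      simp [l, param, paramLin, Finset.sum_apply, mul_comm]

lemma exists_enumeration {S : Finset (Point d)} (hS : S.card = n + 1) :
    ∃ a : Fin (n + 1) → Point d, Function.Injective a ∧ Finset.univ.image a = S := by
  classical
  let e := (S.equivFinOfCardEq hS).symm
  refine ⟨fun i => e i, fun i j h => e.injective (Subtype.ext h), ?_⟩
  ext x
  simp only [Finset.mem_image, Finset.mem_univ, true_and]
  exact ⟨fun ⟨i, hi⟩ => hi ▸ (e i).2, fun hx => ⟨e.symm ⟨x, hx⟩, by simp⟩⟩

lemma hull_eq_image_param {S : Finset (Point d)} {a : Fin (n + 1) → Point d}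
    (ha : Function.Injective a) (haS : Finset.univ.image a = S) :
    hull S = param a '' refSimplex n := by
  classical
  ext x
  rw [hull, Finset.mem_convexHull', ← haS]
  simp only [Finset.sum_image ha.injOn, Finset.mem_image, Finset.mem_univ, true_and,
    forall_exists_index, forall_apply_eq_imp_iff]
  constructor
  · rintro ⟨w, h0, h1, rfl⟩
    refine ⟨WithLp.toLp 2 fun i => w (a i.succ), ⟨fun i => h0 _, ?_⟩, ?_⟩
    · rw [Fin.sum_univ_succ] at h1
      have := h0 0
      simp only
      linarith
    · rw [param_eq_sum]
      refine Finset.sum_congr rfl fun j _ => ?_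
      refine Fin.cases ?_ (fun i => ?_) j
      · rw [Fin.sum_univ_succ] at h1
        simp only [Fin.cons_zero]
        rw [← h1]; simp
      · simp
  · rintro ⟨y, ⟨hy0, hy1⟩, rfl⟩
    have hinv : ∀ j, Function.invFun a (a j) = j := Function.leftInverse_invFun ha
    refine ⟨fun p => (Fin.cons (1 - ∑ i, y i) y : Fin (n + 1) → ℝ) (Function.invFun a p),
      fun j => ?_, ?_, ?_⟩
    · simp only [hinv]
      refine Fin.cases ?_ (fun i => ?_) j
      · simpa using hy1
      · simpa using hy0 i
    · simp only [hinv]; exact sum_cons_eq_one y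
    · simp only [hinv]; exact (param_eq_sum a y).symm

namespace IsSimplex

variable {K S : Finset (Point d)}

lemma baryCoord_param (hK : IsSimplex K) (hS : S ⊆ K) {a : Fin (n + 1) → Point d}
    (ha : Function.Injective a) (haS : Finset.univ.image a = S) (x : Point n) (j : Fin (n + 1)) :
    ev (baryCoord K (a j)) (param a x) = (Fin.cons (1 - ∑ i, x i) x : Fin (n + 1) → ℝ) j := by
  classical
  have hmem : ∀ j, a j ∈ K := fun j => hS (haS ▸ Finset.mem_image_of_mem _ (Finset.mem_univ j))
  rw [param_eq_sum, ev_affine (hK.baryCoord_mem (hmem j)) _ _ _ (sum_cons_eq_one x),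
    Finset.sum_eq_single j]
  · simp [hK.ev_baryCoord_vertex (hmem j) (hmem j)]
  · intro i _ hij
    simp [hK.ev_baryCoord_vertex (hmem j) (hmem i), ha.ne hij.symm]
  · simp

lemma param_injective (hK : IsSimplex K) (hS : S ⊆ K) {a : Fin (n + 1) → Point d}
    (ha : Function.Injective a) (haS : Finset.univ.image a = S) :
    Function.Injective (param a) := by
  intro x y hxy
  ext i
  have h1 := hK.baryCoord_param hS ha haS x i.succ
  rw [hxy, hK.baryCoord_param hS ha haS y i.succ] at h1
  simpa using h1.symm

lemma weight_param (hK : IsSimplex K) (hS : S ⊆ K) {a : Fin (n + 1) → Point d}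
    (ha : Function.Injective a) (haS : Finset.univ.image a = S) (x : Point n) :
    ∏ p ∈ S, ev (baryCoord K p) (param a x) = refWeight x := by
  classical
  conv_lhs => rw [← haS]
  rw [Finset.prod_image ha.injOn]
  simp only [hK.baryCoord_param hS ha haS, Fin.prod_univ_succ, Fin.cons_zero, Fin.cons_succ, refWeight]

/-- The surface measure on a simplex is a multiple of the image of the Lebesgue measure. -/
lemma exists_restrict_hull_eq (hK : IsSimplex K) (hS : S ⊆ K) {a : Fin (n + 1) → Point d}
    (ha : Function.Injective a) (haS : Finset.univ.image a = S) : ∃ c : ℝ, 0 < c ∧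
      (μHE[n] : Measure (Point d)).restrict (hull S) =
        ENNReal.ofReal c • Measure.map (param a) (volume.restrict (refSimplex n)) := by
  have hinj := hK.param_injective hS ha haS
  have hlin : Function.Injective (paramLin a) := fun x y h => hinj (by rw [param, param, h])
  -- The factor is the determinant of the linear part onto its range; it is nonzero because the
  -- parametrization is injective.
  refine ⟨(paramLin a).normDet, lt_of_le_of_ne (LinearMap.normDet_nonneg _) fun h => ?_, ?_⟩
  · exact (LinearMap.normDet_eq_zero_iff_ker_ne_bot.1 h.symm) (LinearMap.ker_eq_bot.2 hlin)
  · ext A hA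
    have h1 : A ∩ hull S = (a 0 + ·) '' (paramLin a '' (param a ⁻¹' A ∩ refSimplex n)) := by
      rw [hull_eq_image_param ha haS, Set.image_image]
      change _ = param a '' _
      rw [Set.image_preimage_inter, ← hull_eq_image_param ha haS]
    have h2 := LinearMap.euclideanHausdorffMeasure_image_eq_normDet_mul_volume (paramLin a)
      (param a ⁻¹' A ∩ refSimplex n)
    rw [finrank_euclideanSpace_fin] at h2
    rw [Measure.restrict_apply hA, h1, (isometry_add_left (a 0)).euclideanHausdorffMeasure_image, h2,
      Measure.smul_apply, Measure.map_apply (continuous_param a).measurable hA,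
      Measure.restrict_apply ((continuous_param a).measurable hA), smul_eq_mul]

end IsSimplex

end Parametrization

/-! ### Norm equivalences on arbitrary simplices -/

section Simplex

variable {d n : ℕ}

/-- The `n`-dimensional measure of a simplex. -/
def area (n : ℕ) (S : Finset (Point d)) : ℝ := (μHE[n] : Measure (Point d)).real (hull S)

namespace IsSimplex

variable {K S : Finset (Point d)}

lemma exists_param (hK : IsSimplex K) (hS : S ⊆ K) (hn : S.card = n + 1) :
    ∃ (a : Fin (n + 1) → Point d) (c : ℝ), Function.Injective a ∧ Finset.univ.image a = S ∧ 0 < c ∧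
      (μHE[n] : Measure (Point d)).restrict (hull S) =
        ENNReal.ofReal c • Measure.map (param a) (volume.restrict (refSimplex n)) := by
  obtain ⟨a, ha, haS⟩ := exists_enumeration hn
  obtain ⟨c, hc, h⟩ := hK.exists_restrict_hull_eq hS ha haS
  exact ⟨a, c, ha, haS, hc, h⟩

lemma measure_hull_lt_top (hK : IsSimplex K) (hS : S ⊆ K) (hn : S.card = n + 1) :
    (μHE[n] : Measure (Point d)) (hull S) < ⊤ := by
  obtain ⟨a, c, ha, haS, hc, h⟩ := hK.exists_param hS hn
  rw [← Measure.restrict_apply_univ, h, Measure.smul_apply,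
    Measure.map_apply (continuous_param a).measurable .univ, Set.preimage_univ,
    Measure.restrict_apply_univ]
  exact ENNReal.mul_lt_top ENNReal.ofReal_lt_top isCompact_refSimplex.measure_lt_top

lemma area_pos (hK : IsSimplex K) (hS : S ⊆ K) (hn : S.card = n + 1) : 0 < area n S := by
  obtain ⟨a, c, ha, haS, hc, h⟩ := hK.exists_param hS hn
  rw [area, measureReal_def, ← Measure.restrict_apply_univ, h, Measure.smul_apply,
    Measure.map_apply (continuous_param a).measurable .univ, Set.preimage_univ,
    Measure.restrict_apply_univ, smul_eq_mul, ENNReal.toReal_mul, ENNReal.toReal_ofReal hc.le]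
  exact mul_pos hc volume_refSimplex_pos

lemma integrableOn_hull (hK : IsSimplex K) (hS : S ⊆ K) (hn : S.card = n + 1) {f : Point d → ℝ}
    (hf : Continuous f) : IntegrableOn f (hull S) (μHE[n] : Measure (Point d)) :=
  hf.continuousOn.integrableOn_of_subset_isCompact (isCompact_hull S) (measurableSet_hull S)
    subset_rfl (hK.measure_hull_lt_top hS hn).ne

lemma integral_le_area_mul (hK : IsSimplex K) (hS : S ⊆ K) (hn : S.card = n + 1) {f : Point d → ℝ}
    (hf : Continuous f) {M : ℝ} (hM : ∀ x ∈ hull S, f x ≤ M) :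
    ∫ x in hull S, f x ∂(μHE[n] : Measure (Point d)) ≤ area n S * M := by
  have : ∫ _x in hull S, M ∂(μHE[n] : Measure (Point d)) = area n S * M := by
    rw [setIntegral_const, smul_eq_mul, area]
  rw [← this]
  exact setIntegral_mono_on (hK.integrableOn_hull hS hn hf)
    (hK.integrableOn_hull hS hn continuous_const) (measurableSet_hull S) hM

lemma weight_mem_Icc (hK : IsSimplex K) (hS : S ⊆ K) {x : Point d} (hx : x ∈ hull S) :
    ∏ p ∈ S, ev (baryCoord K p) x ∈ Set.Icc (0 : ℝ) 1 := by
  have hx' := hull_mono hS hx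
  exact ⟨Finset.prod_nonneg fun p hp => hK.baryCoord_nonneg hx' (hS hp),
    Finset.prod_le_one (fun p hp => hK.baryCoord_nonneg hx' (hS hp))
      fun p hp => hK.baryCoord_le_one hx' (hS hp)⟩

lemma continuous_weight : Continuous fun x : Point d => ∏ p ∈ S, ev (baryCoord K p) x :=
  continuous_finsetProd _ fun _ _ => continuous_ev _

end IsSimplex

/-- Weighted `L²` norms control the maximum norm of polynomials on a simplex, uniformly in the
simplex. -/
lemma exists_sq_mul_area_le (n m : ℕ) : ∃ C : ℝ, 0 < C ∧ ∀ (d : ℕ) (K S : Finset (Point d)),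
    IsSimplex K → S ⊆ K → S.card = n + 1 → ∀ u ∈ polySpace d m, ∀ x ∈ hull S,
      ev u x ^ 2 * area n S ≤ C * ∫ y in hull S, ev u y ^ 2 * ∏ p ∈ S, ev (baryCoord K p) y
        ∂(μHE[n] : Measure (Point d)) := by
  obtain ⟨C, hC, hmain⟩ := exists_sq_le_refSimplex n m
  have hv := volume_refSimplex_pos (n := n)
  -- The factor of the parametrization multiplies both the area and the integral and drops out, so
  -- the constant only sees the unit simplex. The summand 1 makes it positive.
  refine ⟨C * (volume : Measure (Point n)).real (refSimplex n) + 1, by positivity,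
    fun d K S hK hS hn u hu x hx => ?_⟩
  obtain ⟨a, c, ha, haS, hc, h⟩ := hK.exists_param hS hn
  have harea : area n S = c * (volume : Measure (Point n)).real (refSimplex n) := by
    rw [area, measureReal_def, ← Measure.restrict_apply_univ, h, Measure.smul_apply,
      Measure.map_apply (continuous_param a).measurable .univ, Set.preimage_univ,
      Measure.restrict_apply_univ, smul_eq_mul, ENNReal.toReal_mul, ENNReal.toReal_ofReal hc.le]
    rfl
  have hcont : Continuous fun y => ev u y ^ 2 * ∏ p ∈ S, ev (baryCoord K p) y :=
    ((continuous_ev u).pow 2).mul IsSimplex.continuous_weight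
  obtain ⟨Q, hQ, hQe⟩ := exists_poly_comp_param a hu
  have hint : ∫ y in hull S, ev u y ^ 2 * ∏ p ∈ S, ev (baryCoord K p) y
      ∂(μHE[n] : Measure (Point d)) = c * ∫ y in refSimplex n, ev Q y ^ 2 * refWeight y := by
    rw [h, integral_smul_measure, ENNReal.toReal_ofReal hc.le, smul_eq_mul,
      integral_map (continuous_param a).aemeasurable hcont.aestronglyMeasurable]
    simp only [hK.weight_param hS ha haS, hQe]
  rw [hull_eq_image_param ha haS] at hx
  obtain ⟨y, hy, rfl⟩ := hx
  have h1 := hmain Q hQ y hy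
  rw [hQe] at h1
  have h2 : 0 ≤ ∫ y in refSimplex n, ev Q y ^ 2 * refWeight y :=
    setIntegral_nonneg isClosed_refSimplex.measurableSet fun z hz =>
      mul_nonneg (sq_nonneg _) (refWeight_nonneg hz)
  rw [hint, harea]
  calc _ ≤ (C * ∫ y in refSimplex n, ev Q y ^ 2 * refWeight y) *
        (c * (volume : Measure (Point n)).real (refSimplex n)) := by gcongr
    _ ≤ _ := by nlinarith [mul_nonneg hc.le h2]

/-- `L²` norms control the maximum norm of polynomials on a simplex, uniformly in the simplex. -/
lemma exists_sq_mul_area_le_integral_sq (n m : ℕ) : ∃ C : ℝ, 0 < C ∧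
    ∀ (d : ℕ) (K S : Finset (Point d)), IsSimplex K → S ⊆ K → S.card = n + 1 →
      ∀ u ∈ polySpace d m, ∀ x ∈ hull S,
        ev u x ^ 2 * area n S ≤ C * ∫ y in hull S, ev u y ^ 2 ∂(μHE[n] : Measure (Point d)) := by
  obtain ⟨C, hC, hmain⟩ := exists_sq_mul_area_le n m
  refine ⟨C, hC, fun d K S hK hS hn u hu x hx => (hmain d K S hK hS hn u hu x hx).trans ?_⟩
  refine mul_le_mul_of_nonneg_left ?_ hC.le
  have h1 : Continuous fun y => ev u y ^ 2 := (continuous_ev u).pow 2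
  refine setIntegral_mono_on (hK.integrableOn_hull hS hn (h1.mul IsSimplex.continuous_weight))
    (hK.integrableOn_hull hS hn h1) (measurableSet_hull S) fun y hy => ?_
  exact mul_le_of_le_one_right (sq_nonneg _) (hK.weight_mem_Icc hS hy).2

end Simplex

/-! ### Gradients of barycentric coordinates -/

section Affine

variable {d : ℕ}

/-- Increments of an affine function do not depend on the base point, by the affine combination with
weights 1, 1, -1. So the gradient may be taken at an arbitrary `z`, which justifies evaluating it at
0 in `baryGrad`. -/
lemma ev_sub_eq_inner {q : Poly d} (hq : q ∈ polySpace d 1) (x y z : Point d) :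
    ev q x - ev q y = ⟪grad q z, x - y⟫_ℝ := by
  have h : ∀ t : ℝ, ev q (y + t • (x - y)) = ev q y + t * (ev q x - ev q y) := by
    intro t
    have := ev_affine hq Finset.univ ![1 - t, t] ![y, x] (by simp)
    simp only [Fin.sum_univ_two, Matrix.cons_val_zero, Matrix.cons_val_one] at this
    rw [show y + t • (x - y) = (1 - t) • y + t • x by rw [sub_smul, smul_sub, one_smul]; abel, this]
    ring
  have hg : ∀ w z : Point d, ⟪grad q z, w⟫_ℝ = ev q (z + w) - ev q z := by
    intro w z
    have h1 := hasDerivAt_ev_line q z w 0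
    have h2 : ∀ t : ℝ, ev q (z + t • w) = ev q z + t * (ev q (z + w) - ev q z) := by
      intro t
      have := ev_affine hq Finset.univ ![1 - t, t] ![z, z + w] (by simp)
      simp only [Fin.sum_univ_two, Matrix.cons_val_zero, Matrix.cons_val_one] at this
      rw [show z + t • w = (1 - t) • z + t • (z + w) by
        rw [sub_smul, smul_add, one_smul]; abel, this]
      ring
    have h3 : HasDerivAt (fun t : ℝ => ev q (z + t • w)) (ev q (z + w) - ev q z) 0 := by
      simp only [h2]
      simpa using ((hasDerivAt_id (0 : ℝ)).mul_const (ev q (z + w) - ev q z)).const_add (ev q z)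
    simpa using h1.unique h3
  have hc : ∀ w, ev q (z + w) - ev q z = ev q (y + w) - ev q y := by
    intro w
    have := ev_affine hq Finset.univ ![(1 : ℝ), 1, -1] ![z, y + w, y]
      (by rw [Fin.sum_univ_three]; simp)
    simp only [Fin.sum_univ_three, Matrix.cons_val_zero, Matrix.cons_val_one, Matrix.cons_val,
      one_smul, neg_smul] at this
    rw [show z + w = z + (y + w) + -y by abel, this]
    ring
  rw [hg, hc, add_sub_cancel]

/-- The gradient of a barycentric coordinate. -/
def baryGrad (K : Finset (Point d)) (a : Point d) : Point d := grad (baryCoord K a) 0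

namespace IsSimplex

variable {K : Finset (Point d)}

lemma baryCoord_sub (hK : IsSimplex K) {a : Point d} (ha : a ∈ K) (x y : Point d) :
    ev (baryCoord K a) x - ev (baryCoord K a) y = ⟪baryGrad K a, x - y⟫_ℝ :=
  ev_sub_eq_inner (hK.baryCoord_mem ha) x y 0

lemma exists_ne_vertex (hK : IsSimplex K) (hd : d ≠ 0) (a : Point d) : ∃ b ∈ K, b ≠ a :=
  Finset.exists_mem_ne (by rw [hK.card]; omega) a

lemma baryGrad_ne_zero (hK : IsSimplex K) (hd : d ≠ 0) {a : Point d} (ha : a ∈ K) :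
    baryGrad K a ≠ 0 := by
  intro h
  obtain ⟨b, hb, hba⟩ := hK.exists_ne_vertex hd a
  have := hK.baryCoord_sub ha a b
  rw [hK.ev_baryCoord_vertex ha ha, hK.ev_baryCoord_vertex ha hb, h] at this
  simp [hba.symm] at this

/-- The derivative along `v` of the identity ∑ λ_b(x) b = x. With the vanishing of ∑ ⟨∇λ_b, v⟩ it
expands `v` in the edges at any vertex. -/
lemma sum_inner_baryGrad_smul (hK : IsSimplex K) (v : Point d) :
    ∑ b ∈ K, ⟪baryGrad K b, v⟫_ℝ • b = v := by
  have h : ∀ b ∈ K, ⟪baryGrad K b, v⟫_ℝ • b =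
      ev (baryCoord K b) v • b - ev (baryCoord K b) 0 • b := fun b hb => by
    rw [← sub_smul, hK.baryCoord_sub hb, sub_zero]
  rw [Finset.sum_congr rfl h, Finset.sum_sub_distrib, hK.sum_baryCoord_smul, hK.sum_baryCoord_smul,
    sub_zero]

lemma sum_inner_baryGrad (hK : IsSimplex K) (v : Point d) : ∑ b ∈ K, ⟪baryGrad K b, v⟫_ℝ = 0 := by
  have h : ∀ b ∈ K, ⟪baryGrad K b, v⟫_ℝ =
      ev (baryCoord K b) v - ev (baryCoord K b) 0 := fun b hb => by
    rw [hK.baryCoord_sub hb, sub_zero]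
  rw [Finset.sum_congr rfl h, Finset.sum_sub_distrib, hK.sum_baryCoord, hK.sum_baryCoord, sub_self]

end IsSimplex

end Affine

/-! ### Simplices as cones and integration by parts -/

section Cone

variable {d : ℕ}

/-- The measure `s ^ n ds` on the unit interval. -/
def powMeasure (n : ℕ) : Measure ℝ :=
  (volume.restrict (Set.Ioc 0 1)).withDensity fun s => ENNReal.ofReal (s ^ n)

lemma integral_powMeasure (n : ℕ) (f : ℝ → ℝ) :
    ∫ s, f s ∂powMeasure n = ∫ s in (0 : ℝ)..1, s ^ n * f s := by
  have hm : Measurable fun s : ℝ => ENNReal.ofReal (s ^ n) := by fun_prop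
  rw [powMeasure, integral_withDensity_eq_integral_toReal_smul hm (by simp),
    intervalIntegral.integral_of_le zero_le_one]
  refine setIntegral_congr_fun measurableSet_Ioc fun s hs => ?_
  simp only [smul_eq_mul]
  rw [ENNReal.toReal_ofReal (pow_nonneg hs.1.le n)]

instance (n : ℕ) : SFinite (powMeasure n) := by unfold powMeasure; infer_instance

namespace IsSimplex

open scoped Classical in
lemma face_card {K : Finset (Point d)} (hK : IsSimplex K) (hd : d ≠ 0) {a : Point d} (ha : a ∈ K) :
    (K.erase a).card = d - 1 + 1 := by
  rw [Finset.card_erase_of_mem ha, hK.card]; omega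

variable {K : Finset (Point d)}

open scoped Classical in
-- The homothety with centre `a` and ratio `s` multiplies λ_b, b ≠ a, and 1 - λ_a by `s`. These
-- slices are the fibres over which the volume is disintegrated.
lemma slice_eq (hK : IsSimplex K) {a : Point d} (ha : a ∈ K) {s : ℝ}
    (hs : s ∈ Set.Ioc (0 : ℝ) 1) :
    hull K ∩ {y | ev (baryCoord K a) y = 1 - s} =
      AffineMap.homothety a s '' hull (K.erase a) := by
  have hval : ∀ (w : Point d) (b) (_ : b ∈ K), ev (baryCoord K b) (AffineMap.homothety a s w) =
      s * ev (baryCoord K b) w + (1 - s) * if b = a then 1 else 0 := by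
    intro w b hb
    have := ev_affine (hK.baryCoord_mem hb) Finset.univ ![s, 1 - s] ![w, a] (by simp)
    simp only [Fin.sum_univ_two, Matrix.cons_val_zero, Matrix.cons_val_one,
      hK.ev_baryCoord_vertex hb ha] at this
    rw [AffineMap.homothety_apply, ← this]
    congr 1
    simp only [vsub_eq_sub, vadd_eq_add, smul_sub, sub_smul, one_smul]
    abel
  have hbij : Function.Surjective (AffineMap.homothety (k := ℝ) a s) := by
    intro y
    refine ⟨AffineMap.homothety a s⁻¹ y, ?_⟩
    rw [← AffineMap.homothety_mul_apply, mul_inv_cancel₀ hs.1.ne',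
      AffineMap.homothety_one, AffineMap.id_apply]
  have hsub := Finset.erase_subset a K
  ext y
  obtain ⟨w, rfl⟩ := hbij y
  have hinj : Function.Injective (AffineMap.homothety (k := ℝ) a s) := by
    intro y z hyz
    simpa [AffineMap.homothety_apply, hs.1.ne'] using hyz
  rw [hinj.mem_set_image, Set.mem_inter_iff, hK.mem_hull_self_iff, hK.mem_hull_iff hsub,
    Set.mem_ofPred_eq, hval w a ha]
  constructor
  · rintro ⟨h1, h2⟩
    have h3 : ev (baryCoord K a) w = 0 := by
      have : s * ev (baryCoord K a) w = 0 := by simpa using h2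
      simpa [hs.1.ne'] using this
    refine ⟨fun b hb => ?_, fun b hb hbe => ?_⟩
    · rcases eq_or_ne b a with rfl | hba
      · exact h3.ge
      · have := h1 b hb
        rw [hval w b hb, if_neg hba, mul_zero, add_zero] at this
        exact nonneg_of_mul_nonneg_right this hs.1
    · have : b = a := by simpa [hb] using hbe
      rw [this, h3]
  · rintro ⟨h1, h2⟩
    have h3 := h2 a ha (by simp)
    refine ⟨fun b hb => ?_, by rw [h3]; simp⟩
    rw [hval w b hb]
    refine add_nonneg (mul_nonneg hs.1.le (h1 b hb)) (mul_nonneg (by linarith [hs.2]) ?_)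
    split_ifs <;> norm_num

open scoped Classical in
/-- The Lebesgue measure on a simplex as the measure of a cone over one of its faces. -/
lemma volume_restrict_eq_cone (hK : IsSimplex K) (hd : d ≠ 0) {a : Point d} (ha : a ∈ K) :
    (volume : Measure (Point d)).restrict (hull K) = ENNReal.ofReal ‖baryGrad K a‖⁻¹ •
      Measure.map (fun p : ℝ × Point d => AffineMap.homothety a p.1 p.2)
        ((powMeasure (d - 1)).prod
          ((μHE[d - 1] : Measure (Point d)).restrict (hull (K.erase a)))) := by
  have hFfin := hK.measure_hull_lt_top (Finset.erase_subset a K) (hK.face_card hd ha)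
  have : IsFiniteMeasure ((μHE[d - 1] : Measure (Point d)).restrict (hull (K.erase a))) :=
    ⟨by rwa [Measure.restrict_apply_univ]⟩
  set G := baryGrad K a with hG
  have hG0 : G ≠ 0 := hK.baryGrad_ne_zero hd ha
  have hGn : 0 < ‖G‖ := norm_pos_iff.2 hG0
  have hcont : Continuous fun p : ℝ × Point d => AffineMap.homothety a p.1 p.2 := by
    simp only [AffineMap.homothety_apply, vsub_eq_sub, vadd_eq_add]
    fun_prop
  -- The perpendicular from `a` to the hyperplane of the opposite face: λ_a decreases by `s` along
  -- s•v, and the length 1/‖G‖ is the height of the simplex.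
  set v : Point d := -(‖G‖ ^ 2)⁻¹ • G with hv
  have hv0 : v ≠ 0 := by simp [hv, hG0]
  have hvn : ‖v‖ = ‖G‖⁻¹ := by
    rw [hv, norm_smul, norm_neg, norm_inv, norm_pow, norm_norm]
    field_simp
  have hplane : ∀ (s : ℝ) (y : Point d),
      y ∈ AffineSubspace.mk' (s • v +ᵥ a) (ℝ ∙ v)ᗮ ↔ ev (baryCoord K a) y = 1 - s := by
    intro s y
    have h1 := hK.baryCoord_sub ha y a
    rw [hK.ev_baryCoord_vertex ha ha, if_pos rfl, ← hG] at h1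
    rw [AffineSubspace.mem_mk', Submodule.mem_orthogonal_singleton_iff_inner_right]
    have h2 : ⟪v, y -ᵥ (s • v +ᵥ a)⟫_ℝ = -(‖G‖ ^ 2)⁻¹ * (⟪G, y - a⟫_ℝ + s) := by
      rw [vsub_eq_sub, vadd_eq_add, show y - (s • v + a) = (y - a) - s • v by abel, inner_sub_right,
        inner_smul_right, real_inner_self_eq_norm_sq, hvn, hv, inner_smul_left]
      simp only [RCLike.conj_to_real]
      field_simp
      ring
    rw [h2, mul_eq_zero, ← h1]
    constructor
    · rintro (h | h)
      · simp [hG0] at h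
      · linarith
    · intro h; right; linarith
  ext A hA
  -- Slicing by hyperplanes orthogonal to `v`. The parameter is measured in units of the height,
  -- which produces the factor in front.
  have hslice := EuclideanGeometry.euclideanHausdorffMeasure_eq_lintegral a hv0
    (hA.inter (measurableSet_hull K))
  rw [finrank_euclideanSpace_fin, EuclideanSpace.euclideanHausdorffMeasure_eq_volume] at hslice
  rw [Measure.restrict_apply hA, hslice, Measure.smul_apply, Measure.map_apply hcont.measurable hA,
    Measure.prod_apply (hcont.measurable hA), powMeasure,
    lintegral_withDensity_eq_lintegral_mul _ (by fun_prop)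
      (measurable_measure_prodMk_left (hcont.measurable hA)), smul_eq_mul,
    ← ofReal_norm, hvn, ← lintegral_indicator measurableSet_Ioc]
  congr 1
  have hne : ∀ᵐ s : ℝ, s ≠ 0 := by simp [ae_iff]
  refine lintegral_congr_ae ?_
  filter_upwards [hne] with s hs0
  have hset : A ∩ hull K ∩ AffineSubspace.mk' (s • v +ᵥ a) (ℝ ∙ v)ᗮ =
      A ∩ (hull K ∩ {y | ev (baryCoord K a) y = 1 - s}) := by
    ext y
    simp only [Set.mem_inter_iff, SetLike.mem_coe, hplane, Set.mem_ofPred_eq, and_assoc]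
  rw [hset]
  -- For these `s` the slice is the image of the face under a homothety of ratio `s`, which
  -- multiplies its measure by s^(d-1); for other nonzero `s` it is empty.
  by_cases hs : s ∈ Set.Ioc (0 : ℝ) 1
  · rw [Set.indicator_of_mem hs, hK.slice_eq ha hs, Pi.mul_apply,
      Measure.restrict_apply (measurable_prodMk_left (hcont.measurable hA))]
    have : A ∩ AffineMap.homothety a s '' hull (K.erase a) = AffineMap.homothety a s ''
        (Prod.mk s ⁻¹' ((fun p : ℝ × Point d => AffineMap.homothety a p.1 p.2) ⁻¹' A) ∩
          hull (K.erase a)) := by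
      rw [← Set.preimage_comp]
      exact (Set.image_preimage_inter _ _ _).symm
    rw [this, euclideanHausdorffMeasure_homothety_image _ _ hs0, ENNReal.smul_def, smul_eq_mul]
    congr 1
    rw [← Real.toNNReal_eq_nnnorm_of_nonneg hs.1.le, ENNReal.ofReal, Real.toNNReal_pow hs.1.le]
  · rw [Set.indicator_of_notMem hs]
    have : A ∩ (hull K ∩ {y | ev (baryCoord K a) y = 1 - s}) = ∅ := by
      rw [Set.eq_empty_iff_forall_notMem]
      rintro y ⟨-, hy, hys⟩
      have h1 := hK.baryCoord_nonneg hy ha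
      have h2 := hK.baryCoord_le_one hy ha
      rw [Set.mem_ofPred_eq] at hys
      refine hs ⟨lt_of_le_of_ne (by linarith) hs0.symm, by linarith⟩
    rw [this, measure_empty]

end IsSimplex

lemma cellInt_eq (K : Finset (Point d)) (f : Point d → ℝ) :
    cellInt K f = ∫ x in hull K, f x ∂(μHE[d] : Measure (Point d)) := by
  rw [cellInt, EuclideanSpace.euclideanHausdorffMeasure_eq_volume]

namespace IsSimplex

variable {K : Finset (Point d)}

open scoped Classical in
-- The divergence theorem for the field f(x)(x - a): it is tangential on the faces through `a`, so
-- only the opposite face contributes.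
lemma cellInt_radial (hK : IsSimplex K) (hd : d ≠ 0) {a : Point d} (ha : a ∈ K) (f : Poly d) :
    cellInt K (fun x => d * ev f x + ⟪grad f x, x - a⟫_ℝ) =
      ‖baryGrad K a‖⁻¹ * faceInt (K.erase a) (ev f) := by
  have hFfin := hK.measure_hull_lt_top (Finset.erase_subset a K) (hK.face_card hd ha)
  have : IsFiniteMeasure ((μHE[d - 1] : Measure (Point d)).restrict (hull (K.erase a))) :=
    ⟨by rwa [Measure.restrict_apply_univ]⟩
  have hcone := hK.volume_restrict_eq_cone hd ha
  have hcont : Continuous fun p : ℝ × Point d => AffineMap.homothety a p.1 p.2 := by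
    simp only [AffineMap.homothety_apply, vsub_eq_sub, vadd_eq_add]
    fun_prop
  have hGn : 0 < ‖baryGrad K a‖ := norm_pos_iff.2 (hK.baryGrad_ne_zero hd ha)
  have hf : Continuous fun x => d * ev f x + ⟪grad f x, x - a⟫_ℝ :=
    (continuous_const.mul (continuous_ev f)).add
      ((continuous_grad f).inner (continuous_id.sub continuous_const))
  have hint : Integrable (fun x => d * ev f x + ⟪grad f x, x - a⟫_ℝ) (volume.restrict (hull K)) :=
    hf.continuousOn.integrableOn_compact (isCompact_hull K)
  rw [hcone, integrable_smul_measure (by simpa using hGn) (by simp),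
    integrable_map_measure hf.aestronglyMeasurable hcont.aemeasurable] at hint
  simp only [Function.comp_def] at hint
  rw [cellInt, hcone, integral_smul_measure, ENNReal.toReal_ofReal (by positivity), smul_eq_mul,
    integral_map hcont.aemeasurable hf.aestronglyMeasurable, integral_prod_symm _ hint, faceInt]
  congr 1
  refine integral_congr_ae (Filter.Eventually.of_forall fun w => ?_)
  simp only
  rw [integral_powMeasure]
  -- On each ray the integrand with its weight s^(d-1) is the derivative of s^d f; the end point s =
  -- 0 contributes nothing because d ≠ 0.
  have hder : ∀ s : ℝ, HasDerivAt (fun s : ℝ => s ^ d * ev f (a + s • (w - a)))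
      (s ^ (d - 1) * (d * ev f (AffineMap.homothety a s w) +
        ⟪grad f (AffineMap.homothety a s w), AffineMap.homothety a s w - a⟫_ℝ)) s := by
    intro s
    have h1 := (hasDerivAt_pow d s).mul (hasDerivAt_ev_line f a (w - a) s)
    have h2 : AffineMap.homothety a s w = a + s • (w - a) := by
      rw [AffineMap.homothety_apply, vsub_eq_sub, vadd_eq_add, add_comm]
    rw [h2]
    refine h1.congr_deriv ?_
    rw [add_sub_cancel_left, inner_smul_right]
    obtain ⟨n, rfl⟩ := Nat.exists_eq_succ_of_ne_zero hd
    simp only [Nat.succ_eq_add_one, Nat.add_sub_cancel]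
    ring
  rw [intervalIntegral.integral_eq_sub_of_hasDerivAt (fun s _ => hder s)
    (Continuous.intervalIntegrable (by
      refine (continuous_pow _).mul (hf.comp (hcont.comp (by fun_prop : Continuous fun s : ℝ => (s, w))))) _ _)]
  simp [hd]

open scoped Classical in
/-- Integration by parts on a simplex. -/
lemma cellInt_inner_grad (hK : IsSimplex K) (hd : d ≠ 0) (f : Poly d) (v : Point d) :
    cellInt K (fun x => ⟪grad f x, v⟫_ℝ) =
      ∑ b ∈ K, ⟪-(‖baryGrad K b‖⁻¹ • baryGrad K b), v⟫_ℝ * faceInt (K.erase b) (ev f) := by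
  have hi : ∀ {g : Point d → ℝ}, Continuous g → IntegrableOn g (hull K) volume := fun hg =>
    hg.continuousOn.integrableOn_compact (isCompact_hull K)
  obtain ⟨a, ha⟩ := hK.nonempty
  have hrad : ∀ b : Point d, Continuous fun x => d * ev f x + ⟪grad f x, x - b⟫_ℝ := fun b =>
    (continuous_const.mul (continuous_ev f)).add
      ((continuous_grad f).inner (continuous_id.sub continuous_const))
  -- In the difference of the radial identities for `a` and `b` the terms d·f cancel and the
  -- constant direction b - a remains.
  have hdiff : ∀ b ∈ K, cellInt K (fun x => ⟪grad f x, b - a⟫_ℝ) =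
      ‖baryGrad K a‖⁻¹ * faceInt (K.erase a) (ev f) -
        ‖baryGrad K b‖⁻¹ * faceInt (K.erase b) (ev f) := by
    intro b hb
    rw [← hK.cellInt_radial hd ha, ← hK.cellInt_radial hd hb, cellInt, cellInt, cellInt,
      ← integral_sub (hi (hrad a)) (hi (hrad b))]
    congr 1
    ext x
    rw [show b - a = (x - a) - (x - b) by abel, inner_sub_right]
    ring
  -- Expansion of `v` in the edges from `a`. In the resulting sum the face opposite to `a` has the
  -- coefficient ∑ ⟨∇λ_b, v⟩ = 0 from the first term of `hdiff`, so only the second terms survive.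
  have hexp : ∀ x, ⟪grad f x, v⟫_ℝ = ∑ b ∈ K, ⟪baryGrad K b, v⟫_ℝ * ⟪grad f x, b - a⟫_ℝ := by
    intro x
    have : v = ∑ b ∈ K, ⟪baryGrad K b, v⟫_ℝ • (b - a) := by
      simp only [smul_sub, Finset.sum_sub_distrib, ← Finset.sum_smul, hK.sum_inner_baryGrad,
        hK.sum_inner_baryGrad_smul, zero_smul, sub_zero]
    conv_lhs => rw [this, inner_sum]
    simp only [inner_smul_right]
  simp only [cellInt] at hdiff ⊢
  simp only [hexp]
  rw [integral_finsetSum _ fun b _ => (hi ((continuous_grad f).inner continuous_const)).const_mul _]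
  simp only [integral_const_mul]
  rw [Finset.sum_congr rfl fun b hb => by rw [hdiff b hb]]
  simp only [mul_sub, Finset.sum_sub_distrib, ← Finset.sum_mul, hK.sum_inner_baryGrad, zero_mul,
    zero_sub, ← Finset.sum_neg_distrib]
  refine Finset.sum_congr rfl fun b _ => ?_
  rw [inner_neg_left, inner_smul_left]
  simp only [RCLike.conj_to_real]
  ring

open scoped Classical in
-- The radial identity with f = 1: the volume of a cone is height times base over `d`. It converts
-- face areas to cell volumes in the estimates.
lemma area_mul_eq (hK : IsSimplex K) (hd : d ≠ 0) {a : Point d} (ha : a ∈ K) :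
    area (d - 1) (K.erase a) = d * ‖baryGrad K a‖ * area d K := by
  have h := hK.cellInt_radial hd ha 1
  have hGn : 0 < ‖baryGrad K a‖ := norm_pos_iff.2 (hK.baryGrad_ne_zero hd ha)
  have hg : ∀ x, grad (1 : Poly d) x = 0 := fun x => grad_C 1 x
  have h1 : cellInt K (fun x => d * ev (1 : Poly d) x + ⟪grad (1 : Poly d) x, x - a⟫_ℝ) =
      area d K * d := by
    rw [cellInt_eq]
    simp [hg, area]
  have h2 : faceInt (K.erase a) (ev (1 : Poly d)) = area (d - 1) (K.erase a) := by
    have : ev (1 : Poly d) = fun _ => 1 := by ext; simp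
    rw [faceInt, this]
    simp [area]
  rw [h1, h2] at h
  field_simp at h
  linarith

end IsSimplex

end Cone

/-! ### Diameters, inscribed balls and normals -/

section Geometry

variable {d : ℕ}

/-- A simplex whose diameter is controlled by the radius of a ball it contains. -/
structure ShapeRegular (γ : ℝ) (K : Finset (Point d)) : Prop where
  simplex : IsSimplex K
  exists_ball : ∃ x r, 0 < r ∧ Metric.ball x r ⊆ hull K ∧ size K ≤ γ * r

namespace IsSimplex

variable {K : Finset (Point d)}

/-- A width estimate for sets containing a ball. -/
lemma radius_mul_norm_le {S : Set (Point d)} {x : Point d} {r : ℝ} (hr : 0 < r)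
    (hb : Metric.ball x r ⊆ S) {v : Point d} {M : ℝ}
    (hM : ∀ y ∈ S, ∀ z ∈ S, ⟪v, y - z⟫_ℝ ≤ M) : r * ‖v‖ ≤ M := by
  rcases eq_or_ne v 0 with rfl | hv
  · have := hM x (hb (Metric.mem_ball_self hr)) x (hb (Metric.mem_ball_self hr))
    simpa using this
  have hvn : 0 < ‖v‖ := norm_pos_iff.2 hv
  set e : Point d := (r / (2 * ‖v‖)) • v with he
  have hen : ‖e‖ = r / 2 := by
    rw [he, norm_smul, Real.norm_of_nonneg (by positivity)]; field_simp
  have h := hM (x + e) (hb (by rw [mem_ball_iff_norm, add_sub_cancel_left, hen]; linarith))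
    (x - e) (hb (by rw [mem_ball_iff_norm, sub_sub_cancel_left, norm_neg, hen]; linarith))
  rw [show x + e - (x - e) = (2 : ℝ) • e by rw [two_smul]; abel, he, smul_smul, inner_smul_right,
    real_inner_self_eq_norm_sq] at h
  calc r * ‖v‖ = 2 * (r / (2 * ‖v‖)) * ‖v‖ ^ 2 := by field_simp
    _ ≤ M := h

lemma norm_baryGrad_le (hK : IsSimplex K) {a : Point d} (ha : a ∈ K) {x : Point d} {r : ℝ}
    (hr : 0 < r) (hb : Metric.ball x r ⊆ hull K) : ‖baryGrad K a‖ ≤ 1 / r := by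
  rw [le_div_iff₀ hr, mul_comm]
  refine radius_mul_norm_le hr hb fun y hy z hz => ?_
  rw [← hK.baryCoord_sub ha]
  linarith [hK.baryCoord_le_one hy ha, hK.baryCoord_nonneg hz ha]

/-- The coordinate of `a` drops from 1 to 0 along an edge at `a`. -/
lemma one_le_norm_baryGrad_mul_size (hK : IsSimplex K) (hd : d ≠ 0) {a : Point d} (ha : a ∈ K) :
    1 ≤ ‖baryGrad K a‖ * size K := by
  obtain ⟨b, hb, hba⟩ := hK.exists_ne_vertex hd a
  have h := hK.baryCoord_sub ha a b
  rw [hK.ev_baryCoord_vertex ha ha, hK.ev_baryCoord_vertex ha hb, if_pos rfl, if_neg hba.symm,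
    sub_zero] at h
  rw [h]
  refine (real_inner_le_norm _ _).trans ?_
  gcongr
  rw [← dist_eq_norm]
  exact dist_le_size (subset_hull K ha) (subset_hull K hb)

lemma size_pos (hK : IsSimplex K) (hd : d ≠ 0) : 0 < size K := by
  obtain ⟨a, ha⟩ := hK.nonempty
  have := hK.one_le_norm_baryGrad_mul_size hd ha
  by_contra! h
  nlinarith [norm_nonneg (baryGrad K a)]

open scoped Classical in
-- Seen along the edge from `a` to a vertex `c` of the face, `a` and `c` coincide. So in a direction
-- `e` orthogonal to this edge, which exists since d ≥ 2, the width of `K` is controlled by the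
-- face, while the ball bounds that width from below.
lemma radius_le_size_face (hK : IsSimplex K) (hd : 2 ≤ d) {a : Point d} (ha : a ∈ K) {x : Point d}
    {r : ℝ} (hr : 0 < r) (hb : Metric.ball x r ⊆ hull K) : r ≤ 2 * size (K.erase a) := by
  obtain ⟨c, hc, hca⟩ := hK.exists_ne_vertex (by omega) a
  have hcF : c ∈ K.erase a := Finset.mem_erase.2 ⟨hca, hc⟩
  obtain ⟨e, he, he0⟩ : ∃ e : Point d, ⟪a - c, e⟫_ℝ = 0 ∧ e ≠ 0 := by
    have h1 := (ℝ ∙ (a - c)).finrank_add_finrank_orthogonal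
    have h2 := finrank_span_singleton (K := ℝ) (sub_ne_zero.2 hca.symm)
    rw [finrank_euclideanSpace_fin, h2] at h1
    have h3 : (ℝ ∙ (a - c))ᗮ ≠ ⊥ := fun h => by
      rw [h, finrank_bot] at h1; omega
    obtain ⟨e, he, he0⟩ := Submodule.exists_mem_ne_zero_of_ne_bot h3
    exact ⟨e, Submodule.mem_orthogonal_singleton_iff_inner_right.1 he, he0⟩
  have hen : 0 < ‖e‖ := norm_pos_iff.2 he0
  have key : ∀ y ∈ hull K, |⟪e, y - c⟫_ℝ| ≤ ‖e‖ * size (K.erase a) := by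
    intro y hy
    have h1 : ⟪e, y - c⟫_ℝ = ∑ b ∈ K, ev (baryCoord K b) y * ⟪e, b - c⟫_ℝ := by
      conv_lhs => rw [← hK.sum_baryCoord_smul y, ← one_smul ℝ c, ← hK.sum_baryCoord y,
        Finset.sum_smul, ← Finset.sum_sub_distrib, inner_sum]
      refine Finset.sum_congr rfl fun b _ => ?_
      rw [← smul_sub, inner_smul_right]
    rw [h1]
    refine (Finset.abs_sum_le_sum_abs _ _).trans ?_
    calc _ ≤ ∑ b ∈ K, ev (baryCoord K b) y * (‖e‖ * size (K.erase a)) := by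
          refine Finset.sum_le_sum fun b hb => ?_
          rw [abs_mul, abs_of_nonneg (hK.baryCoord_nonneg hy hb)]
          refine mul_le_mul_of_nonneg_left ?_ (hK.baryCoord_nonneg hy hb)
          rcases eq_or_ne b a with rfl | hba
          · rw [real_inner_comm, he, abs_zero]
            exact mul_nonneg hen.le (size_nonneg _)
          · refine (abs_real_inner_le_norm _ _).trans ?_
            gcongr
            rw [← dist_eq_norm]
            exact dist_le_size (subset_hull _ (Finset.mem_erase.2 ⟨hba, hb⟩)) (subset_hull _ hcF)
      _ = ‖e‖ * size (K.erase a) := by rw [← Finset.sum_mul, hK.sum_baryCoord, one_mul]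
  have := radius_mul_norm_le hr hb (v := e) (M := 2 * (‖e‖ * size (K.erase a))) fun y hy z hz => by
    have h1 := abs_le.1 (key y hy)
    have h2 := abs_le.1 (key z hz)
    rw [show y - z = (y - c) - (z - c) by abel, inner_sub_right]
    linarith
  nlinarith

open scoped Classical in
-- `outerNormal` is a choice, so uniqueness is essential. Orthogonality to the edges of the face
-- leaves only multiples of ∇λ_a; the unit length and the sign fix the factor.
lemma isOuterNormal_iff (hK : IsSimplex K) (hd : d ≠ 0) {a : Point d} (ha : a ∈ K) {n : Point d} :
    IsOuterNormal K (K.erase a) n ↔ n = -(‖baryGrad K a‖⁻¹ • baryGrad K a) := by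
  set G := baryGrad K a with hG
  have hGn : 0 < ‖G‖ := norm_pos_iff.2 (hK.baryGrad_ne_zero hd ha)
  constructor
  · rintro ⟨h1, h2, h3⟩
    obtain ⟨c, hc, hca⟩ := hK.exists_ne_vertex hd a
    have hcF : c ∈ K.erase a := Finset.mem_erase.2 ⟨hca, hc⟩
    have hneg := h3 c hcF a ha (by simp)
    have hn : n = ⟪n, a - c⟫_ℝ • G := by
      refine ext_inner_right ℝ fun v => ?_
      have hv : v = ∑ b ∈ K, ⟪baryGrad K b, v⟫_ℝ • (b - c) := by
        simp only [smul_sub, Finset.sum_sub_distrib, ← Finset.sum_smul, hK.sum_inner_baryGrad,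
          hK.sum_inner_baryGrad_smul, zero_smul, sub_zero]
      conv_lhs => rw [hv, inner_sum]
      rw [Finset.sum_eq_single a]
      · rw [inner_smul_right, inner_smul_left, mul_comm]; rfl
      · intro b hb hba
        rw [inner_smul_right, h2 c hcF b (Finset.mem_erase.2 ⟨hba, hb⟩), mul_zero]
      · exact fun h => absurd ha h
    have h4 : -⟪n, a - c⟫_ℝ * ‖G‖ = 1 := by
      rw [← h1]
      conv_rhs => rw [hn, norm_smul, Real.norm_of_nonpos hneg.le]
    have h5 : ⟪n, a - c⟫_ℝ = -‖G‖⁻¹ := by field_simp; linarith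
    rw [hn, h5, neg_smul]
  · rintro rfl
    refine ⟨?_, fun x hx y hy => ?_, fun x hx y hy hyF => ?_⟩
    · rw [norm_neg, norm_smul, norm_inv, norm_norm, inv_mul_cancel₀ hGn.ne']
    · rw [inner_neg_left, inner_smul_left, ← hK.baryCoord_sub ha,
        hK.ev_baryCoord_vertex ha (Finset.mem_of_mem_erase hx),
        hK.ev_baryCoord_vertex ha (Finset.mem_of_mem_erase hy),
        if_neg (Finset.ne_of_mem_erase hx).symm, if_neg (Finset.ne_of_mem_erase hy).symm]
      simp
    · have : y = a := by simpa [hy] using hyF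
      subst this
      rw [inner_neg_left, inner_smul_left, ← hK.baryCoord_sub ha,
        hK.ev_baryCoord_vertex ha (Finset.mem_of_mem_erase hx), hK.ev_baryCoord_vertex ha ha,
        if_neg (Finset.ne_of_mem_erase hx).symm]
      simp [hGn]

open scoped Classical in
lemma outerNormal_eq (hK : IsSimplex K) (hd : d ≠ 0) {a : Point d} (ha : a ∈ K) :
    outerNormal K (K.erase a) = -(‖baryGrad K a‖⁻¹ • baryGrad K a) :=
  (hK.isOuterNormal_iff hd ha).1 (Classical.epsilon_spec ⟨_, (hK.isOuterNormal_iff hd ha).2 rfl⟩)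

open scoped Classical in
lemma norm_outerNormal (hK : IsSimplex K) (hd : d ≠ 0) {a : Point d} (ha : a ∈ K) :
    ‖outerNormal K (K.erase a)‖ = 1 :=
  ((hK.isOuterNormal_iff hd ha).2 (hK.outerNormal_eq hd ha)).1

lemma area_eq_volume : area d K = (volume : Measure (Point d)).real (hull K) := by
  rw [area, EuclideanSpace.euclideanHausdorffMeasure_eq_volume]

lemma area_self_pos (hK : IsSimplex K) : 0 < area d K := hK.area_pos subset_rfl hK.card

lemma area_le_size_pow (hK : IsSimplex K) :
    area d K ≤ (volume : Measure (Point d)).real (Metric.ball 0 1) * size K ^ d := by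
  obtain ⟨a, ha⟩ := hK.nonempty
  have h : hull K ⊆ Metric.closedBall a (size K) := fun x hx =>
    dist_le_size hx (subset_hull K ha)
  rw [area_eq_volume]
  refine (measureReal_mono h Metric.isBounded_closedBall.measure_lt_top.ne).trans ?_
  rw [measureReal_def, Measure.addHaar_closedBall _ _ (size_nonneg K), ENNReal.toReal_mul,
    ENNReal.toReal_ofReal (by have := size_nonneg K; positivity), finrank_euclideanSpace_fin,
    mul_comm]
  rfl

lemma radius_pow_le_area {x : Point d} {r : ℝ} (hr : 0 < r) (hb : Metric.ball x r ⊆ hull K) :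
    (volume : Measure (Point d)).real (Metric.ball 0 1) * r ^ d ≤ area d K := by
  rw [area_eq_volume]
  refine le_trans ?_ (measureReal_mono hb (isCompact_hull K).measure_lt_top.ne)
  rw [measureReal_def, measureReal_def, Measure.addHaar_ball_of_pos _ _ hr, ENNReal.toReal_mul,
    ENNReal.toReal_ofReal (by positivity), finrank_euclideanSpace_fin, mul_comm]

lemma integrableOn_cell {K : Finset (Point d)} {f : Point d → ℝ} (hf : Continuous f) :
    IntegrableOn f (hull K) volume :=
  hf.continuousOn.integrableOn_compact (isCompact_hull K)

lemma cellInt_le_area_mul {f : Point d → ℝ} (hf : Continuous f) {M : ℝ}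
    (hM : ∀ x ∈ hull K, f x ≤ M) : cellInt K f ≤ area d K * M := by
  have : ∫ _x in hull K, M = area d K * M := by
    rw [setIntegral_const, smul_eq_mul, area_eq_volume]
  rw [← this]
  exact setIntegral_mono_on (integrableOn_cell hf) (integrableOn_cell continuous_const)
    (measurableSet_hull K) hM

end IsSimplex

end Geometry

/-! ### Green's identity -/

section Green

variable {d : ℕ} {K : Finset (Point d)}

lemma continuous_ev_mul (q r : Poly d) : Continuous fun x => ev q x * ev r x :=
  (continuous_ev q).mul (continuous_ev r)

namespace IsSimplex

open scoped Classical in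
lemma integrableOn_face (hK : IsSimplex K) (hd : d ≠ 0) {a : Point d} (ha : a ∈ K)
    {f : Point d → ℝ} (hf : Continuous f) :
    IntegrableOn f (hull (K.erase a)) (μHE[d - 1] : Measure (Point d)) :=
  hK.integrableOn_hull (Finset.erase_subset a K) (hK.face_card hd ha) hf

open scoped Classical in
/-- Green's identity for polynomials on a simplex. -/
lemma cellInt_gradDot (hK : IsSimplex K) (hd : d ≠ 0) (s q : Poly d) :
    cellInt K (fun x => ev (gradDot s q) x) =
      -cellInt K (fun x => ev s x * ev (lapl q) x) +
        ∑ a ∈ K, faceInt (K.erase a)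
          (fun x => ev s x * ev (normalDeriv (outerNormal K (K.erase a)) q) x) := by
  -- Integration by parts for the polynomial s ∂_i q in the coordinate direction i, to be summed
  -- over i.
  have h1 : ∀ i : Fin d, cellInt K (fun x => ev (MvPolynomial.pderiv i s * MvPolynomial.pderiv i q) x +
      ev (s * MvPolynomial.pderiv i (MvPolynomial.pderiv i q)) x) =
      ∑ a ∈ K, outerNormal K (K.erase a) i * faceInt (K.erase a) (ev (s * MvPolynomial.pderiv i q)) := by
    intro i
    have h := hK.cellInt_inner_grad hd (s * MvPolynomial.pderiv i q) (EuclideanSpace.single i 1)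
    have h2 : ∀ x, ⟪grad (s * MvPolynomial.pderiv i q) x, EuclideanSpace.single i (1 : ℝ)⟫_ℝ =
        ev (MvPolynomial.pderiv i s * MvPolynomial.pderiv i q) x +
      ev (s * MvPolynomial.pderiv i (MvPolynomial.pderiv i q)) x := by
      intro x
      rw [EuclideanSpace.inner_single_right]
      simp [grad_apply]
      ring
    simp only [h2] at h
    rw [h]
    refine Finset.sum_congr rfl fun a ha => ?_
    rw [hK.outerNormal_eq hd ha, EuclideanSpace.inner_single_right]
    simp
  have h2 : cellInt K (fun x => ev (gradDot s q) x) + cellInt K (fun x => ev s x * ev (lapl q) x) =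
      ∑ i, cellInt K (fun x => ev (MvPolynomial.pderiv i s * MvPolynomial.pderiv i q) x +
      ev (s * MvPolynomial.pderiv i (MvPolynomial.pderiv i q)) x) := by
    simp only [cellInt]
    rw [← integral_add (integrableOn_cell (continuous_ev _)) (integrableOn_cell (continuous_ev_mul _ _)),
      ← integral_finsetSum (f := fun i x =>
        ev (MvPolynomial.pderiv i s * MvPolynomial.pderiv i q) x +
          ev (s * MvPolynomial.pderiv i (MvPolynomial.pderiv i q)) x) _
        fun i _ => integrableOn_cell ((continuous_ev _).add (continuous_ev _))]
    congr 1
    ext x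
    simp [gradDot, lapl, Finset.mul_sum, Finset.sum_add_distrib]
  have h3 : ∀ a ∈ K, faceInt (K.erase a)
      (fun x => ev s x * ev (normalDeriv (outerNormal K (K.erase a)) q) x) =
      ∑ i, outerNormal K (K.erase a) i * faceInt (K.erase a) (ev (s * MvPolynomial.pderiv i q)) := by
    intro a ha
    simp only [faceInt, ← integral_const_mul]
    rw [← integral_finsetSum _ fun i _ => (hK.integrableOn_face hd ha (continuous_ev _)).const_mul _]
    congr 1
    ext x
    simp only [normalDeriv, ev_sum, ev_mul, ev_C, Finset.mul_sum]
    exact Finset.sum_congr rfl fun i _ => by ring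
  rw [Finset.sum_congr rfl h3, Finset.sum_comm, ← Finset.sum_congr rfl fun i _ => h1 i, ← h2]
  ring

end IsSimplex

end Green

/-! ### Maximum norm estimates on one simplex -/

section LocalEstimates

variable {d : ℕ}

lemma norm_sq_eq_sum (v : Point d) : ‖v‖ ^ 2 = ∑ i, v i ^ 2 := by
  rw [EuclideanSpace.norm_sq_eq]
  simp

/-- `L²` norms of gradients control their maximum norms. -/
lemma exists_norm_grad_sq_mul_area_le (d m : ℕ) : ∃ C : ℝ, 0 < C ∧ ∀ K : Finset (Point d),
    IsSimplex K → ∀ u ∈ polySpace d m, ∀ x ∈ hull K,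
      ‖grad u x‖ ^ 2 * area d K ≤ C * cellInt K (fun y => ev (gradDot u u) y) := by
  obtain ⟨C, hC, h⟩ := exists_sq_mul_area_le_integral_sq d m
  refine ⟨C, hC, fun K hK u hu x hx => ?_⟩
  have h1 : cellInt K (fun y => ev (gradDot u u) y) =
      ∑ i, ∫ y in hull K, ev (MvPolynomial.pderiv i u) y ^ 2 ∂(μHE[d] : Measure (Point d)) := by
    rw [cellInt_eq, ← integral_finsetSum (f := fun i y => ev (MvPolynomial.pderiv i u) y ^ 2) _
      fun i _ => hK.integrableOn_hull subset_rfl hK.card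
        ((continuous_ev (MvPolynomial.pderiv i u)).pow 2)]
    congr 1
    ext y
    simp [gradDot, sq]
  rw [h1, norm_sq_eq_sum, Finset.sum_mul, Finset.mul_sum]
  exact Finset.sum_le_sum fun i _ => h d K K hK subset_rfl hK.card _
    (polySpace_mono (by omega) (pderiv_mem_polySpace hu i)) x hx

lemma exists_isMaxOn_hull {S : Finset (Point d)} (hS : S.Nonempty) {f : Point d → ℝ}
    (hf : Continuous f) : ∃ x ∈ hull S, ∀ y ∈ hull S, f y ≤ f x :=
  (isCompact_hull S).exists_isMaxOn ((Finset.coe_nonempty.2 hS).mono (subset_hull S)) hf.continuousOn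

open scoped Classical in
/-- The reconstruction is close to the cell polynomial if the face polynomials are. -/
lemma exists_abs_reconstruction_sub_le (d p : ℕ) (hd : d ≠ 0) (γ : ℝ) : ∃ C : ℝ, 0 < C ∧
    ∀ K : Finset (Point d), ShapeRegular γ K → ∀ (s R : Poly d) (t : Point d → Poly d),
      s ∈ polySpace d p → R ∈ polySpace d (p + 1) →
      (∀ q ∈ polySpace d (p + 1), cellInt K (fun x => ev (gradDot R q) x) =
        -cellInt K (fun x => ev s x * ev (lapl q) x) + ∑ a ∈ K, faceInt (K.erase a)
          (fun x => ev (t a) x * ev (normalDeriv (outerNormal K (K.erase a)) q) x)) →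
      cellInt K (fun x => ev R x) = cellInt K (fun x => ev s x) →
      ∀ δ : ℝ, (∀ a ∈ K, ∀ x ∈ hull (K.erase a), |ev (t a) x - ev s x| ≤ δ) →
      ∀ x ∈ hull K, |ev R x - ev s x| ≤ C * δ := by
  obtain ⟨C, hC, hmain⟩ := exists_norm_grad_sq_mul_area_le d (p + 1)
  refine ⟨C * d * (d + 1) * |γ| + 1, by positivity, fun K hγ s R t hs hR hrec hmean δ hδ x hx => ?_⟩
  have hK := hγ.simplex
  obtain ⟨x₀, r, hr, hb, hsz⟩ := hγ.exists_ball
  have hA := hK.area_self_pos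
  set q := R - s with hq
  -- The difference is itself an admissible test polynomial.
  have hqmem : q ∈ polySpace d (p + 1) := Submodule.sub_mem _ hR (polySpace_mono (by omega) hs)
  have hδ0 : 0 ≤ δ := by
    obtain ⟨a, ha⟩ := hK.nonempty
    obtain ⟨b, hb, hba⟩ := hK.exists_ne_vertex hd a
    exact (abs_nonneg _).trans (hδ a ha b (subset_hull _ (Finset.mem_erase.2 ⟨hba, hb⟩)))
  -- Subtracting Green's identity for `s` removes the volume term with the Laplacian and leaves only
  -- the face residuals.
  have hen : cellInt K (fun x => ev (gradDot q q) x) = ∑ a ∈ K, faceInt (K.erase a)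
      (fun x => (ev (t a) x - ev s x) * ev (normalDeriv (outerNormal K (K.erase a)) q) x) := by
    have h1 : cellInt K (fun x => ev (gradDot q q) x) =
        cellInt K (fun x => ev (gradDot R q) x) - cellInt K (fun x => ev (gradDot s q) x) := by
      simp only [cellInt]
      rw [← integral_sub (IsSimplex.integrableOn_cell (continuous_ev _))
        (IsSimplex.integrableOn_cell (continuous_ev _))]
      congr 1; ext y
      rw [ev_gradDot, ev_gradDot, ev_gradDot, ← inner_sub_left, ← grad_sub]
    rw [h1, hrec q hqmem, hK.cellInt_gradDot hd, add_sub_add_left_eq_sub, ← Finset.sum_sub_distrib]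
    refine Finset.sum_congr rfl fun a ha => ?_
    simp only [faceInt]
    rw [← integral_sub (hK.integrableOn_face hd ha (continuous_ev_mul _ _))
      (hK.integrableOn_face hd ha (continuous_ev_mul _ _))]
    congr 1; ext y; ring
  obtain ⟨z, hz, hzmax⟩ := exists_isMaxOn_hull hK.nonempty (continuous_grad q).norm
  set g := ‖grad q z‖ with hg
  -- The face has area d‖∇λ_a‖|K| ≤ d|K|/r. This makes both sides of the energy bound proportional
  -- to |K|, so that g ≤ const·δ/r results.
  have hface : ∀ a ∈ K, faceInt (K.erase a)
      (fun x => (ev (t a) x - ev s x) * ev (normalDeriv (outerNormal K (K.erase a)) q) x) ≤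
      d * (1 / r) * area d K * (δ * g) := by
    intro a ha
    have hsub := Finset.erase_subset a K
    refine (hK.integral_le_area_mul hsub (hK.face_card hd ha) (f := fun x =>
      (ev (t a) x - ev s x) * ev (normalDeriv (outerNormal K (K.erase a)) q) x) (((continuous_ev _).sub (continuous_ev _)).mul (continuous_ev _)) (M := δ * g)
      fun y hy => ?_).trans ?_
    · refine (le_abs_self _).trans ?_
      rw [abs_mul]
      refine mul_le_mul (hδ a ha y hy) ?_ (abs_nonneg _) hδ0
      rw [ev_normalDeriv]
      refine (abs_real_inner_le_norm _ _).trans ?_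
      rw [hK.norm_outerNormal hd ha, one_mul]
      exact hzmax y (hull_mono hsub hy)
    · rw [hK.area_mul_eq hd ha]
      have := hK.norm_baryGrad_le ha hr hb
      have : 0 ≤ g := norm_nonneg _
      gcongr
  have h2 : g ^ 2 * area d K ≤ C * ((d + 1) * (d * (1 / r) * area d K * (δ * g))) := by
    refine (hmain K hK q (by exact_mod_cast hqmem) z hz).trans ?_
    rw [hen]
    gcongr
    refine (Finset.sum_le_sum hface).trans_eq ?_
    rw [Finset.sum_const, hK.card]
    simp
  have h3 : g ≤ C * d * (d + 1) * δ / r := by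
    rcases (norm_nonneg (grad q z)).eq_or_lt with h0 | h0
    · rw [hg, ← h0]; positivity
    · have : g * (g * area d K) ≤ (C * d * (d + 1) * δ / r) * (g * area d K) := by
        calc g * (g * area d K) = g ^ 2 * area d K := by ring
          _ ≤ _ := h2
          _ = _ := by field_simp
      exact le_of_mul_le_mul_right this (mul_pos h0 hA)
  have h4 : ∀ y ∈ hull K, |ev q x - ev q y| ≤ g * size K := by
    intro y hy
    refine (abs_ev_sub_le (convex_hull K) q (fun w hw => hzmax w hw) hy hx).trans ?_
    rw [← dist_eq_norm]
    exact mul_le_mul_of_nonneg_left (dist_le_size hx hy) (norm_nonneg _)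
  -- With mean value zero, point values of `q` are bounded by its oscillation, at most `g` times the
  -- diameter; shape regularity then cancels `r`.
  have hq0 : cellInt K (ev q) = 0 := by
    have : cellInt K (ev q) = cellInt K (fun x => ev R x) - cellInt K (fun x => ev s x) := by
      simp only [cellInt]
      rw [← integral_sub (IsSimplex.integrableOn_cell (continuous_ev _))
        (IsSimplex.integrableOn_cell (continuous_ev _))]
      congr 1; ext y; rw [hq, ev_sub]
    rw [this, hmean, sub_self]
  have h5 : ∀ c : ℝ, cellInt K (fun y => c * (ev q x - ev q y)) = area d K * (c * ev q x) := by
    intro c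
    have hc : cellInt K (fun _ => ev q x) = area d K * ev q x := by
      rw [cellInt, setIntegral_const, smul_eq_mul, IsSimplex.area_eq_volume]
    have : cellInt K (fun y => c * (ev q x - ev q y)) =
        c * (cellInt K (fun _ => ev q x) - cellInt K (ev q)) := by
      simp only [cellInt]
      rw [← integral_sub (IsSimplex.integrableOn_cell continuous_const)
        (IsSimplex.integrableOn_cell (continuous_ev _)), ← integral_const_mul]
    rw [this, hq0, hc]; ring
  have h6 : ∀ c : ℝ, |c| = 1 → c * ev q x ≤ g * size K := by
    intro c hc
    have h := IsSimplex.cellInt_le_area_mul (K := K) (f := fun y => c * (ev q x - ev q y))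
      (continuous_const.mul (continuous_const.sub (continuous_ev _))) (M := g * size K) fun y hy => by
        refine (le_abs_self _).trans ?_
        rw [abs_mul, hc, one_mul]
        exact h4 y hy
    rw [h5] at h
    exact le_of_mul_le_mul_left h hA
  have h7 : |ev q x| ≤ g * size K := abs_le.2 ⟨by linarith [h6 (-1) (by simp)], by linarith [h6 1 (by simp)]⟩
  rw [← ev_sub, ← hq]
  have hsz' : size K ≤ |γ| * r := hsz.trans (mul_le_mul_of_nonneg_right (le_abs_self γ) hr.le)
  calc |ev q x| ≤ g * size K := h7
    _ ≤ (C * d * (d + 1) * δ / r) * (|γ| * r) := by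
      gcongr
      exact size_nonneg K
    _ = (C * d * (d + 1) * |γ|) * δ := by field_simp
    _ ≤ _ := by nlinarith

/-- A polynomial determined by weighted moments is bounded by the function that has these moments. -/
lemma exists_abs_le_of_weighted_moment (n m : ℕ) : ∃ C : ℝ, 0 < C ∧
    ∀ (d : ℕ) (K S : Finset (Point d)), IsSimplex K → S ⊆ K → S.card = n + 1 →
      ∀ b ∈ polySpace d m, ∀ (v : Poly d) (M : ℝ), (∀ x ∈ hull S, |ev v x| ≤ M) →
      ∫ x in hull S, ev b x ^ 2 * ∏ p ∈ S, ev (baryCoord K p) x ∂(μHE[n] : Measure (Point d)) ≤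
        ∫ x in hull S, ev b x * ev v x ∂(μHE[n] : Measure (Point d)) →
      ∀ x ∈ hull S, |ev b x| ≤ C * M := by
  obtain ⟨C, hC, hmain⟩ := exists_sq_mul_area_le n m
  refine ⟨C, hC, fun d K S hK hS hn b hb v M hM hle x hx => ?_⟩
  have hA := hK.area_pos hS hn
  have hne : S.Nonempty := Finset.card_pos.1 (by omega)
  have hM0 : 0 ≤ M := (abs_nonneg _).trans (hM x hx)
  -- At a maximum point of |b| the chain |b(z)|²|S| ≤ C∫b²w ≤ C∫bv ≤ C|b(z)|M|S| can be divided by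
  -- |b(z)||S|.
  obtain ⟨z, hz, hzmax⟩ := exists_isMaxOn_hull hne (continuous_ev b).abs
  refine (hzmax x hx).trans ?_
  have h1 := hmain d K S hK hS hn b hb z hz
  have h2 := hK.integral_le_area_mul hS hn (continuous_ev_mul b v) (M := |ev b z| * M) fun y hy => by
    refine (le_abs_self _).trans ?_
    rw [abs_mul]
    exact mul_le_mul (hzmax y hy) (hM y hy) (abs_nonneg _) (abs_nonneg _)
  have h3 : |ev b z| * (|ev b z| * area n S) ≤ C * M * (|ev b z| * area n S) := by
    calc |ev b z| * (|ev b z| * area n S) = ev b z ^ 2 * area n S := by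
          rw [← sq_abs]; ring
      _ ≤ _ := h1.trans (mul_le_mul_of_nonneg_left (hle.trans h2) hC.le)
      _ = _ := by ring
  rcases (abs_nonneg (ev b z)).eq_or_lt with h0 | h0
  · rw [← h0]; positivity
  · exact le_of_mul_le_mul_right h3 (mul_pos h0 hA)

end LocalEstimates

open scoped Classical

/-! ### Smallest faces through a point -/

section Carrier

variable {d : ℕ} {K : Finset (Point d)}

/-- The vertices of the smallest face of `K` that contains `x`. -/
def carrier (K : Finset (Point d)) (x : Point d) : Finset (Point d) :=
  K.filter fun a => ev (baryCoord K a) x ≠ 0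

lemma carrier_subset (K : Finset (Point d)) (x : Point d) : carrier K x ⊆ K :=
  Finset.filter_subset _ _

namespace IsSimplex

lemma mem_hull_iff_carrier_subset (hK : IsSimplex K) {S : Finset (Point d)} (hS : S ⊆ K)
    {x : Point d} (hx : x ∈ hull K) : x ∈ hull S ↔ carrier K x ⊆ S := by
  rw [hK.mem_hull_iff hS, and_iff_right (hK.mem_hull_self_iff.1 hx)]
  constructor
  · intro h a ha
    obtain ⟨h1, h2⟩ := Finset.mem_filter.1 ha
    by_contra haS
    exact h2 (h a h1 haS)
  · intro h a ha haS
    by_contra h0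
    exact haS (h (Finset.mem_filter.2 ⟨ha, h0⟩))

lemma mem_hull_carrier (hK : IsSimplex K) {x : Point d} (hx : x ∈ hull K) :
    x ∈ hull (carrier K x) := (hK.mem_hull_iff_carrier_subset (carrier_subset K x) hx).2 subset_rfl

lemma mem_interior_iff_carrier (hK : IsSimplex K) {x : Point d} (hx : x ∈ hull K) :
    x ∈ interior (hull K) ↔ carrier K x = K := by
  rw [hK.interior_hull, carrier, Finset.filter_eq_self]
  exact forall₂_congr fun a ha =>
    ⟨fun h => ne_of_gt h, fun h => lt_of_le_of_ne (hK.baryCoord_nonneg hx ha) h.symm⟩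

/-- Vertices are extreme points: on the simplex λ_a takes the value 1 only at `a`, and convex
combinations of values below 1 stay below 1. `S` need not consist of vertices of `K`. -/
lemma mem_of_mem_hull (hK : IsSimplex K) {S : Finset (Point d)} {a : Point d} (ha : a ∈ K)
    (haS : a ∈ hull S) (hS : hull S ⊆ hull K) : a ∈ S := by
  by_contra hna
  rw [hull, Finset.mem_convexHull'] at haS
  obtain ⟨w, hw0, hw1, hwa⟩ := haS
  have h1 : ∀ b ∈ S, ev (baryCoord K a) b < 1 := by
    intro b hb
    have hbK : b ∈ hull K := hS (subset_hull S hb)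
    refine lt_of_le_of_ne (hK.baryCoord_le_one hbK ha) fun h => ?_
    have h2 := hK.sum_baryCoord b
    rw [← Finset.add_sum_erase K _ ha, h, add_eq_left,
      Finset.sum_eq_zero_iff_of_nonneg fun c hc =>
        hK.baryCoord_nonneg hbK (Finset.mem_of_mem_erase hc)] at h2
    have h3 := hK.sum_baryCoord_smul b
    rw [← Finset.add_sum_erase K _ ha, h, one_smul,
      Finset.sum_eq_zero fun c hc => by rw [h2 c hc, zero_smul], add_zero] at h3
    exact hna (h3 ▸ hb)
  have h2 := ev_affine (hK.baryCoord_mem ha) S w id hw1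
  simp only [id] at h2
  rw [hwa, hK.ev_baryCoord_vertex ha ha, if_pos rfl] at h2
  obtain ⟨b, hb, hwb⟩ : ∃ b ∈ S, 0 < w b := by
    by_contra! h
    have := Finset.sum_nonpos h
    linarith
  have h3 : ∑ b ∈ S, w b * ev (baryCoord K a) b < ∑ b ∈ S, w b :=
    Finset.sum_lt_sum (fun c hc => mul_le_of_le_one_right (hw0 c hc) (h1 c hc).le)
      ⟨b, hb, mul_lt_of_lt_one_right hwb (h1 b hb)⟩
  linarith

lemma closure_interior_hull (hK : IsSimplex K) : closure (interior (hull K)) = hull K :=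
  (convex_hull K).closure_interior_eq_closure_of_nonempty_interior hK.interior_hull_nonempty |>.trans
    (isClosed_hull K).closure_eq

end IsSimplex

end Carrier

/-! ### Incidence geometry of matching meshes -/

section Matching

variable {d : ℕ} {Ω : Set (Point d)} (T : Mesh d Ω)

namespace Mesh

lemma isSimplex (K : T.Cell) : IsSimplex K.1 := ⟨T.card_cell K.1 K.2, T.nondegenerate K.1 K.2⟩

/-- The mesh axiom only gives a vertex set contained in the first cell. Used in both orders it gives
two vertex sets with the same hull, and extremality of vertices puts the first one into both cells.
-/
lemma hull_inter (K₁ K₂ : T.Cell) : hull K₁.1 ∩ hull K₂.1 = hull (K₁.1 ∩ K₂.1) := by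
  obtain ⟨S, hS, h⟩ := T.matching K₁.1 K₁.2 K₂.1 K₂.2
  obtain ⟨S', hS', h'⟩ := T.matching K₂.1 K₂.2 K₁.1 K₁.2
  have hSS' : hull S = hull S' := by rw [← h, ← h', Set.inter_comm]
  refine Set.Subset.antisymm ?_
    (Set.subset_inter (hull_mono Finset.inter_subset_left) (hull_mono Finset.inter_subset_right))
  rw [h]
  refine hull_mono fun a ha => Finset.mem_inter.2 ⟨hS ha, ?_⟩
  refine hS' ((T.isSimplex K₁).mem_of_mem_hull (hS ha) (hSS' ▸ subset_hull S ha) ?_)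
  rw [← hSS', ← h]
  exact Set.inter_subset_left

/-- The smallest face of one cell through a point is shared by every cell at that point; this is how
matching enters the later arguments. -/
lemma carrier_subset_of_mem {K₁ K₂ : T.Cell} {x : Point d} (h₁ : x ∈ hull K₁.1)
    (h₂ : x ∈ hull K₂.1) : carrier K₁.1 x ⊆ K₂.1 := by
  have h : x ∈ hull (K₁.1 ∩ K₂.1) := T.hull_inter K₁ K₂ ▸ ⟨h₁, h₂⟩
  exact (((T.isSimplex K₁).mem_hull_iff_carrier_subset Finset.inter_subset_left h₁).1 h).trans
    Finset.inter_subset_right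

lemma cell_eq_of_subset {K₁ K₂ : T.Cell} (h : K₁.1 ⊆ K₂.1) : K₁ = K₂ :=
  Subtype.ext (Finset.eq_of_subset_of_card_le h
    (by rw [(T.isSimplex K₁).card, (T.isSimplex K₂).card]))

lemma cell_eq_of_mem_interior {K₁ K₂ : T.Cell} {x : Point d} (h₁ : x ∈ interior (hull K₁.1))
    (h₂ : x ∈ hull K₂.1) : K₁ = K₂ := by
  have h := interior_subset h₁
  have := T.carrier_subset_of_mem h h₂
  rw [((T.isSimplex K₁).mem_interior_iff_carrier h).1 h₁] at this
  exact T.cell_eq_of_subset this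

lemma mem_hull_of_subset {K : T.Cell} {S : Finset (Point d)} (hS : S ⊆ K.1) {K' : T.Cell}
    {x : Point d} (hx : x ∈ hull K.1) (hx' : x ∈ hull K'.1) (hxS : x ∈ hull S) :
    x ∈ hull (S ∩ K'.1) := by
  have h1 := ((T.isSimplex K).mem_hull_iff_carrier_subset hS hx).1 hxS
  refine ((T.isSimplex K).mem_hull_iff_carrier_subset (Finset.inter_subset_left.trans hS) hx).2 ?_
  exact Finset.subset_inter h1 (T.carrier_subset_of_mem hx hx')

lemma mem_closure_iff {x : Point d} : x ∈ closure Ω ↔ ∃ K : T.Cell, x ∈ hull K.1 := by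
  rw [← T.cover]; simp

lemma hull_subset_closure (K : T.Cell) : hull K.1 ⊆ closure Ω := fun _ hx =>
  T.mem_closure_iff.2 ⟨K, hx⟩

lemma exists_cell_of_mem_faces {F : Finset (Point d)} (hF : F ∈ T.faces) :
    ∃ K : T.Cell, F ⊆ K.1 ∧ F.card = d := by
  simp only [Mesh.faces, Finset.mem_biUnion, Finset.mem_powersetCard] at hF
  obtain ⟨K, hK, h⟩ := hF
  exact ⟨⟨K, hK⟩, h⟩

lemma mem_faces {K : T.Cell} {F : Finset (Point d)} (hF : F ⊆ K.1) (hc : F.card = d) : F ∈ T.faces := by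
  simp only [Mesh.faces, Finset.mem_biUnion, Finset.mem_powersetCard]
  exact ⟨K.1, K.2, hF, hc⟩

lemma face_card (F : T.Face) : F.1.card = d := (T.exists_cell_of_mem_faces F.2).choose_spec.2

/-- A neighbourhood of a point of a cell that meets only hulls of vertex sets containing it. -/
lemma exists_ball_disjoint (z : Point d) : ∃ ε > 0, ∀ K : T.Cell, ∀ S ⊆ K.1, z ∉ hull S →
    Disjoint (Metric.ball z ε) (hull S) := by
  let A : Set (Point d) := ⋃ S ∈ (T.cells.biUnion Finset.powerset).filter fun S => z ∉ hull S, hull S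
  have hA : IsClosed A := isClosed_biUnion_finset fun S _ => isClosed_hull S
  have hz : z ∉ A := by
    simp only [A, Set.mem_iUnion, not_exists]
    exact fun S hS => (Finset.mem_filter.1 hS).2
  obtain ⟨ε, hε, h⟩ := Metric.isOpen_iff.1 hA.isOpen_compl z hz
  refine ⟨ε, hε, fun K S hS hzS => Set.disjoint_left.2 fun y hy hyS => h hy ?_⟩
  simp only [A, Set.mem_iUnion]
  exact ⟨S, Finset.mem_filter.2
    ⟨Finset.mem_biUnion.2 ⟨K.1, K.2, Finset.mem_powerset.2 hS⟩, hzS⟩, hyS⟩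

/-- A face that belongs to only one cell lies on the boundary. -/
lemma isBoundaryFace_of_not_isInterface (hΩ : IsOpen Ω) {F : T.Face} (hF : ¬ T.IsInterface F) :
    T.IsBoundaryFace F := by
  obtain ⟨K, hFK, hFc⟩ := T.exists_cell_of_mem_faces F.2
  have hK := T.isSimplex K
  intro x hx
  have hxK : x ∈ hull K.1 := hull_mono hFK hx
  rw [frontier, hΩ.interior_eq]
  refine ⟨T.hull_subset_closure K hxK, fun hxΩ => ?_⟩
  have hFne : F.1.Nonempty := by
    rw [Finset.nonempty_iff_ne_empty]
    intro h
    rw [hull, h] at hx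
    simp at hx
  have hc : (F.1.card : ℝ) ≠ 0 := by exact_mod_cast hFne.card_pos.ne'
  have hw : ∑ _a ∈ F.1, (F.1.card : ℝ)⁻¹ = 1 := by simp [hc]
  set c : Point d := ∑ a ∈ F.1, (F.1.card : ℝ)⁻¹ • a with hcdef
  have hcF : c ∈ hull F.1 := by
    rw [hull, Finset.mem_convexHull']
    exact ⟨_, fun _ _ => by positivity, hw, rfl⟩
  have hlim : Filter.Tendsto (fun t : ℝ => x + t • (c - x)) (nhdsWithin 0 (Set.Ioi 0)) (nhds x) := by
    have : Continuous fun t : ℝ => x + t • (c - x) := by fun_prop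
    have h := this.tendsto 0
    simp only [zero_smul, add_zero] at h
    exact h.mono_left nhdsWithin_le_nhds
  have hev : ∀ᶠ t in nhdsWithin (0 : ℝ) (Set.Ioi 0), x + t • (c - x) ∈ Ω ∧ t ∈ Set.Ioo (0 : ℝ) 1 :=
    (hlim.eventually (hΩ.mem_nhds hxΩ)).and (Ioo_mem_nhdsGT zero_lt_one)
  obtain ⟨t, hyΩ, ht0, ht1⟩ := hev.exists
  -- A small move towards the barycentre of the face stays in Ω and makes all coordinates of the
  -- vertices of the face positive, so the carrier is the whole face.
  set y := x + t • (c - x) with hy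
  have hyF : y ∈ hull F.1 := (convex_hull F.1).add_smul_sub_mem hx hcF ⟨ht0.le, ht1.le⟩
  have hcar : carrier K.1 y = F.1 := by
    refine Finset.Subset.antisymm
      ((hK.mem_hull_iff_carrier_subset hFK (hull_mono hFK hyF)).1 hyF) fun a ha => ?_
    refine Finset.mem_filter.2 ⟨hFK ha, ne_of_gt ?_⟩
    have h1 := ev_affine (hK.baryCoord_mem (hFK ha)) Finset.univ ![1 - t, t] ![x, c] (by simp)
    simp only [Fin.sum_univ_two, Matrix.cons_val_zero, Matrix.cons_val_one] at h1
    rw [hy, show x + t • (c - x) = (1 - t) • x + t • c by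
      rw [sub_smul, smul_sub, one_smul]; abel, h1, hcdef,
      hK.baryCoord_combination hFK hw (hFK ha), Finset.sum_ite_eq, if_pos ha]
    have := hK.baryCoord_nonneg hxK (hFK ha)
    have : 0 < t * (F.1.card : ℝ)⁻¹ := mul_pos ht0 (by positivity)
    nlinarith
  -- Any cell at `y` contains the whole face, so a second one would make it an interface. Then `K`
  -- alone covers a neighbourhood of `y`, although `y` lies on its boundary.
  have huniq : ∀ K' : T.Cell, y ∈ hull K'.1 → K' = K := by
    intro K' hK'
    by_contra hne
    refine hF ⟨K', K, hne, ?_, hFK⟩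
    rw [← hcar]
    exact T.carrier_subset_of_mem (hull_mono hFK hyF) hK'
  obtain ⟨ε, hε, hball⟩ := T.exists_ball_disjoint y
  have hnhds : hull K.1 ∈ nhds y := by
    filter_upwards [hΩ.mem_nhds hyΩ, Metric.ball_mem_nhds y hε] with w hw hwε
    obtain ⟨K', hK'⟩ := T.mem_closure_iff.1 (subset_closure hw)
    by_cases h : y ∈ hull K'.1
    · rwa [← huniq K' h]
    · exact absurd hK' (Set.disjoint_left.1 (hball K' K'.1 subset_rfl h) hwε)
  have hint : carrier K.1 y = K.1 :=
    (hK.mem_interior_iff_carrier (hull_mono hFK hyF)).1 (mem_interior_iff_mem_nhds.2 hnhds)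
  have : F.1.card = d + 1 := by rw [← hcar, hint, hK.card]
  omega

/-- Two cells with a common face cover a neighbourhood of each inner point of the face. -/
lemma union_hull_mem_nhds {K₁ K₂ : T.Cell} (hne : K₁ ≠ K₂) {w : Point d} (hw : w ∈ hull K₁.1)
    (hcard : (carrier K₁.1 w).card = d) (hsub : carrier K₁.1 w ⊆ K₂.1) :
    hull K₁.1 ∪ hull K₂.1 ∈ nhds w := by
  set F := carrier K₁.1 w with hF
  have h₁ := T.isSimplex K₁
  have h₂ := T.isSimplex K₂
  have hF₁ : F ⊆ K₁.1 := carrier_subset _ _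
  have hwF : w ∈ hull F := h₁.mem_hull_carrier hw
  have hw₂ : w ∈ hull K₂.1 := hull_mono hsub hwF
  have hFF : F ⊆ carrier K₂.1 w := by
    have h1 : carrier K₁.1 w ⊆ K₂.1 := hsub
    have h2 := T.carrier_subset_of_mem hw₂ hw
    have h3 := h₂.mem_hull_carrier hw₂
    exact (h₁.mem_hull_iff_carrier_subset h2 hw).1 h3
  obtain ⟨a, haF, hK₁⟩ := (Finset.covBy_iff_exists_insert (s := F) (t := K₁.1)).1
    (Finset.covBy_iff_card_sdiff_eq_one.2 ⟨hF₁, by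
      rw [Finset.card_sdiff_of_subset hF₁, h₁.card, hcard]; omega⟩)
  obtain ⟨b, hbF, hK₂⟩ := (Finset.covBy_iff_exists_insert (s := F) (t := K₂.1)).1
    (Finset.covBy_iff_card_sdiff_eq_one.2 ⟨hsub, by
      rw [Finset.card_sdiff_of_subset hsub, h₂.card, hcard]; omega⟩)
  have ha : a ∈ K₁.1 := by rw [← hK₁]; exact Finset.mem_insert_self _ _
  have hb : b ∈ K₂.1 := by rw [← hK₂]; exact Finset.mem_insert_self _ _
  have hpos₁ : ∀ᶠ x in nhds w, ∀ c ∈ F, 0 < ev (baryCoord K₁.1 c) x := by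
    rw [Filter.eventually_all_finset]
    intro c hc
    refine (continuous_ev _).continuousAt.eventually (lt_mem_nhds (lt_of_le_of_ne
      (h₁.baryCoord_nonneg hw (hF₁ hc)) ((Finset.mem_filter.1 hc).2).symm))
  have hpos₂ : ∀ᶠ x in nhds w, ∀ c ∈ F, 0 < ev (baryCoord K₂.1 c) x := by
    rw [Filter.eventually_all_finset]
    intro c hc
    refine (continuous_ev _).continuousAt.eventually (lt_mem_nhds (lt_of_le_of_ne
      (h₂.baryCoord_nonneg hw₂ (hsub hc)) ((Finset.mem_filter.1 (hFF hc)).2).symm))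
  -- Both coordinates are affine and vanish on the common face, hence they are proportional.
  have hprop : ∀ x, ev (baryCoord K₁.1 a) x = ev (baryCoord K₂.1 b) x * ev (baryCoord K₁.1 a) b := by
    intro x
    rw [h₂.ev_eq_sum (h₁.baryCoord_mem ha) x]
    refine Finset.sum_eq_single b (fun c hc hcb => ?_) fun h => absurd hb h
    have hcF : c ∈ F := by
      rw [← hK₂, Finset.mem_insert] at hc
      exact hc.resolve_left hcb
    rw [h₁.ev_baryCoord_vertex ha (hF₁ hcF), if_neg, mul_zero]
    rintro rfl; exact haF hcF
  -- The cells lie on opposite sides of the face: otherwise a small move from `w` towards `a` would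
  -- reach the interior of K₁ inside K₂.
  have hneg : ev (baryCoord K₁.1 a) b < 0 := by
    by_contra! hge
    rcases hge.eq_or_lt with h0 | h0
    · have := hprop a
      rw [← h0, mul_zero, h₁.ev_baryCoord_vertex ha ha, if_pos rfl] at this
      exact one_ne_zero this
    · have hwa : ev (baryCoord K₁.1 a) w = 0 := by
        by_contra h
        exact haF (Finset.mem_filter.2 ⟨ha, h⟩)
      have hlim : Filter.Tendsto (fun t : ℝ => w + t • (a - w)) (nhdsWithin 0 (Set.Ioi 0)) (nhds w) := by
        have : Continuous fun t : ℝ => w + t • (a - w) := by fun_prop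
        have h := this.tendsto 0
        simp only [zero_smul, add_zero] at h
        exact h.mono_left nhdsWithin_le_nhds
      obtain ⟨t, ⟨ht1, ht2⟩, ht0⟩ := (((hlim.eventually hpos₁).and (hlim.eventually hpos₂)).and
        self_mem_nhdsWithin).exists
      have hta : ev (baryCoord K₁.1 a) (w + t • (a - w)) = t := by
        have h1 := ev_affine (h₁.baryCoord_mem ha) Finset.univ ![1 - t, t] ![w, a] (by simp)
        simp only [Fin.sum_univ_two, Matrix.cons_val_zero, Matrix.cons_val_one] at h1
        rw [show w + t • (a - w) = (1 - t) • w + t • a by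
          rw [sub_smul, smul_sub, one_smul]; abel, h1, hwa, h₁.ev_baryCoord_vertex ha ha]
        simp
      have ht0' : (0 : ℝ) < t := ht0
      refine hne (T.cell_eq_of_mem_interior (x := w + t • (a - w)) ?_ ?_)
      · rw [h₁.interior_hull]
        intro c hc
        rw [← hK₁, Finset.mem_insert] at hc
        rcases hc with rfl | hc
        · rwa [hta]
        · exact ht1 c hc
      · rw [h₂.mem_hull_self_iff]
        intro c hc
        rw [← hK₂, Finset.mem_insert] at hc
        rcases hc with rfl | hc
        · have := hprop (w + t • (a - w))
          rw [hta] at this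
          by_contra! hlt
          nlinarith
        · exact (ht2 c hc).le
  -- Near `w` the coordinates of the vertices of the face are positive in both cells, so the sign of
  -- a single coordinate decides between them.
  filter_upwards [hpos₁, hpos₂] with x hx₁ hx₂
  by_cases hxa : 0 ≤ ev (baryCoord K₁.1 a) x
  · left
    rw [h₁.mem_hull_self_iff]
    intro c hc
    rw [← hK₁, Finset.mem_insert] at hc
    rcases hc with rfl | hc
    · exact hxa
    · exact (hx₁ c hc).le
  · right
    rw [h₂.mem_hull_self_iff]
    intro c hc
    rw [← hK₂, Finset.mem_insert] at hc
    rcases hc with rfl | hc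
    · have := hprop x
      by_contra! hlt
      nlinarith
    · exact (hx₂ c hc).le

end Mesh

end Matching

/-! ### Exterior points near a Lipschitz boundary -/

section Lipschitz

variable {d : ℕ}

/-- A point on a Lipschitz boundary is a limit of exterior points. -/
lemma mem_closure_compl_closure {Ω : Set (Point d)} (hΩ : IsOpen Ω) (hL : HasLipschitzBoundary Ω)
    {x : Point d} (hx : x ∈ frontier Ω) : x ∈ closure (closure Ω)ᶜ := by
  obtain ⟨ρ, hρ, e, he, L, g, hg, h⟩ := hL x hx
  have hxΩ : x ∉ Ω := by
    rw [frontier, hΩ.interior_eq] at hx; exact hx.2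
  have hee : ⟪e, e⟫_ℝ = 1 := by rw [real_inner_self_eq_norm_sq, he, one_pow]
  have hx' : ⟪e, x⟫_ℝ ≤ g (x - ⟪e, x⟫_ℝ • e) := by
    by_contra! hlt
    exact hxΩ ((h x (Metric.mem_ball_self hρ)).2 hlt)
  -- The points strictly below the graph form an open set disjoint from Ω, hence disjoint from its
  -- closure.
  have hO : IsOpen {y | y ∈ Metric.ball x ρ ∧ ⟪e, y⟫_ℝ < g (y - ⟪e, y⟫_ℝ • e)} := by
    have h1 : Continuous fun y : Point d => y - ⟪e, y⟫_ℝ • e := by fun_prop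
    have h2 : Continuous fun y : Point d => ⟪e, y⟫_ℝ := by fun_prop
    exact Metric.isOpen_ball.inter (isOpen_lt h2 (hg.continuous.comp h1))
  have hsub : {y | y ∈ Metric.ball x ρ ∧ ⟪e, y⟫_ℝ < g (y - ⟪e, y⟫_ℝ • e)} ⊆ (closure Ω)ᶜ := by
    rw [← interior_compl]
    refine interior_maximal (fun y hy hyΩ => ?_) hO
    exact absurd ((h y hy.1).1 hyΩ) (not_lt.2 hy.2.le)
  rw [Metric.mem_closure_iff]
  intro ε hε
  set t := min ε ρ / 2 with ht
  have ht0 : 0 < t := by positivity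
  have hdist : dist x (x - t • e) = t := by
    rw [dist_eq_norm, sub_sub_cancel, norm_smul, he, mul_one, Real.norm_of_nonneg ht0.le]
  refine ⟨x - t • e, hsub ⟨?_, ?_⟩, ?_⟩
  · rw [Metric.mem_ball, dist_comm, hdist]
    have := min_le_right ε ρ
    linarith
  -- Moving vertically leaves the argument of `g` unchanged and lowers the height.
  · have h1 : ⟪e, x - t • e⟫_ℝ = ⟪e, x⟫_ℝ - t := by
      rw [inner_sub_right, inner_smul_right, hee, mul_one]
    rw [h1, show x - t • e - (⟪e, x⟫_ℝ - t) • e = x - ⟪e, x⟫_ℝ • e by rw [sub_smul]; abel]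
    linarith
  · rw [hdist]
    have := min_le_left ε ρ
    linarith

end Lipschitz

/-! ### Connectivity of the cells at a point -/

namespace Mesh

variable {d : ℕ} {Ω : Set (Point d)} (T : Mesh d Ω)

/-- Cells are adjacent at `z` if they have a common face that contains `z`. -/
def faceGraph (z : Point d) : SimpleGraph T.Cell where
  Adj K K' := K ≠ K' ∧ ∃ F, F ⊆ K.1 ∧ F ⊆ K'.1 ∧ F.card = d ∧ z ∈ hull F
  symm := ⟨fun _ _ ⟨h, F, h1, h2, h3⟩ => ⟨h.symm, F, h2, h1, h3⟩⟩
  loopless := ⟨fun _ h => h.1 rfl⟩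

lemma mem_patch {z : Point d} {K : T.Cell} : K ∈ T.patch z ↔ z ∈ hull K.1 := by
  simp [patch]

/-- The points outside a null set see no lower dimensional vertex set from `x`. -/
lemma exists_mem_forall_notMem_affineSpan (x : Point d) {U : Set (Point d)} (hU : IsOpen U)
    (hne : U.Nonempty) : ∃ y ∈ U, ∀ K : T.Cell, ∀ S ⊆ K.1, S.card < d →
      y ∉ affineSpan ℝ (insert x (S : Set (Point d))) := by
  let I := (T.cells.biUnion Finset.powerset).filter fun S => S.card < d
  have h0 : volume (⋃ S ∈ I, (affineSpan ℝ (insert x (S : Set (Point d))) : Set (Point d))) = 0 := by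
    refine (measure_biUnion_null_iff I.countable_toSet).2 fun S hS => ?_
    have hS : S.card < d := (Finset.mem_filter.1 hS).2
    -- Fewer than `d` vertices and the point `x` span an affine space of dimension at most d - 1, a
    -- null set.
    refine Measure.addHaar_affineSubspace _ _ fun htop => ?_
    have h1 : (insert x S).card ≤ d := (Finset.card_insert_le _ _).trans hS
    have h0 : 0 < (insert x S).card := (Finset.insert_nonempty x S).card_pos
    have h2 := finrank_vectorSpan_image_finset_le ℝ (id : Point d → Point d) (insert x S)
      (n := (insert x S).card - 1) (by omega)
    rw [Finset.image_id, ← direction_affineSpan, Finset.coe_insert, htop,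
      AffineSubspace.direction_top, finrank_top, finrank_euclideanSpace_fin] at h2
    omega
  obtain ⟨y, hy, hyN⟩ : ∃ y ∈ U, y ∉ ⋃ S ∈ I,
      (affineSpan ℝ (insert x (S : Set (Point d))) : Set (Point d)) := by
    by_contra! h
    exact (hU.measure_pos volume hne).ne' (measure_mono_null h h0)
  refine ⟨y, hy, fun K S hS hc hyS => hyN (Set.mem_biUnion (x := S) ?_ hyS)⟩
  exact Finset.mem_filter.2 ⟨Finset.mem_biUnion.2 ⟨K.1, K.2, Finset.mem_powerset.2 hS⟩, hc⟩

/-- A set of cells at `z` covers a neighbourhood of `z` if it contains with each cell its neighbours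
at all faces through `z`. -/
lemma iUnion_hull_mem_nhds {z : Point d} {𝒞 : Set T.Cell} {K₀ : T.Cell} (hK₀ : K₀ ∈ 𝒞)
    (hz : z ∈ hull K₀.1)
    (h𝒞 : ∀ K ∈ 𝒞, ∀ F ⊆ K.1, F.card = d → z ∈ hull F → ∃ K' ∈ 𝒞, K' ≠ K ∧ F ⊆ K'.1) :
    ⋃ K ∈ 𝒞, hull K.1 ∈ nhds z := by
  set W := ⋃ K ∈ 𝒞, hull K.1 with hW
  have hWc : IsClosed W := (Set.toFinite 𝒞).isClosed_biUnion fun K _ => isClosed_hull K.1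
  have hsub : ∀ K ∈ 𝒞, hull K.1 ⊆ W := fun K hK => Set.subset_biUnion_of_mem (u := fun K : T.Cell => hull K.1) hK
  obtain ⟨ε, hε, hdisj⟩ := T.exists_ball_disjoint z
  by_contra hnot
  have hU : (Metric.ball z ε \ W).Nonempty := by
    by_contra h
    rw [Set.not_nonempty_iff_eq_empty, Set.sdiff_eq_empty] at h
    exact hnot (Filter.mem_of_superset (Metric.ball_mem_nhds z hε) h)
  obtain ⟨x, hxε, hx⟩ : (Metric.ball z ε ∩ interior (hull K₀.1)).Nonempty := by
    rw [← (T.isSimplex K₀).closure_interior_hull] at hz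
    exact _root_.mem_closure_iff.1 hz _ Metric.isOpen_ball (Metric.mem_ball_self hε)
  -- If `W` were no neighbourhood, its complement would be open and nonempty in the ball, and it
  -- would contain a generic `y`: the segment from `x` to `y` then meets faces of codimension at
  -- least two at most at `x`.
  obtain ⟨y, ⟨hyε, hyW⟩, hy⟩ := T.exists_mem_forall_notMem_affineSpan x
    (Metric.isOpen_ball.sdiff hWc) hU
  have hγ : Continuous fun t : ℝ => AffineMap.lineMap x y t := AffineMap.lineMap_continuous
  have hcpt : IsCompact (Set.Icc (0 : ℝ) 1 ∩ (fun t : ℝ => AffineMap.lineMap x y t) ⁻¹' W) :=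
    isCompact_Icc.inter_right (hWc.preimage hγ)
  -- The last parameter at which the segment is in `W`. Since `W` turns out to be a neighbourhood of
  -- that point, maximality is violated.
  obtain ⟨t, ⟨⟨ht0, ht1⟩, htW⟩, hmax⟩ := hcpt.exists_isGreatest
    ⟨0, ⟨le_rfl, zero_le_one⟩, by simpa using hsub K₀ hK₀ (interior_subset hx)⟩
  have ht1 : t < 1 := ht1.lt_of_ne fun h => hyW (by simpa [h] using htW)
  set w : Point d := AffineMap.lineMap x y t with hw
  have hwε : w ∈ Metric.ball z ε :=
    (convex_ball z ε).lineMap_mem hxε hyε ⟨ht0, ht1.le⟩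
  obtain ⟨K, hK, hwK⟩ : ∃ K ∈ 𝒞, w ∈ hull K.1 := by simpa [hW] using htW
  have hKs := T.isSimplex K
  have hcw : w ∈ hull (carrier K.1 w) := hKs.mem_hull_carrier hwK
  -- The ball around `z` meets only faces that contain `z`, so the hypothesis on neighbours applies
  -- to the carrier of `w`.
  have hzc : z ∈ hull (carrier K.1 w) := by
    by_contra h
    exact Set.disjoint_left.1 (hdisj K _ (carrier_subset _ _) h) hwε hcw
  have hnhds : W ∈ nhds w := by
    rcases lt_trichotomy (carrier K.1 w).card d with h | h | h
    -- Codimension two or more. For t > 0 the point `y` would lie in the span of `x` and the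
    -- carrier, against genericity; for t = 0 the point is `x`, which is interior to K₀.
    · exfalso
      rcases ht0.eq_or_lt with h0 | h0
      · have hwx : w = x := by rw [hw, ← h0, AffineMap.lineMap_apply_zero]
        have hKK : K₀ = K := T.cell_eq_of_mem_interior hx (hwx ▸ hwK)
        have hcar : carrier K.1 w = K.1 :=
          (hKs.mem_interior_iff_carrier hwK).1 (by rw [hwx, ← hKK]; exact hx)
        rw [hcar, hKs.card] at h
        omega
      · refine hy K _ (carrier_subset _ _) h ?_
        have h1 : w ∈ affineSpan ℝ (insert x (carrier K.1 w : Set (Point d))) :=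
          affineSpan_mono ℝ (Set.subset_insert _ _) (convexHull_subset_affineSpan _ hcw)
        have h2 : x ∈ affineSpan ℝ (insert x (carrier K.1 w : Set (Point d))) :=
          subset_affineSpan ℝ _ (Set.mem_insert _ _)
        have h3 := AffineMap.lineMap_mem t⁻¹ h2 h1
        rwa [hw, AffineMap.lineMap_lineMap_right, inv_mul_cancel₀ h0.ne',
          AffineMap.lineMap_apply_one] at h3
    · obtain ⟨K', hK', hne, hsub'⟩ := h𝒞 K hK _ (carrier_subset _ _) h hzc
      exact Filter.mem_of_superset (T.union_hull_mem_nhds hne.symm hwK h hsub')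
        (Set.union_subset (hsub K hK) (hsub K' hK'))
    · have hcar : carrier K.1 w = K.1 := Finset.eq_of_subset_of_card_le (carrier_subset _ _)
        (by rw [hKs.card]; omega)
      exact Filter.mem_of_superset (mem_interior_iff_mem_nhds.1
        ((hKs.mem_interior_iff_carrier hwK).2 hcar)) (hsub K hK)
  have hev : ∀ᶠ s in nhdsWithin t (Set.Ioi t), AffineMap.lineMap x y s ∈ W ∧ s ∈ Set.Ioo t 1 :=
    ((hγ.tendsto t).mono_left nhdsWithin_le_nhds |>.eventually hnhds).and (Ioo_mem_nhdsGT ht1)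
  obtain ⟨s, hsW, hts, hs1⟩ := hev.exists
  exact absurd (hmax ⟨⟨ht0.trans hts.le, hs1.le⟩, hsW⟩) (not_le.2 hts)

lemma exists_adj_of_isInterface {z : Point d} {K : T.Cell} {F : T.Face} (hF : F.1 ⊆ K.1)
    (hz : z ∈ hull F.1) (hi : T.IsInterface F) :
    ∃ K', (T.faceGraph z).Adj K K' ∧ F.1 ⊆ K'.1 := by
  obtain ⟨K₁, K₂, hne, h₁, h₂⟩ := hi
  by_cases h : K = K₁
  · exact ⟨K₂, ⟨h ▸ hne, F.1, hF, h₂, T.face_card F, hz⟩, h₂⟩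
  · exact ⟨K₁, ⟨h, F.1, hF, h₁, T.face_card F, hz⟩, h₁⟩

lemma iUnion_reachable_mem_nhds {z : Point d} {K : T.Cell} (hz : z ∈ hull K.1)
    (h : ∀ K', (T.faceGraph z).Reachable K K' → ∀ F : T.Face, F.1 ⊆ K'.1 → z ∈ hull F.1 →
      T.IsInterface F) :
    ⋃ K' ∈ {K' | (T.faceGraph z).Reachable K K'}, hull K'.1 ∈ nhds z := by
  refine T.iUnion_hull_mem_nhds (K₀ := K) (SimpleGraph.Reachable.refl K) hz
    fun K' hK' F hF hc hzF => ?_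
  have hFf := T.mem_faces hF hc
  obtain ⟨K'', hadj, hsub⟩ := T.exists_adj_of_isInterface (F := ⟨F, hFf⟩) hF hzF
    (h K' hK' ⟨F, hFf⟩ hF hzF)
  exact ⟨K'', SimpleGraph.Reachable.trans hK' hadj.reachable, hadj.1.symm, hsub⟩

/-- The cells at a point of the domain are connected through faces that contain the point. -/
lemma reachable_of_mem (hΩ : IsOpen Ω) {z : Point d} (hzΩ : z ∈ Ω) {K K' : T.Cell}
    (hK : z ∈ hull K.1) (hK' : z ∈ hull K'.1) : (T.faceGraph z).Reachable K K' := by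
  -- A face through a point of Ω is an interface, so the cells reachable from `K` cover a
  -- neighbourhood and meet the interior of each cell at `z`.
  have hW := T.iUnion_reachable_mem_nhds hK fun K₁ _ F _ hzF => by
    by_contra hi
    have := T.isBoundaryFace_of_not_isInterface hΩ hi hzF
    rw [frontier, hΩ.interior_eq] at this
    exact this.2 hzΩ
  rw [← (T.isSimplex K').closure_interior_hull] at hK'
  obtain ⟨x, hx, hxK'⟩ := _root_.mem_closure_iff_nhds.1 hK' _ hW
  obtain ⟨K₁, h₁, hxK₁⟩ : ∃ K₁, (T.faceGraph z).Reachable K K₁ ∧ x ∈ hull K₁.1 := by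
    simpa using hx
  rwa [T.cell_eq_of_mem_interior hxK' hxK₁]

/-- The cells at a boundary point are connected to a cell with a boundary face that contains the
point. -/
lemma exists_reachable_not_isInterface (hΩ : IsOpen Ω) (hL : HasLipschitzBoundary Ω) {z : Point d}
    (hzΩ : z ∈ frontier Ω) {K : T.Cell} (hK : z ∈ hull K.1) :
    ∃ K', (T.faceGraph z).Reachable K K' ∧ ∃ F : T.Face, F.1 ⊆ K'.1 ∧ z ∈ hull F.1 ∧
      ¬ T.IsInterface F := by
  -- Otherwise the reachable cells would cover a neighbourhood of `z` inside the closure of Ω,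
  -- although exterior points accumulate at `z`.
  by_contra! h
  obtain ⟨x, hx, hxc⟩ := _root_.mem_closure_iff_nhds.1 (mem_closure_compl_closure hΩ hL hzΩ) _
    (T.iUnion_reachable_mem_nhds hK h)
  simp only [Set.mem_iUnion] at hx
  obtain ⟨K', -, hxK'⟩ := hx
  exact hxc (T.hull_subset_closure K' hxK')

lemma mem_hull_of_reachable {z : Point d} {K K' : T.Cell} (hK : z ∈ hull K.1)
    (h : (T.faceGraph z).Reachable K K') : z ∈ hull K'.1 := by
  obtain ⟨w⟩ := h
  induction w with
  | nil => exact hK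
  | cons hadj _ ih =>
    obtain ⟨-, F, -, h2, -, h3⟩ := hadj
    exact ih (hull_mono h2 h3)

/-- A path does not repeat cells and stays in the patch of `z`. -/
lemma exists_walk {z : Point d} {K K' : T.Cell} (hK : z ∈ hull K.1)
    (h : (T.faceGraph z).Reachable K K') :
    ∃ w : (T.faceGraph z).Walk K K', w.length ≤ (T.patch z).card := by
  obtain ⟨w, hw⟩ := h.exists_isPath
  refine ⟨w, ?_⟩
  have h1 : w.support.toFinset ⊆ T.patch z := fun K₁ h₁ => by
    rw [List.mem_toFinset] at h₁
    exact T.mem_patch.2 (T.mem_hull_of_reachable hK ⟨w.takeUntil K₁ h₁⟩)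
  have h2 := Finset.card_le_card h1
  rw [List.toFinset_card_of_nodup hw.support_nodup, SimpleGraph.Walk.length_support] at h2
  omega

end Mesh

/-! ### Consequences of shape regularity -/

section ShapeRegularity

variable {d : ℕ} {K : Finset (Point d)} {γ : ℝ}

lemma size_mono {S S' : Finset (Point d)} (h : S ⊆ S') : size S ≤ size S' :=
  Metric.diam_mono (hull_mono h) (isCompact_hull S').isBounded

lemma IsSimplex.exists_erase_eq (hK : IsSimplex K) {F : Finset (Point d)} (hF : F ⊆ K)
    (hc : F.card = d) : ∃ a ∈ K, F = K.erase a := by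
  obtain ⟨a, haF, h⟩ := (Finset.covBy_iff_exists_insert (s := F) (t := K)).1
    (Finset.covBy_iff_card_sdiff_eq_one.2 ⟨hF, by
      rw [Finset.card_sdiff_of_subset hF, hK.card, hc]; omega⟩)
  exact ⟨a, h ▸ Finset.mem_insert_self _ _, by rw [← h, Finset.erase_insert haF]⟩

namespace ShapeRegular

lemma size_le_face (hK : ShapeRegular γ K) (hd : 2 ≤ d) {F : Finset (Point d)} (hF : F ⊆ K)
    (hc : F.card = d) : size K ≤ 2 * γ * size F := by
  obtain ⟨x, r, hr, hb, hsz⟩ := hK.exists_ball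
  obtain ⟨a, ha, rfl⟩ := hK.simplex.exists_erase_eq hF hc
  have h1 := hK.simplex.radius_le_size_face hd ha hr hb
  have h2 := hK.simplex.size_pos (by omega)
  have h3 : 0 < γ := by
    by_contra! h
    nlinarith
  nlinarith

lemma pos (hK : ShapeRegular γ K) (hd : d ≠ 0) : 0 < γ := by
  obtain ⟨x, r, hr, hb, hsz⟩ := hK.exists_ball
  have h2 := hK.simplex.size_pos hd
  by_contra! h
  nlinarith

/-- Diameters of faces lie between those of the cell divided by 2γ and those of the cell. The bound
makes powers of 2γ increase with the length of a walk. -/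
lemma one_le (hK : ShapeRegular γ K) (hd : 2 ≤ d) : 1 ≤ 2 * γ := by
  obtain ⟨a, ha⟩ := hK.simplex.nonempty
  have h1 := hK.size_le_face hd (Finset.erase_subset a K)
    (by rw [Finset.card_erase_of_mem ha, hK.simplex.card]; rfl)
  have h2 := hK.simplex.size_pos (by omega)
  have h3 := size_mono (Finset.erase_subset a K)
  have := hK.pos (by omega)
  by_contra! h
  nlinarith

end ShapeRegular

/-- Needed because a real supremum of an unbounded set has the default value 0. -/
lemma IsSimplex.inradius_bddAbove (hK : IsSimplex K) (hd : d ≠ 0) :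
    BddAbove {r | 0 ≤ r ∧ ∃ x, Metric.ball x r ⊆ hull K} := by
  obtain ⟨a, ha⟩ := hK.nonempty
  have hG : 0 < ‖baryGrad K a‖ := norm_pos_iff.2 (hK.baryGrad_ne_zero hd ha)
  refine ⟨1 / ‖baryGrad K a‖, ?_⟩
  rintro r ⟨hr0, x, hb⟩
  rcases hr0.eq_or_lt with rfl | hr
  · positivity
  · have := hK.norm_baryGrad_le ha hr hb
    rw [le_div_iff₀ hr] at this
    rw [le_div_iff₀ hG]
    linarith

lemma IsSimplex.inradius_pos (hK : IsSimplex K) (hd : d ≠ 0) : 0 < inradius K := by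
  obtain ⟨x, hx⟩ := hK.interior_hull_nonempty
  obtain ⟨r, hr, hb⟩ := Metric.isOpen_iff.1 isOpen_interior x hx
  exact hr.trans_le (le_csSup (hK.inradius_bddAbove hd) ⟨hr.le, x, hb.trans interior_subset⟩)

end ShapeRegularity

/-! ### Shape parameter and size of patches -/

namespace Mesh

variable {d : ℕ} {Ω : Set (Point d)} (T : Mesh d Ω)

lemma shapeParameter_nonneg : 0 ≤ T.shapeParameter := Real.sInf_nonneg fun _ h => h.1

/-- The infimum is attained, since the constraints are closed; the sum of all ratios of diameter and
inradius shows that it is not taken over the empty set. -/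
lemma size_le_shapeParameter_mul (hd : d ≠ 0) (K : T.Cell) :
    size K.1 ≤ T.shapeParameter * inradius K.1 := by
  have hpos := (T.isSimplex K).inradius_pos hd
  rw [← div_le_iff₀ hpos]
  refine le_csInf ⟨∑ K' : T.Cell, size K'.1 / inradius K'.1, ?_, fun K' => ?_⟩ fun γ hγ => ?_
  · exact Finset.sum_nonneg fun K' _ => div_nonneg (size_nonneg _)
      ((T.isSimplex K').inradius_pos hd).le
  · rw [← div_le_iff₀ ((T.isSimplex K').inradius_pos hd)]
    exact Finset.single_le_sum (f := fun K' : T.Cell => size K'.1 / inradius K'.1)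
      (fun K' _ => div_nonneg (size_nonneg _) ((T.isSimplex K').inradius_pos hd).le)
      (Finset.mem_univ K')
  · rw [div_le_iff₀ hpos]
    exact hγ.2 K

/-- The inradius is a supremum that is not shown to be attained. A ball of more than half that
radius is at hand, at the price of a factor 2. -/
lemma shapeRegular (hd : d ≠ 0) (K : T.Cell) : ShapeRegular (2 * T.shapeParameter) K.1 := by
  refine ⟨T.isSimplex K, ?_⟩
  have hpos := (T.isSimplex K).inradius_pos hd
  have h0 := T.shapeParameter_nonneg
  obtain ⟨x₀, hx₀⟩ := (T.isSimplex K).nonempty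
  obtain ⟨r, ⟨hr0, x, hb⟩, hr⟩ := exists_lt_of_lt_csSup (s := {r | 0 ≤ r ∧ ∃ x, Metric.ball x r ⊆ hull K.1})
    ⟨0, le_rfl, x₀, by simp⟩ (half_lt_self hpos)
  change inradius K.1 / 2 < r at hr
  refine ⟨x, r, by linarith, hb, ?_⟩
  have := T.size_le_shapeParameter_mul hd K
  nlinarith

variable {γ : ℝ}

lemma size_le_of_adj (hγ : ∀ K : T.Cell, ShapeRegular γ K.1) (hd : 2 ≤ d) {z : Point d}
    {K K' : T.Cell} (h : (T.faceGraph z).Adj K K') : size K.1 ≤ 2 * γ * size K'.1 := by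
  obtain ⟨-, F, h1, h2, h3, -⟩ := h
  have := (hγ K).pos (by omega)
  exact ((hγ K).size_le_face hd h1 h3).trans
    (mul_le_mul_of_nonneg_left (size_mono h2) (by positivity))

lemma size_le_of_walk (hγ : ∀ K : T.Cell, ShapeRegular γ K.1) (hd : 2 ≤ d) {z : Point d}
    {K K' : T.Cell} (w : (T.faceGraph z).Walk K K') :
    size K.1 ≤ (2 * γ) ^ w.length * size K'.1 := by
  induction w with
  | nil => simp
  | @cons K₁ _ _ hadj w ih =>
    have := (hγ K₁).pos (by omega)
    rw [SimpleGraph.Walk.length_cons, pow_succ', mul_assoc]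
    exact (T.size_le_of_adj hγ hd hadj).trans (mul_le_mul_of_nonneg_left ih (by positivity))

lemma abs_sub_le_of_walk {z : Point d} {f : T.Cell → ℝ} {M : ℝ} {K K' : T.Cell}
    (w : (T.faceGraph z).Walk K K')
    (h : ∀ K₁ K₂, (T.faceGraph z).Reachable K K₁ → (T.faceGraph z).Adj K₁ K₂ →
      |f K₁ - f K₂| ≤ M) : |f K - f K'| ≤ w.length * M := by
  induction w with
  | nil => simp
  | cons hadj w ih =>
    have h1 := h _ _ (SimpleGraph.Reachable.refl _) hadj
    have h2 := ih fun K₁ K₂ hr => h K₁ K₂ (hadj.reachable.trans hr)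
    rw [SimpleGraph.Walk.length_cons]
    push_cast
    have := abs_sub_le (f _) (f _) (f _) |>.trans (add_le_add h1 h2)
    linarith

/-- The number of cells at a point is bounded in terms of the shape regularity. -/
lemma card_patch_le (hγ0 : 0 ≤ γ) (hγ : ∀ K : T.Cell, ShapeRegular γ K.1) (hd : d ≠ 0) (z : Point d) :
    ((T.patch z).card : ℝ) ≤ γ ^ d := by
  rcases (T.patch z).eq_empty_or_nonempty with he | hne
  · simpa [he] using pow_nonneg hγ0 d
  obtain ⟨K₀, hK₀, hmin⟩ := (T.patch z).exists_min_image (fun K => size K.1) hne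
  set ρ := size K₀.1 with hρ
  have hρ0 : 0 < ρ := (T.isSimplex K₀).size_pos hd
  have hγ0 := (hγ K₀).pos hd
  -- Each cell is shrunk towards `z` to the smallest diameter ρ in the patch. The image stays in the
  -- cell and in the ρ-ball about `z`, and it still contains a ball of radius ρ/γ.
  have key : ∀ K ∈ T.patch z, ∃ x : Point d, Metric.ball x (ρ / γ) ⊆ interior (hull K.1) ∧
      Metric.ball x (ρ / γ) ⊆ Metric.closedBall z ρ := by
    intro K hK
    obtain ⟨x, r, hr, hb, hsz⟩ := (hγ K).exists_ball
    have hs := (T.isSimplex K).size_pos hd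
    have hzK := T.mem_patch.1 hK
    set t := ρ / size K.1 with ht
    have ht0 : 0 < t := by positivity
    have ht1 : t ≤ 1 := (div_le_one hs).2 (hmin K hK)
    have hsub : ∀ y ∈ Metric.ball (z + t • (x - z)) (ρ / γ), ∃ y' ∈ hull K.1, y = z + t • (y' - z) := by
      intro y hy
      refine ⟨z + t⁻¹ • (y - z), hb ?_, ?_⟩
      · rw [Metric.mem_ball, dist_eq_norm] at hy ⊢
        have h1 : z + t⁻¹ • (y - z) - x = t⁻¹ • (y - (z + t • (x - z))) := by
          rw [← sub_sub, smul_sub t⁻¹ (y - z), smul_smul, inv_mul_cancel₀ ht0.ne', one_smul]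
          abel
        rw [h1, norm_smul, norm_inv, Real.norm_of_nonneg ht0.le, inv_mul_lt_iff₀ ht0]
        refine hy.trans_le ?_
        rw [ht, div_mul_eq_mul_div, div_le_div_iff₀ hγ0 hs]
        nlinarith
      · rw [add_sub_cancel_left, smul_smul, mul_inv_cancel₀ ht0.ne', one_smul, add_sub_cancel]
    refine ⟨z + t • (x - z), interior_maximal (fun y hy => ?_) Metric.isOpen_ball, fun y hy => ?_⟩
    · obtain ⟨y', hy', rfl⟩ := hsub y hy
      exact (convex_hull K.1).add_smul_sub_mem hzK hy' ⟨ht0.le, ht1⟩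
    · obtain ⟨y', hy', rfl⟩ := hsub y hy
      rw [Metric.mem_closedBall, dist_eq_norm, add_sub_cancel_left, norm_smul,
        Real.norm_of_nonneg ht0.le, ← dist_eq_norm]
      calc t * dist y' z ≤ t * size K.1 := mul_le_mul_of_nonneg_left (dist_le_size hy' hzK) ht0.le
        _ = ρ := div_mul_cancel₀ _ hs.ne'
  choose! x hx₁ hx₂ using key
  have hdisj : (T.patch z : Set T.Cell).PairwiseDisjoint fun K => Metric.ball (x K) (ρ / γ) := by
    intro K hK K' hK' hne
    refine Set.disjoint_left.2 fun y hy hy' => hne ?_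
    exact T.cell_eq_of_mem_interior (hx₁ K hK hy) (interior_subset (hx₁ K' hK' hy'))
  -- Comparing the volume of the disjoint small balls with that of the ρ-ball bounds their number by
  -- γ^d.
  have hle : volume (⋃ K ∈ T.patch z, Metric.ball (x K) (ρ / γ)) ≤ volume (Metric.closedBall z ρ) :=
    measure_mono (Set.iUnion₂_subset hx₂)
  rw [measure_biUnion_finset hdisj fun _ _ => measurableSet_ball] at hle
  have hV : volume (Metric.ball (0 : Point d) 1) ≠ 0 := (Metric.measure_ball_pos _ _ one_pos).ne'
  have hV' : volume (Metric.ball (0 : Point d) 1) ≠ ⊤ := measure_ball_lt_top.ne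
  have h1 : ∀ K ∈ T.patch z, volume (Metric.ball (x K) (ρ / γ)) =
      ENNReal.ofReal ((ρ / γ) ^ d) * volume (Metric.ball (0 : Point d) 1) := fun K _ => by
    rw [Measure.addHaar_ball_of_pos _ _ (by positivity), finrank_euclideanSpace_fin]
  rw [Finset.sum_congr rfl h1, Finset.sum_const, Measure.addHaar_closedBall _ _ hρ0.le,
    finrank_euclideanSpace_fin, nsmul_eq_mul, ← mul_assoc,
    ENNReal.mul_le_mul_iff_left hV hV', ← ENNReal.ofReal_natCast,
    ← ENNReal.ofReal_mul (by positivity), ENNReal.ofReal_le_ofReal_iff (by positivity), div_pow,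
    mul_div_assoc', div_le_iff₀ (by positivity), mul_comm (ρ ^ d)] at hle
  exact le_of_mul_le_mul_right hle (by positivity)

end Mesh

/-! ### Linear algebra of moments -/

section Integrals

variable {d : ℕ}

/-- The integral of polynomials against a measure. -/
def integralPoly (μ : Measure (Point d)) (hμ : ∀ q : Poly d, Integrable (ev q) μ) :
    Poly d →ₗ[ℝ] ℝ where
  toFun q := ∫ x, ev q x ∂μ
  map_add' q r := by simp only [ev_add]; exact integral_add (hμ q) (hμ r)
  map_smul' c q := by simp only [ev_smul, RingHom.id_apply, smul_eq_mul]; exact integral_const_mul c _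

lemma integralPoly_apply (μ : Measure (Point d)) (hμ : ∀ q : Poly d, Integrable (ev q) μ)
    (q : Poly d) : integralPoly μ hμ q = ∫ x, ev q x ∂μ := rfl

/-- `gradDot` as a bilinear map. -/
def gradDotBilin (d : ℕ) : Poly d →ₗ[ℝ] Poly d →ₗ[ℝ] Poly d :=
  LinearMap.mk₂ ℝ gradDot
    (fun q r s => by simp [gradDot, add_mul, Finset.sum_add_distrib])
    (fun c q r => by simp [gradDot, Finset.smul_sum])
    (fun q r s => by simp [gradDot, mul_add, Finset.sum_add_distrib])
    (fun c q r => by simp [gradDot, Finset.smul_sum])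

lemma gradDot_comm (q r : Poly d) : gradDot q r = gradDot r q := by
  simp only [gradDot, mul_comm]

lemma gradDot_add_left (q r s : Poly d) : gradDot (q + r) s = gradDot q s + gradDot r s :=
  (gradDotBilin d).map_add₂ q r s

lemma gradDot_sub_left (q r s : Poly d) : gradDot (q - r) s = gradDot q s - gradDot r s :=
  (gradDotBilin d).map_sub₂ q r s

lemma gradDot_smul_left (c : ℝ) (q r : Poly d) : gradDot (c • q) r = c • gradDot q r :=
  (gradDotBilin d).map_smul₂ c q r

lemma gradDot_C_left (c : ℝ) (r : Poly d) : gradDot (MvPolynomial.C c) r = 0 := by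
  simp [gradDot]

/-- `lapl` as a linear map. -/
def laplLin (d : ℕ) : Poly d →ₗ[ℝ] Poly d where
  toFun := lapl
  map_add' q r := by simp [lapl, Finset.sum_add_distrib]
  map_smul' c q := by simp [lapl, Finset.smul_sum]

lemma laplLin_apply (q : Poly d) : laplLin d q = lapl q := rfl

/-- `normalDeriv` as a linear map. -/
def normalDerivLin (n : Point d) : Poly d →ₗ[ℝ] Poly d where
  toFun := normalDeriv n
  map_add' q r := by simp [normalDeriv, mul_add, Finset.sum_add_distrib]
  map_smul' c q := by simp [normalDeriv, Finset.smul_sum]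

lemma normalDerivLin_apply (n : Point d) (q : Poly d) : normalDerivLin n q = normalDeriv n q := rfl

namespace IsSimplex

variable {K S : Finset (Point d)} {n : ℕ}

lemma integrable_ev (hK : IsSimplex K) (hS : S ⊆ K) (hn : S.card = n + 1) (q : Poly d) :
    Integrable (ev q) ((μHE[n] : Measure (Point d)).restrict (hull S)) :=
  hK.integrableOn_hull hS hn (continuous_ev q)

lemma eq_zero_of_weighted_moment (hK : IsSimplex K) (hS : S ⊆ K) (hn : S.card = n + 1) {κ : ℝ}
    (hκ : κ ≠ 0) {m : ℤ} {b : Poly d} (hb : b ∈ polySpace d m)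
    (h : ∫ x in hull S, ev b x * ev b x * (κ * ∏ p ∈ S, ev (baryCoord K p) x)
      ∂(μHE[n] : Measure (Point d)) = 0) : ∀ x ∈ hull S, ev b x = 0 := by
  obtain ⟨C, hC, hmain⟩ := exists_sq_mul_area_le n m.toNat
  intro x hx
  have h1 := hmain d K S hK hS hn b (polySpace_mono (Int.self_le_toNat m) hb) x hx
  have h2 : ∀ x, ev b x * ev b x * (κ * ∏ p ∈ S, ev (baryCoord K p) x) =
      κ * (ev b x ^ 2 * ∏ p ∈ S, ev (baryCoord K p) x) := fun x => by ring
  simp only [h2, integral_const_mul, mul_eq_zero, hκ, false_or] at h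
  rw [h, mul_zero] at h1
  have h3 := hK.area_pos hS hn
  by_contra h0
  have : 0 < ev b x ^ 2 := by positivity
  nlinarith

/-- A polynomial in `d` variables may vanish on a lower-dimensional simplex without being zero, so
the weighted form can be degenerate. The moment functional vanishes on its isotropic vectors, and
`exists_representer` needs no more. -/
lemma exists_weighted_moment (hK : IsSimplex K) (hS : S ⊆ K) (hn : S.card = n + 1) {κ : ℝ}
    (hκ : κ ≠ 0) (m : ℤ) (w : Poly d) : ∃ b ∈ polySpace d m, ∀ q ∈ polySpace d m,
      ∫ x in hull S, ev q x * ev b x * (κ * ∏ p ∈ S, ev (baryCoord K p) x)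
        ∂(μHE[n] : Measure (Point d)) =
      ∫ x in hull S, ev q x * ev w x ∂(μHE[n] : Measure (Point d)) := by
  let L := integralPoly ((μHE[n] : Measure (Point d)).restrict (hull S)) (hK.integrable_ev hS hn)
  let W : Poly d := MvPolynomial.C κ * ∏ p ∈ S, baryCoord K p
  let B : LinearMap.BilinForm ℝ (polySpace d m) :=
    ((LinearMap.mul ℝ (Poly d)).compr₂ (L ∘ₗ LinearMap.mulRight ℝ W)).domRestrict₁₂ _ _
  have hB : ∀ u v, B u v = ∫ x in hull S, ev u.1 x * ev v.1 x *
      (κ * ∏ p ∈ S, ev (baryCoord K p) x) ∂(μHE[n] : Measure (Point d)) := fun u v => by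
    change L (u.1 * v.1 * W) = _
    simp [L, W, integralPoly_apply]
  let l : polySpace d m →ₗ[ℝ] ℝ := (L ∘ₗ LinearMap.mulRight ℝ w) ∘ₗ (polySpace d m).subtype
  have hl : ∀ v, l v = ∫ x in hull S, ev v.1 x * ev w x ∂(μHE[n] : Measure (Point d)) := fun v => by
    change L (v.1 * w) = _
    simp [L, integralPoly_apply]
  obtain ⟨b, hb⟩ := exists_representer B (fun u v => by simp only [hB, mul_comm (ev u.1 _)]) l
    fun v hv => by
      rw [hB] at hv
      rw [hl, setIntegral_congr_fun (g := fun _ => 0) (measurableSet_hull S), integral_zero]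
      exact fun x hx => by simp [hK.eq_zero_of_weighted_moment hS hn hκ v.2 hv x hx]
  refine ⟨b.1, b.2, fun q hq => ?_⟩
  have := hb ⟨q, hq⟩
  rw [hB, hl] at this
  simpa only [mul_comm (ev q _) (ev b.1 _)] using this

lemma baryCoord_eq_on_hull {K' : Finset (Point d)} (hK : IsSimplex K) (hK' : IsSimplex K')
    (hS : S ⊆ K) (hS' : S ⊆ K') {a : Point d} (ha : a ∈ S) {x : Point d} (hx : x ∈ hull S) :
    ev (baryCoord K a) x = ev (baryCoord K' a) x := by
  rw [hull, Finset.mem_convexHull'] at hx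
  obtain ⟨w, -, hw, rfl⟩ := hx
  rw [hK.baryCoord_combination hS hw (hS ha), hK'.baryCoord_combination hS' hw (hS' ha)]

lemma isConst_of_grad (hK : IsSimplex K) {m : ℕ} {q : Poly d} (hq : q ∈ polySpace d m)
    (h : cellInt K (fun x => ev (gradDot q q) x) = 0) : ∃ c, q = MvPolynomial.C c := by
  obtain ⟨C, hC, hmain⟩ := exists_norm_grad_sq_mul_area_le d m
  have hA := hK.area_self_pos
  have h0 : ∀ x ∈ hull K, ‖grad q x‖ ≤ 0 := fun x hx => by
    have h1 := hmain K hK q hq x hx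
    rw [h, mul_zero] at h1
    by_contra! h2
    have : 0 < ‖grad q x‖ ^ 2 := by positivity
    nlinarith
  obtain ⟨a, ha⟩ := hK.nonempty
  refine ⟨ev q a, eq_of_ev_eqOn hK.interior_hull_nonempty fun x hx => ?_⟩
  have h1 := abs_ev_sub_le (convex_hull K) q h0 (subset_hull K ha) hx
  rw [zero_mul] at h1
  rw [ev_C, ← sub_eq_zero]
  exact abs_nonpos_iff.1 h1

end IsSimplex

end Integrals

/-! ### Well-posedness of the reconstruction and of the bubble operators -/

namespace Mesh

variable {d : ℕ} {Ω : Set (Point d)} (T : Mesh d Ω)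

section Reconstruction

variable (p : ℕ)

lemma integrable_cell (K : T.Cell) (q : Poly d) : Integrable (ev q) (volume.restrict (hull K.1)) :=
  IsSimplex.integrableOn_cell (continuous_ev q)

lemma integrable_face (hd : d ≠ 0) (F : T.Face) (q : Poly d) :
    Integrable (ev q) ((μHE[d - 1] : Measure (Point d)).restrict (hull F.1)) := by
  obtain ⟨K, hFK, hc⟩ := T.exists_cell_of_mem_faces F.2
  exact (T.isSimplex K).integrable_ev hFK (by omega) q

/-- A discrete Neumann problem: the energy form degenerates only on constants, and there the
right-hand side vanishes because it contains only derivatives of the test polynomial. A constant is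
then added to adjust the mean value. -/
lemma exists_isReconstruction (hd : d ≠ 0) (s : T.CellPoly × T.FacePoly) (K : T.Cell) :
    ∃ r, T.IsReconstruction p s K r := by
  have hK := T.isSimplex K
  let L := integralPoly _ (T.integrable_cell K)
  let LF : T.Face → Poly d →ₗ[ℝ] ℝ := fun F => integralPoly _ (T.integrable_face hd F)
  let V := polySpace d (p + 1)
  let B : LinearMap.BilinForm ℝ V := ((gradDotBilin d).compr₂ L).domRestrict₁₂ _ _
  have hB : ∀ u v, B u v = cellInt K.1 (fun x => ev (gradDot u.1 v.1) x) := fun u v => rfl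
  let l : V →ₗ[ℝ] ℝ := (-(L ∘ₗ LinearMap.mulLeft ℝ (s.1 K) ∘ₗ laplLin d) +
    ∑ F ∈ T.facesOf K, LF F ∘ₗ LinearMap.mulLeft ℝ (s.2 F) ∘ₗ
      normalDerivLin (outerNormal K.1 F.1)) ∘ₗ V.subtype
  have hl : ∀ v, l v = -cellInt K.1 (fun x => ev (s.1 K) x * ev (lapl v.1) x) +
        ∑ F ∈ T.facesOf K,
          faceInt F.1 (fun x => ev (s.2 F) x * ev (normalDeriv (outerNormal K.1 F.1) v.1) x) := by
    intro v
    simp only [← ev_mul]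
    simp [l, L, LF, integralPoly_apply, laplLin_apply, normalDerivLin_apply, cellInt, faceInt]
  obtain ⟨b, hb⟩ := exists_representer B (fun u v => by simp only [hB, gradDot_comm]) l
    fun v hv => by
      obtain ⟨c, hc⟩ := hK.isConst_of_grad (m := p + 1) (by push_cast; exact v.2) hv
      rw [hl, show v.1 = MvPolynomial.C c from hc]
      simp [lapl, normalDeriv, cellInt, faceInt]
  have hA := hK.area_self_pos
  set c : ℝ := (cellInt K.1 (fun x => ev (s.1 K) x) - cellInt K.1 (fun x => ev b.1 x)) / area d K.1
    with hc
  refine ⟨b.1 + MvPolynomial.C c, Submodule.add_mem _ b.2 (C_mem_polySpace c (by positivity)),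
    fun q hq => ?_, ?_⟩
  · have := hb ⟨q, hq⟩
    rw [hl, hB] at this
    rw [← this, gradDot_add_left, gradDot_C_left, add_zero]
  · have h1 : cellInt K.1 (fun x => ev (b.1 + MvPolynomial.C c) x) =
        cellInt K.1 (fun x => ev b.1 x) + area d K.1 * c := by
      simp only [ev_add, ev_C]
      rw [cellInt, integral_add (T.integrable_cell K _) (IsSimplex.integrableOn_cell continuous_const),
        setIntegral_const, IsSimplex.area_eq_volume]
      rfl
    rw [h1, hc, mul_div_cancel₀ _ hA.ne', add_sub_cancel]

lemma reconstruction_spec (hd : d ≠ 0) (s : T.CellPoly × T.FacePoly) (K : T.Cell) :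
    T.IsReconstruction p s K (T.reconstruction p s K) :=
  Classical.epsilon_spec (T.exists_isReconstruction p hd s K)

lemma IsReconstruction.unique {p : ℕ} {s : T.CellPoly × T.FacePoly} {K : T.Cell} {r r' : Poly d}
    (h : T.IsReconstruction p s K r) (h' : T.IsReconstruction p s K r') : r = r' := by
  obtain ⟨h1, h2, h3⟩ := h
  obtain ⟨h1', h2', h3'⟩ := h'
  have hK := T.isSimplex K
  have hs := Submodule.sub_mem _ h1 h1'
  obtain ⟨c, hc⟩ := hK.isConst_of_grad (m := p + 1) (q := r - r') (by push_cast; exact hs) (by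
    have h4 := (h2 _ hs).trans (h2' _ hs).symm
    rw [gradDot_sub_left, ← sub_eq_zero.2 h4]
    simp only [ev_sub]
    exact integral_sub (T.integrable_cell K _) (T.integrable_cell K _))
  have h5 : cellInt K.1 (fun x => ev (r - r') x) = 0 := by
    rw [← sub_eq_zero.2 (h3.trans h3'.symm)]
    simp only [ev_sub]
    exact integral_sub (T.integrable_cell K _) (T.integrable_cell K _)
  have hA := hK.area_self_pos
  rw [hc] at h5
  simp only [ev_C] at h5
  rw [cellInt, setIntegral_const, ← IsSimplex.area_eq_volume, smul_eq_mul, mul_eq_zero,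
    or_iff_right hA.ne'] at h5
  rw [← sub_eq_zero, hc, h5, map_zero]

lemma reconstruction_add (hd : d ≠ 0) (s t : T.CellPoly × T.FacePoly) :
    T.reconstruction p (s + t) = T.reconstruction p s + T.reconstruction p t := by
  ext1 K
  refine IsReconstruction.unique T (T.reconstruction_spec p hd (s + t) K) ?_
  obtain ⟨h1, h2, h3⟩ := T.reconstruction_spec p hd s K
  obtain ⟨k1, k2, k3⟩ := T.reconstruction_spec p hd t K
  have hc := T.integrable_cell K
  refine ⟨Submodule.add_mem _ h1 k1, fun q hq => ?_, ?_⟩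
  · have e1 : ∀ u v : Poly d, cellInt K.1 (fun x => ev (u + v) x) =
        cellInt K.1 (fun x => ev u x) + cellInt K.1 (fun x => ev v x) := fun u v => by
      simp only [ev_add]; exact integral_add (hc u) (hc v)
    have e2 : ∀ (F : T.Face) (u v : Poly d), faceInt F.1 (fun x => ev (u + v) x) =
        faceInt F.1 (fun x => ev u x) + faceInt F.1 (fun x => ev v x) := fun F u v => by
      simp only [ev_add]; exact integral_add (T.integrable_face hd F u) (T.integrable_face hd F v)
    have h2 := h2 q hq
    have k2 := k2 q hq
    simp only [← ev_mul] at h2 k2 ⊢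
    simp only [Pi.add_apply, Prod.fst_add, Prod.snd_add, gradDot_add_left, add_mul, e1, e2,
      Finset.sum_add_distrib] at h2 k2 ⊢
    rw [h2, k2]; ring
  · simp only [Pi.add_apply, Prod.fst_add, ev_add]
    rw [cellInt, cellInt, integral_add (hc _) (hc _), integral_add (hc _) (hc _)]
    exact congrArg₂ _ h3 k3

lemma reconstruction_smul (hd : d ≠ 0) (c : ℝ) (s : T.CellPoly × T.FacePoly) :
    T.reconstruction p (c • s) = c • T.reconstruction p s := by
  ext1 K
  refine IsReconstruction.unique T (T.reconstruction_spec p hd (c • s) K) ?_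
  obtain ⟨h1, h2, h3⟩ := T.reconstruction_spec p hd s K
  refine ⟨Submodule.smul_mem _ c h1, fun q hq => ?_, ?_⟩
  · have h2 := h2 q hq
    simp only [Pi.smul_apply, Prod.smul_fst, Prod.smul_snd, gradDot_smul_left, ev_smul, mul_assoc,
      cellInt, faceInt, integral_const_mul, ← Finset.mul_sum] at h2 ⊢
    rw [h2]; ring
  · simp only [Pi.smul_apply, Prod.smul_fst, ev_smul, cellInt, integral_const_mul] at h3 ⊢
    rw [h3]

end Reconstruction

section Bubbles

variable (p : ℕ)

lemma ev_elementBubble (K : Finset (Point d)) (x : Point d) : ev (elementBubble K) x =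
    ((d : ℝ) + 1) ^ (d + 1) * ∏ a ∈ K, ev (baryCoord K a) x := by
  simp [elementBubble]

lemma ev_faceBubble {K F : Finset (Point d)} (h : F ⊆ K) (x : Point d) : ev (faceBubble K F) x =
    (d : ℝ) ^ d * ∏ a ∈ F, ev (baryCoord K a) x := by
  simp [faceBubble, h]

lemma faceBubble_eq_on_hull {K K' : T.Cell} {F : Finset (Point d)} (h : F ⊆ K.1) (h' : F ⊆ K'.1)
    {x : Point d} (hx : x ∈ hull F) : ev (faceBubble K.1 F) x = ev (faceBubble K'.1 F) x := by
  rw [ev_faceBubble h, ev_faceBubble h', Finset.prod_congr rfl fun a ha =>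
    (T.isSimplex K).baryCoord_eq_on_hull (T.isSimplex K') h h' ha hx]

lemma bubbleCell_spec (K : T.Cell) (w : Poly d) :
    T.bubbleCell p K (ev w) ∈ polySpace d ((p : ℤ) - 1) ∧ ∀ q ∈ polySpace d ((p : ℤ) - 1),
      cellInt K.1 (fun x => ev q x * ev (T.bubbleCell p K (ev w)) x * ev (elementBubble K.1) x) =
        cellInt K.1 (fun x => ev q x * ev w x) := by
  have hK := T.isSimplex K
  have hex : ∃ b, b ∈ polySpace d ((p : ℤ) - 1) ∧ ∀ q ∈ polySpace d ((p : ℤ) - 1),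
      cellInt K.1 (fun x => ev q x * ev b x * ev (elementBubble K.1) x) =
        cellInt K.1 (fun x => ev q x * ev w x) := by
    simp only [cellInt_eq, ev_elementBubble]
    exact hK.exists_weighted_moment subset_rfl hK.card (by positivity) _ w
  exact Classical.epsilon_spec hex

lemma bubbleCell_unique {K : T.Cell} {w b : Poly d} (hb : b ∈ polySpace d ((p : ℤ) - 1))
    (h : ∀ q ∈ polySpace d ((p : ℤ) - 1),
      cellInt K.1 (fun x => ev q x * ev b x * ev (elementBubble K.1) x) =
        cellInt K.1 (fun x => ev q x * ev w x)) : T.bubbleCell p K (ev w) = b := by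
  have hK := T.isSimplex K
  obtain ⟨h1, h2⟩ := T.bubbleCell_spec p K w
  have hs := Submodule.sub_mem _ h1 hb
  refine eq_of_ev_eqOn hK.interior_hull_nonempty fun x hx => ?_
  rw [← sub_eq_zero, ← ev_sub]
  refine hK.eq_zero_of_weighted_moment subset_rfl hK.card
    (κ := ((d : ℝ) + 1) ^ (d + 1)) (by positivity) hs ?_ x hx
  have h3 := sub_eq_zero.2 ((h2 _ hs).trans (h _ hs).symm)
  simp only [← ev_mul] at h3
  rw [cellInt, cellInt, ← integral_sub (T.integrable_cell K _) (T.integrable_cell K _)] at h3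
  rw [← cellInt_eq, cellInt, ← h3]
  congr 1 with x
  simp only [ev_mul, ev_sub, ev_elementBubble]
  ring

lemma bubbleFace_spec (hd : d ≠ 0) (F : T.Face) (w : Poly d) :
    T.bubbleFace p F (ev w) ∈ polySpace d p ∧ ∀ K : T.Cell, F.1 ⊆ K.1 → ∀ r ∈ polySpace d p,
      faceInt F.1 (fun x => ev r x * ev (T.bubbleFace p F (ev w)) x * ev (faceBubble K.1 F.1) x) =
        faceInt F.1 (fun x => ev r x * ev w x) := by
  obtain ⟨K₀, hF₀, hc⟩ := T.exists_cell_of_mem_faces F.2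
  have hd' : (d : ℝ) ≠ 0 := by exact_mod_cast hd
  obtain ⟨b, hb, h⟩ := (T.isSimplex K₀).exists_weighted_moment hF₀ (n := d - 1) (by omega)
    (κ := (d : ℝ) ^ d) (by positivity) p w
  have hex : ∃ b, b ∈ polySpace d p ∧ ∀ K : T.Cell, F.1 ⊆ K.1 → ∀ r ∈ polySpace d p,
      faceInt F.1 (fun x => ev r x * ev b x * ev (faceBubble K.1 F.1) x) =
        faceInt F.1 (fun x => ev r x * ev w x) := by
    refine ⟨b, hb, fun K hK r hr => ?_⟩
    rw [faceInt, faceInt, ← h r hr]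
    refine setIntegral_congr_fun (measurableSet_hull F.1) fun x hx => ?_
    simp only [← ev_faceBubble hF₀, T.faceBubble_eq_on_hull hK hF₀ hx]
  exact Classical.epsilon_spec hex

/-- Only the restriction to the face is unique; as a polynomial in `d` variables the chosen
`bubbleFace` is not. -/
lemma bubbleFace_unique (hd : d ≠ 0) {F : T.Face} {w b : Poly d} (hb : b ∈ polySpace d p)
    {K : T.Cell} (hF : F.1 ⊆ K.1) (h : ∀ r ∈ polySpace d p,
      faceInt F.1 (fun x => ev r x * ev b x * ev (faceBubble K.1 F.1) x) =
        faceInt F.1 (fun x => ev r x * ev w x)) {x : Point d} (hx : x ∈ hull F.1) :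
    ev (T.bubbleFace p F (ev w)) x = ev b x := by
  obtain ⟨h1, h2⟩ := T.bubbleFace_spec p hd F w
  have hs := Submodule.sub_mem _ h1 hb
  have hd' : (d : ℝ) ≠ 0 := by exact_mod_cast hd
  rw [← sub_eq_zero, ← ev_sub]
  refine (T.isSimplex K).eq_zero_of_weighted_moment hF (n := d - 1) (by rw [T.face_card]; omega)
    (κ := (d : ℝ) ^ d) (by positivity) hs ?_ x hx
  have h3 := (h2 K hF _ hs).trans (h _ hs).symm
  simp only [← ev_mul] at h3
  simp only [← ev_faceBubble hF, ← ev_mul]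
  rw [mul_sub, sub_mul, ← sub_eq_zero.2 h3]
  simp only [ev_sub]
  exact integral_sub (T.integrable_face hd F _) (T.integrable_face hd F _)

end Bubbles

end Mesh

/-! ### Continuity and boundary values of the building blocks -/

namespace Mesh

variable {d : ℕ} {Ω : Set (Point d)} (T : Mesh d Ω)

/-- Element-wise polynomials that are continuous and vanish on the boundary of the domain. -/
structure Conforming (u : T.CellPoly) : Prop where
  agree : ∀ (K K' : T.Cell) (x : Point d), x ∈ hull K.1 → x ∈ hull K'.1 → ev (u K) x = ev (u K') x
  vanish : ∀ (K : T.Cell) (x : Point d), x ∈ hull K.1 → x ∈ frontier Ω → ev (u K) x = 0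

variable {T}

namespace Conforming

lemma zero : T.Conforming 0 := ⟨fun _ _ _ _ _ => by simp, fun _ _ _ _ => by simp⟩

lemma add {u v : T.CellPoly} (hu : T.Conforming u) (hv : T.Conforming v) : T.Conforming (u + v) :=
  ⟨fun K K' x h h' => by simp [hu.agree K K' x h h', hv.agree K K' x h h'],
    fun K x h h' => by simp [hu.vanish K x h h', hv.vanish K x h h']⟩

lemma sum {ι : Type*} (s : Finset ι) {u : ι → T.CellPoly} (h : ∀ i ∈ s, T.Conforming (u i)) :
    T.Conforming (∑ i ∈ s, u i) :=
  Finset.sum_induction u T.Conforming (fun _ _ => add) zero h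

lemma mul {u v : T.CellPoly} (hu : ∀ (K K' : T.Cell) (x : Point d), x ∈ hull K.1 → x ∈ hull K'.1 →
    ev (u K) x = ev (u K') x) (hv : T.Conforming v) : T.Conforming (u * v) :=
  ⟨fun K K' x h h' => by simp [hu K K' x h h', hv.agree K K' x h h'],
    fun K x h h' => by simp [hv.vanish K x h h']⟩

lemma toFun_eq {u : T.CellPoly} (hu : T.Conforming u) {K : T.Cell} {x : Point d}
    (hx : x ∈ hull K.1) : T.toFun u x = ev (u K) x := by
  have h : ∃ K : T.Cell, x ∈ hull K.1 := ⟨K, hx⟩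
  rw [toFun, dif_pos h]
  exact hu.agree _ _ _ h.choose_spec hx

end Conforming

variable (T)

lemma exists_boundary_face (hΩ : IsOpen Ω) (hL : HasLipschitzBoundary Ω) {x : Point d}
    (hx : x ∈ frontier Ω) {K : T.Cell} (hK : x ∈ hull K.1) :
    ∃ (K' : T.Cell) (F : T.Face), F.1 ⊆ K'.1 ∧ x ∈ hull F.1 ∧ ¬ T.IsInterface F := by
  obtain ⟨K', -, F, h⟩ := T.exists_reachable_not_isInterface hΩ hL hx hK
  exact ⟨K', F, h⟩

/-- On the common face both traces are determined by their values at the nodes of that face, which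
are nodes of both cells. -/
lemma lagrangeBasis_agree {m : ℕ} (hm : m ≠ 0) (z : Point d) (K K' : T.Cell) (x : Point d)
    (h : x ∈ hull K.1) (h' : x ∈ hull K'.1) :
    ev (lagrangeBasis m K.1 z) x = ev (lagrangeBasis m K'.1 z) x := by
  have hx : x ∈ hull (K.1 ∩ K'.1) := T.hull_inter K K' ▸ ⟨h, h'⟩
  have hK := T.isSimplex K
  have hK' := T.isSimplex K'
  rw [← sub_eq_zero, ← ev_sub]
  refine hK.ev_eq_zero_of_nodes hm Finset.inter_subset_left
    (Submodule.sub_mem _ (hK.lagrangeBasis_mem hm z) (hK'.lagrangeBasis_mem hm z))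
    (fun y hy => ?_) hx
  rw [ev_sub, (hK.lagrangeBasis_spec hm z).2 y (lagrangeNodes_mono Finset.inter_subset_left hy),
    (hK'.lagrangeBasis_spec hm z).2 y (lagrangeNodes_mono Finset.inter_subset_right hy), sub_self]

/-- A boundary point lies on some face that is no interface. That face is contained in the boundary,
so it misses the node `z`, and the basis function vanishes on it. -/
lemma conforming_lagrangeBasis (hΩ : IsOpen Ω) (hL : HasLipschitzBoundary Ω) {m : ℕ} (hm : m ≠ 0)
    {z : Point d} (hz : z ∉ frontier Ω) (c : ℝ) :
    T.Conforming fun K => MvPolynomial.C c * lagrangeBasis m K.1 z := by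
  refine ⟨fun K K' x h h' => by simp [T.lagrangeBasis_agree hm z K K' x h h'], fun K x h hx => ?_⟩
  obtain ⟨K', F, hF, hxF, hi⟩ := T.exists_boundary_face hΩ hL hx h
  rw [ev_mul, T.lagrangeBasis_agree hm z K K' x h (hull_mono hF hxF),
    (T.isSimplex K').lagrangeBasis_eq_zero_on hm hF (fun hzF => hz
      (T.isBoundaryFace_of_not_isInterface hΩ hi hzF)) hxF, mul_zero]

lemma conforming_averaging (hΩ : IsOpen Ω) (hL : HasLipschitzBoundary Ω) (p : ℕ)
    (s : T.CellPoly × T.FacePoly) : T.Conforming (T.averaging p s) := by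
  have h : T.averaging p s = ∑ z ∈ T.interiorNodes (p + 1), fun K : T.Cell =>
      MvPolynomial.C (((T.patch z).card : ℝ)⁻¹ *
        ∑ K₁ ∈ T.patch z, ev (T.reconstruction p s K₁) z) * lagrangeBasis (p + 1) K.1 z := by
    ext1 K
    rw [Finset.sum_apply]
    rfl
  rw [h]
  exact Conforming.sum _ fun z hz => T.conforming_lagrangeBasis hΩ hL p.succ_ne_zero
    (Finset.mem_filter.1 hz).2 _

lemma faceBubble_eq_zero {K : T.Cell} {F S : Finset (Point d)} (hS : S ⊆ K.1) (h : ¬ F ⊆ S)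
    {x : Point d} (hx : x ∈ hull S) : ev (faceBubble K.1 F) x = 0 := by
  by_cases hF : F ⊆ K.1
  · obtain ⟨a, haF, haS⟩ := Finset.not_subset.1 h
    rw [ev_faceBubble hF, Finset.prod_eq_zero haF, mul_zero]
    exact (((T.isSimplex K).mem_hull_iff hS).1 hx).2 a (hF haF) haS
  · simp [faceBubble, hF]

lemma conforming_faceBubble (hΩ : IsOpen Ω) (hL : HasLipschitzBoundary Ω) {F : T.Face}
    (hF : T.IsInterface F) : T.Conforming fun K => faceBubble K.1 F.1 := by
  refine ⟨fun K K' x h h' => ?_, fun K x h hx => ?_⟩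
  · have hxS : x ∈ hull (K.1 ∩ K'.1) := T.hull_inter K K' ▸ ⟨h, h'⟩
    by_cases hs : F.1 ⊆ K.1 ∩ K'.1
    · have h1 := hs.trans Finset.inter_subset_left
      have h2 := hs.trans Finset.inter_subset_right
      rw [ev_faceBubble h1, ev_faceBubble h2, Finset.prod_congr rfl fun a ha =>
        (T.isSimplex K).baryCoord_eq_on_hull (T.isSimplex K') Finset.inter_subset_left
          Finset.inter_subset_right (hs ha) hxS]
    · rw [T.faceBubble_eq_zero Finset.inter_subset_left hs hxS,
        T.faceBubble_eq_zero Finset.inter_subset_right hs hxS]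
  · obtain ⟨K', G, hG, hxG, hi⟩ := T.exists_boundary_face hΩ hL hx h
    -- `K` need not contain the boundary face `G`, but `x` lies on their common vertices' hull. If
    -- that contained `F`, then F = G would not be an interface.
    refine T.faceBubble_eq_zero (S := G.1 ∩ K.1) Finset.inter_subset_right (fun hs => hi ?_)
      (T.mem_hull_of_subset hG (hull_mono hG hxG) h hxG)
    have : F = G := Subtype.ext (Finset.eq_of_subset_of_card_le
      (hs.trans Finset.inter_subset_left) (by rw [T.face_card, T.face_card]))
    rwa [← this]

lemma elementBubble_eq_zero {K : T.Cell} {x : Point d} (h : x ∈ hull K.1)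
    (hx : x ∉ interior (hull K.1)) : ev (elementBubble K.1) x = 0 := by
  have h1 : carrier K.1 x ≠ K.1 := fun h1 =>
    hx (((T.isSimplex K).mem_interior_iff_carrier h).2 h1)
  rw [carrier, Ne, Finset.filter_eq_self] at h1
  push Not at h1
  obtain ⟨a, ha, h0⟩ := h1
  rw [ev_elementBubble, Finset.prod_eq_zero ha h0, mul_zero]

/-- Element bubbles vanish outside the open cell. Open cells are disjoint from the other cells, and
they contain no boundary points because exterior points accumulate there. -/
lemma conforming_mul_elementBubble (hΩ : IsOpen Ω) (hL : HasLipschitzBoundary Ω)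
    (b : T.Cell → Poly d) : T.Conforming fun K => b K * elementBubble K.1 := by
  refine ⟨fun K K' x h h' => ?_, fun K x h hx => ?_⟩
  · by_cases hK : K = K'
    · rw [hK]
    · rw [ev_mul, ev_mul, T.elementBubble_eq_zero h fun hi => hK (T.cell_eq_of_mem_interior hi h'),
        T.elementBubble_eq_zero h' fun hi => hK (T.cell_eq_of_mem_interior hi h).symm]
      simp
  · rw [ev_mul, T.elementBubble_eq_zero h fun hi => ?_, mul_zero]
    obtain ⟨y, hy, hyc⟩ := _root_.mem_closure_iff.1 (mem_closure_compl_closure hΩ hL hx) _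
      isOpen_interior hi
    exact hyc (T.hull_subset_closure K (interior_subset hy))

section Skeleton

variable (p : ℕ)

/-- The function on the cells given by polynomials on the interfaces times face bubbles. -/
def skeletonOf (b : T.FacePoly) : T.CellPoly := fun K =>
  if p = 0 then ∑ F ∈ T.interfaces, b F * faceBubble K.1 F.1
  else ∑ F ∈ T.interfaces, ∑ z ∈ (T.nodes p).filter (fun z => z ∈ hull F.1),
    MvPolynomial.C (ev (b F) z) * lagrangeBasis p K.1 z * faceBubble K.1 F.1

lemma bubbleSkeleton_eq (v : T.Face → Point d → ℝ) :
    T.bubbleSkeleton p v = T.skeletonOf p fun F => T.bubbleFace p F (v F) := rfl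

lemma eq_C_of_mem {q : Poly d} (hq : q ∈ polySpace d (0 : ℕ)) : ∃ c, q = MvPolynomial.C c :=
  ⟨_, (MvPolynomial.totalDegree_eq_zero_iff_eq_C).1 (Nat.le_zero.1 (mem_polySpace_natCast.1 hq))⟩

lemma conforming_skeletonOf (hΩ : IsOpen Ω) (hL : HasLipschitzBoundary Ω)
    (b : T.FacePoly) : T.Conforming (T.skeletonOf p b) := by
  by_cases hp : p = 0
  · have h : T.skeletonOf p b = ∑ F ∈ T.interfaces,
        ((fun _ => b F) * fun K : T.Cell => faceBubble K.1 F.1 : T.CellPoly) := by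
      ext1 K
      simp [skeletonOf, hp]
    rw [h]
    exact Conforming.sum _ fun F hF => Conforming.mul (fun _ _ _ _ _ => rfl)
      (T.conforming_faceBubble hΩ hL (by simpa [interfaces] using hF))
  · have h : T.skeletonOf p b = ∑ F ∈ T.interfaces,
        ∑ z ∈ (T.nodes p).filter (fun z => z ∈ hull F.1),
        ((fun K : T.Cell => MvPolynomial.C (ev (b F) z) * lagrangeBasis p K.1 z) *
          fun K : T.Cell => faceBubble K.1 F.1 : T.CellPoly) := by
      ext1 K
      simp only [skeletonOf, hp, if_false, Finset.sum_apply, Pi.mul_apply]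
    rw [h]
    exact Conforming.sum _ fun F hF => Conforming.sum _ fun z _ => Conforming.mul
      (fun K K' x h h' => by simp [T.lagrangeBasis_agree hp z K K' x h h'])
      (T.conforming_faceBubble hΩ hL (by simpa [interfaces] using hF))

lemma skeletonOf_add (b b' : T.FacePoly) :
    T.skeletonOf p (b + b') = T.skeletonOf p b + T.skeletonOf p b' := by
  ext1 K
  by_cases hp : p = 0 <;>
    simp [skeletonOf, hp, add_mul, Finset.sum_add_distrib]

lemma skeletonOf_smul (c : ℝ) (b : T.FacePoly) :
    T.skeletonOf p (c • b) = c • T.skeletonOf p b := by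
  ext1 K
  by_cases hp : p = 0 <;>
    simp [skeletonOf, hp, Finset.smul_sum, MvPolynomial.smul_eq_C_mul, mul_assoc]

lemma face_nonempty (hd : d ≠ 0) (F : T.Face) : (F.1).Nonempty :=
  Finset.card_pos.1 (by rw [T.face_card]; omega)

/-- Only nodal values on the faces enter, or the constant if p = 0. Hence the ambiguity of
`bubbleFace` off its face does no harm to linearity. -/
lemma skeletonOf_congr (hd : d ≠ 0) {b b' : T.FacePoly} (hb : ∀ F, b F ∈ polySpace d p)
    (hb' : ∀ F, b' F ∈ polySpace d p) (h : ∀ F, ∀ x ∈ hull F.1, ev (b F) x = ev (b' F) x) :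
    T.skeletonOf p b = T.skeletonOf p b' := by
  ext1 K
  by_cases hp : p = 0
  · simp only [skeletonOf, hp, if_true]
    refine Finset.sum_congr rfl fun F _ => ?_
    subst hp
    obtain ⟨c, hc⟩ := eq_C_of_mem (hb F)
    obtain ⟨c', hc'⟩ := eq_C_of_mem (hb' F)
    obtain ⟨x, hx⟩ := T.face_nonempty hd F
    have := h F x (subset_hull _ hx)
    rw [hc, hc', ev_C, ev_C] at this
    rw [hc, hc', this]
  · simp only [skeletonOf, hp, if_false]
    refine Finset.sum_congr rfl fun F _ => Finset.sum_congr rfl fun z hz => ?_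
    rw [h F z (Finset.mem_filter.1 hz).2]

/-- The other face bubbles vanish on `F`, and the sum over the nodes in `F` is the Lagrange
interpolation of `b F`, exact on the face in degree `p`. -/
lemma ev_skeletonOf_face {b : T.FacePoly} (hb : ∀ F, b F ∈ polySpace d p) {K : T.Cell} {F : T.Face}
    (hF : F.1 ⊆ K.1) (hi : T.IsInterface F) {x : Point d} (hx : x ∈ hull F.1) :
    ev (T.skeletonOf p b K) x = ev (b F) x * ev (faceBubble K.1 F.1) x := by
  have hFi : F ∈ T.interfaces := by simpa [interfaces] using hi
  have h0 : ∀ F' : T.Face, F' ≠ F → ev (faceBubble K.1 F'.1) x = 0 := fun F' hne =>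
    T.faceBubble_eq_zero hF (fun hs => hne (Subtype.ext (Finset.eq_of_subset_of_card_le hs
      (by rw [T.face_card, T.face_card])))) hx
  by_cases hp : p = 0
  · simp only [skeletonOf, hp, if_true, ev_sum, ev_mul]
    exact Finset.sum_eq_single F (fun F' _ hne => by rw [h0 F' hne, mul_zero])
      fun h => absurd hFi h
  · simp only [skeletonOf, hp, if_false, ev_sum, ev_mul, ev_C, ← Finset.sum_mul]
    rw [Finset.sum_eq_single F (fun F' _ hne => by rw [h0 F' hne, mul_zero])
      fun h => absurd hFi h]
    congr 1
    have hK := T.isSimplex K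
    have hm : ∑ z ∈ (T.nodes p).filter (fun z => z ∈ hull F.1),
        MvPolynomial.C (ev (b F) z) * lagrangeBasis p K.1 z ∈ polySpace d p := by
      refine Submodule.sum_mem _ fun z _ => ?_
      rw [← MvPolynomial.smul_eq_C_mul]
      exact Submodule.smul_mem _ _ (hK.lagrangeBasis_mem hp z)
    have h1 := hK.ev_eq_zero_of_nodes hp hF (Submodule.sub_mem _ hm (hb F)) (fun y hy => ?_) hx
    · simpa [sub_eq_zero] using h1
    · have hyK := lagrangeNodes_mono hF hy
      simp only [ev_sub, ev_sum, ev_mul, ev_C, (hK.lagrangeBasis_spec hp _).2 y hyK, mul_ite,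
        mul_one, mul_zero, Finset.sum_ite_eq]
      rw [if_pos, sub_self]
      exact Finset.mem_filter.2 ⟨Finset.mem_biUnion.2 ⟨K.1, K.2, hyK⟩,
        lagrangeNodes_subset_hull hp hy⟩

end Skeleton

end Mesh

/-! ### Moments and linearity of the smoother -/

namespace Mesh

variable {d : ℕ} {Ω : Set (Point d)} (T : Mesh d Ω) (p : ℕ)

lemma bubbleFace_congr {F : T.Face} {v w : Point d → ℝ} (h : ∀ x ∈ hull F.1, v x = w x) :
    T.bubbleFace p F v = T.bubbleFace p F w := by
  have h1 : ∀ r : Poly d, faceInt F.1 (fun x => ev r x * v x) =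
      faceInt F.1 (fun x => ev r x * w x) := fun r =>
    setIntegral_congr_fun (measurableSet_hull F.1) fun x hx => by simp only [h x hx]
  simp only [bubbleFace, h1]

/-- A cell with the given face. -/
def cellOf (F : T.Face) : T.Cell := (T.exists_cell_of_mem_faces F.2).choose

lemma subset_cellOf (F : T.Face) : F.1 ⊆ (T.cellOf F).1 :=
  (T.exists_cell_of_mem_faces F.2).choose_spec.1

/-- The polynomials on the faces to which the bubble smoother is applied. -/
def faceResidual (s : T.CellPoly × T.FacePoly) : T.FacePoly := fun F =>
  s.2 F - T.averaging p s (T.cellOf F)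

/-- The part of the smoother that consists of face bubbles. -/
def facePart (s : T.CellPoly × T.FacePoly) : T.CellPoly :=
  T.skeletonOf p fun F => T.bubbleFace p F (ev (T.faceResidual p s F))

/-- The polynomials in the cells to which the operator with element bubbles is applied. -/
def cellResidual (s : T.CellPoly × T.FacePoly) : T.CellPoly :=
  s.1 - T.averaging p s - T.facePart p s

/-- The part of the smoother that consists of element bubbles. -/
def cellPart (s : T.CellPoly × T.FacePoly) : T.CellPoly := fun K =>
  T.bubbleCell p K (ev (T.cellResidual p s K)) * elementBubble K.1

/-- On a face `toFun` of the continuous averaging may be replaced by the polynomial of any adjacent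
cell. After that the bubble operators act on polynomials only. -/
lemma smoother_eq (hΩ : IsOpen Ω) (hL : HasLipschitzBoundary Ω) (s : T.CellPoly × T.FacePoly) :
    T.smoother p s = T.averaging p s + (T.facePart p s + T.cellPart p s) := by
  have h1 : T.bubbleSkeleton p (fun F x => ev (s.2 F) x - T.toFun (T.averaging p s) x) =
      T.facePart p s := by
    rw [bubbleSkeleton_eq, facePart]
    congr 1
    ext1 F
    refine T.bubbleFace_congr p fun x hx => ?_
    rw [faceResidual, ev_sub,
      (T.conforming_averaging hΩ hL p s).toFun_eq (hull_mono (T.subset_cellOf F) hx)]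
  rw [smoother, bubbleSmoother, h1]
  congr 2
  ext1 K
  simp only [bubbleMesh, cellPart, cellResidual, Pi.sub_apply]
  congr 2
  ext1 x
  simp

lemma conforming_smoother (hΩ : IsOpen Ω) (hL : HasLipschitzBoundary Ω)
    (s : T.CellPoly × T.FacePoly) : T.Conforming (T.smoother p s) := by
  rw [T.smoother_eq p hΩ hL]
  exact (T.conforming_averaging hΩ hL p s).add ((T.conforming_skeletonOf p hΩ hL _).add
    (T.conforming_mul_elementBubble hΩ hL _))

/-- The element bubbles reproduce the moments of what averaging and face bubbles leave over in the
cell, so the sum telescopes. -/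
lemma smoother_cell_moment (hΩ : IsOpen Ω) (hL : HasLipschitzBoundary Ω)
    (s : T.CellPoly × T.FacePoly) (K : T.Cell) {q : Poly d} (hq : q ∈ polySpace d ((p : ℤ) - 1)) :
    cellInt K.1 (fun x => ev q x * ev (T.smoother p s K) x) =
      cellInt K.1 (fun x => ev q x * ev (s.1 K) x) := by
  have h := (T.bubbleCell_spec p K (T.cellResidual p s K)).2 q hq
  have hc := T.integrable_cell K
  have h1 : ∀ x, ev q x * ev (T.smoother p s K) x = ev (q * (T.averaging p s K + T.facePart p s K)) x +
      ev q x * ev (T.bubbleCell p K (ev (T.cellResidual p s K))) x * ev (elementBubble K.1) x := by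
    intro x
    rw [T.smoother_eq p hΩ hL]
    simp [cellPart]
    ring
  have h2 : ∀ x, ev q x * ev (s.1 K) x = ev (q * (T.averaging p s K + T.facePart p s K)) x +
      ev q x * ev (T.cellResidual p s K) x := by
    intro x
    simp [cellResidual]
    ring
  simp only [h1, h2, ← ev_mul] at h ⊢
  rw [cellInt, cellInt, integral_add (hc _) (hc _), integral_add (hc _) (hc _)]
  exact congrArg _ h

lemma ev_faceResidual (hΩ : IsOpen Ω) (hL : HasLipschitzBoundary Ω) (s : T.CellPoly × T.FacePoly)
    {K : T.Cell} {F : T.Face} (hF : F.1 ⊆ K.1) {x : Point d} (hx : x ∈ hull F.1) :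
    ev (T.faceResidual p s F) x = ev (s.2 F) x - ev (T.averaging p s K) x := by
  rw [faceResidual, ev_sub, (T.conforming_averaging hΩ hL p s).agree (T.cellOf F) K x
    (hull_mono (T.subset_cellOf F) hx) (hull_mono hF hx)]

/-- On the face the element bubbles vanish and the face bubbles reproduce the moments of the
residual σ_Σ - Aσ, so again the sum telescopes. -/
lemma smoother_face_moment (hd : d ≠ 0) (hΩ : IsOpen Ω) (hL : HasLipschitzBoundary Ω)
    (s : T.CellPoly × T.FacePoly) {F : T.Face} (hi : T.IsInterface F) {K : T.Cell}
    (hF : F.1 ⊆ K.1) {r : Poly d} (hr : r ∈ polySpace d p) :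
    faceInt F.1 (fun x => ev r x * ev (T.smoother p s K) x) =
      faceInt F.1 (fun x => ev r x * ev (s.2 F) x) := by
  have h := (T.bubbleFace_spec p hd F (T.faceResidual p s F)).2 K hF r hr
  have hc := T.integrable_face hd F
  have hlt : ¬ K.1 ⊆ F.1 := fun hs => by
    have := Finset.card_le_card hs
    rw [T.face_card, (T.isSimplex K).card] at this
    omega
  obtain ⟨a, ha, haF⟩ := Finset.not_subset.1 hlt
  have h1 : ∀ x ∈ hull F.1, ev r x * ev (T.smoother p s K) x = ev (r * T.averaging p s K) x +
      ev r x * ev (T.bubbleFace p F (ev (T.faceResidual p s F))) x * ev (faceBubble K.1 F.1) x := by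
    intro x hx
    have h0 : ev (elementBubble K.1) x = 0 := by
      rw [ev_elementBubble, Finset.prod_eq_zero ha, mul_zero]
      exact (((T.isSimplex K).mem_hull_iff hF).1 hx).2 a ha haF
    rw [T.smoother_eq p hΩ hL]
    simp only [Pi.add_apply, ev_add, cellPart, ev_mul, h0, mul_zero, add_zero, facePart]
    rw [T.ev_skeletonOf_face p (fun F => (T.bubbleFace_spec p hd F _).1) hF hi hx]
    ring
  have h2 : ∀ x ∈ hull F.1, ev r x * ev (s.2 F) x = ev (r * T.averaging p s K) x +
      ev r x * ev (T.faceResidual p s F) x := by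
    intro x hx
    rw [T.ev_faceResidual p hΩ hL s hF hx, ev_mul]
    ring
  rw [faceInt, faceInt, setIntegral_congr_fun (measurableSet_hull F.1) h1,
    setIntegral_congr_fun (measurableSet_hull F.1) h2]
  simp only [← ev_mul] at h ⊢
  rw [integral_add (hc _) (hc _), integral_add (hc _) (hc _)]
  exact congrArg _ h

lemma averaging_add (hd : d ≠ 0) (s t : T.CellPoly × T.FacePoly) :
    T.averaging p (s + t) = T.averaging p s + T.averaging p t := by
  ext1 K
  simp [averaging, T.reconstruction_add p hd, Finset.sum_add_distrib, mul_add, add_mul]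

lemma averaging_smul (hd : d ≠ 0) (c : ℝ) (s : T.CellPoly × T.FacePoly) :
    T.averaging p (c • s) = c • T.averaging p s := by
  ext1 K
  simp only [averaging, T.reconstruction_smul p hd, Pi.smul_apply, ev_smul, Finset.smul_sum,
    ← Finset.mul_sum]
  refine Finset.sum_congr rfl fun z _ => ?_
  rw [MvPolynomial.smul_eq_C_mul, mul_left_comm _ c]
  simp only [map_mul, mul_assoc]

lemma bubbleFace_add (hd : d ≠ 0) (F : T.Face) (w w' : Poly d) {x : Point d} (hx : x ∈ hull F.1) :
    ev (T.bubbleFace p F (ev (w + w'))) x =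
      ev (T.bubbleFace p F (ev w) + T.bubbleFace p F (ev w')) x := by
  obtain ⟨h1, h2⟩ := T.bubbleFace_spec p hd F w
  obtain ⟨k1, k2⟩ := T.bubbleFace_spec p hd F w'
  have hF := T.subset_cellOf F
  have hc := T.integrable_face hd F
  refine T.bubbleFace_unique p hd (Submodule.add_mem _ h1 k1) hF (fun r hr => ?_) hx
  have h2 := h2 _ hF r hr
  have k2 := k2 _ hF r hr
  simp only [← ev_mul] at h2 k2 ⊢
  simp only [mul_add, add_mul, ev_add]
  rw [faceInt, faceInt, integral_add (hc _) (hc _), integral_add (hc _) (hc _)]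
  exact congrArg₂ _ h2 k2

lemma bubbleFace_smul (hd : d ≠ 0) (F : T.Face) (c : ℝ) (w : Poly d) {x : Point d}
    (hx : x ∈ hull F.1) :
    ev (T.bubbleFace p F (ev (c • w))) x = ev (c • T.bubbleFace p F (ev w)) x := by
  obtain ⟨h1, h2⟩ := T.bubbleFace_spec p hd F w
  have hF := T.subset_cellOf F
  refine T.bubbleFace_unique p hd (Submodule.smul_mem _ c h1) hF (fun r hr => ?_) hx
  have h2 := h2 _ hF r hr
  simp only [ev_smul, mul_left_comm _ c, mul_assoc, faceInt, integral_const_mul] at h2 ⊢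
  rw [h2]

lemma bubbleCell_add (K : T.Cell) (w w' : Poly d) :
    T.bubbleCell p K (ev (w + w')) = T.bubbleCell p K (ev w) + T.bubbleCell p K (ev w') := by
  obtain ⟨h1, h2⟩ := T.bubbleCell_spec p K w
  obtain ⟨k1, k2⟩ := T.bubbleCell_spec p K w'
  have hc := T.integrable_cell K
  refine T.bubbleCell_unique p (Submodule.add_mem _ h1 k1) fun r hr => ?_
  have h2 := h2 r hr
  have k2 := k2 r hr
  simp only [← ev_mul] at h2 k2 ⊢
  simp only [mul_add, add_mul, ev_add]
  rw [cellInt, cellInt, integral_add (hc _) (hc _), integral_add (hc _) (hc _)]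
  exact congrArg₂ _ h2 k2

lemma bubbleCell_smul (K : T.Cell) (c : ℝ) (w : Poly d) :
    T.bubbleCell p K (ev (c • w)) = c • T.bubbleCell p K (ev w) := by
  obtain ⟨h1, h2⟩ := T.bubbleCell_spec p K w
  refine T.bubbleCell_unique p (Submodule.smul_mem _ c h1) fun r hr => ?_
  have h2 := h2 r hr
  simp only [ev_smul, mul_left_comm _ c, mul_assoc, cellInt, integral_const_mul] at h2 ⊢
  rw [h2]

lemma facePart_add (hd : d ≠ 0) (s t : T.CellPoly × T.FacePoly) :
    T.facePart p (s + t) = T.facePart p s + T.facePart p t := by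
  rw [facePart, facePart, facePart, ← skeletonOf_add]
  refine T.skeletonOf_congr p hd (fun F => (T.bubbleFace_spec p hd F _).1)
    (fun F => Submodule.add_mem _ (T.bubbleFace_spec p hd F _).1 (T.bubbleFace_spec p hd F _).1)
    fun F x hx => ?_
  have h : T.faceResidual p (s + t) F = T.faceResidual p s F + T.faceResidual p t F := by
    simp only [faceResidual, T.averaging_add p hd, Pi.add_apply, Prod.snd_add]
    abel
  rw [h, T.bubbleFace_add p hd F _ _ hx]
  rfl

lemma facePart_smul (hd : d ≠ 0) (c : ℝ) (s : T.CellPoly × T.FacePoly) :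
    T.facePart p (c • s) = c • T.facePart p s := by
  rw [facePart, facePart, ← skeletonOf_smul]
  refine T.skeletonOf_congr p hd (fun F => (T.bubbleFace_spec p hd F _).1)
    (fun F => Submodule.smul_mem _ c (T.bubbleFace_spec p hd F _).1) fun F x hx => ?_
  have h : T.faceResidual p (c • s) F = c • T.faceResidual p s F := by
    simp only [faceResidual, T.averaging_smul p hd, Pi.smul_apply, Prod.smul_snd, smul_sub]
  rw [h, T.bubbleFace_smul p hd F _ _ hx]
  rfl

lemma cellPart_add (hd : d ≠ 0) (s t : T.CellPoly × T.FacePoly) :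
    T.cellPart p (s + t) = T.cellPart p s + T.cellPart p t := by
  ext1 K
  have h : T.cellResidual p (s + t) K = T.cellResidual p s K + T.cellResidual p t K := by
    simp only [cellResidual, T.averaging_add p hd, T.facePart_add p hd, Pi.add_apply,
      Pi.sub_apply, Prod.fst_add]
    abel
  simp only [cellPart, h, bubbleCell_add, Pi.add_apply, add_mul]

lemma cellPart_smul (hd : d ≠ 0) (c : ℝ) (s : T.CellPoly × T.FacePoly) :
    T.cellPart p (c • s) = c • T.cellPart p s := by
  ext1 K
  have h : T.cellResidual p (c • s) K = c • T.cellResidual p s K := by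
    simp only [cellResidual, T.averaging_smul p hd, T.facePart_smul p hd, Pi.smul_apply,
      Pi.sub_apply, Prod.smul_fst, smul_sub]
  simp only [cellPart, h, bubbleCell_smul, Pi.smul_apply, smul_mul_assoc]

lemma isLinearMap_smoother (hd : d ≠ 0) (hΩ : IsOpen Ω) (hL : HasLipschitzBoundary Ω) :
    IsLinearMap ℝ (T.smoother p) where
  map_add s t := by
    simp only [T.smoother_eq p hΩ hL, T.averaging_add p hd, T.facePart_add p hd,
      T.cellPart_add p hd]
    abel
  map_smul c s := by
    simp only [T.smoother_eq p hΩ hL, T.averaging_smul p hd, T.facePart_smul p hd,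
      T.cellPart_smul p hd, smul_add]

end Mesh

/-! ### Lipschitz functions and mollification -/

section Approximation

variable {d : ℕ}

/-- A function that is Lipschitz continuous on the members of a finite closed cover is Lipschitz
continuous. -/
lemma lipschitzWith_of_closed_cover {ι : Type*} [Finite ι] {A : ι → Set (Point d)}
    (hA : ∀ i, IsClosed (A i)) (hcov : ⋃ i, A i = Set.univ) {U : Point d → ℝ} {L : ℝ≥0}
    (hU : ∀ i, LipschitzOnWith L U (A i)) : LipschitzWith L U := by
  have hc : Continuous U := (locallyFinite_of_finite A).continuous hcov hA fun i => (hU i).continuousOn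
  refine LipschitzWith.of_dist_le_mul fun x y => ?_
  set f : ℝ → Point d := fun t => AffineMap.lineMap x y t with hf
  have hfc : Continuous f := AffineMap.lineMap_continuous
  have hfd : ∀ s t, dist (f s) (f t) = |s - t| * dist x y := fun s t => by
    rw [hf]
    simp only [dist_lineMap_lineMap, Real.dist_eq]
  -- Continuous induction along the segment from `x` to `y`.
  have h : Set.Icc (0 : ℝ) 1 ⊆ {t | dist (U x) (U (f t)) ≤ L * (t * dist x y)} := by
    refine IsClosed.Icc_subset_of_forall_exists_gt ?_ (by simp [hf]) ?_
    · refine IsClosed.inter ?_ isClosed_Icc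
      exact isClosed_le (by fun_prop) (by fun_prop)
    · rintro t ⟨ht, ht0, ht1⟩ s hs
      have hev : ∀ᶠ z in nhdsWithin t (Set.Ioi t), z ∈ Set.Ioc t s ∧ ∃ i, f z ∈ A i := by
        have h1 : ∀ᶠ z in nhdsWithin t (Set.Ioi t), z ∈ Set.Ioc t s := Ioc_mem_nhdsGT hs
        refine h1.and (Filter.Eventually.of_forall fun z => ?_)
        have : f z ∈ ⋃ i, A i := hcov ▸ Set.mem_univ _
        simpa using this
      -- As the cover is finite, a single member is visited arbitrarily soon after `t`; being closed
      -- it contains the point at `t`, so its Lipschitz bound extends the estimate.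
      obtain ⟨i, hi⟩ : ∃ i, ∃ᶠ z in nhdsWithin t (Set.Ioi t), f z ∈ A i := by
        by_contra! hnot
        have h1 : ∀ᶠ z in nhdsWithin t (Set.Ioi t), ∀ i, f z ∉ A i :=
          Filter.eventually_all.2 hnot
        obtain ⟨z, ⟨-, i, h2⟩, h3⟩ := (hev.and h1).exists
        exact h3 i h2
      have hti : f t ∈ A i := (hA i).mem_of_frequently_of_tendsto hi
        ((hfc.tendsto t).mono_left nhdsWithin_le_nhds)
      obtain ⟨z, hzi, hz, -⟩ := (hi.and_eventually hev).exists
      refine ⟨z, ?_, hz⟩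
      have h1 := (hU i).dist_le_mul _ hti _ hzi
      rw [hfd, abs_sub_comm, abs_of_pos (sub_pos.2 hz.1)] at h1
      have ht : dist (U x) (U (f t)) ≤ L * (t * dist x y) := ht
      show dist (U x) (U (f z)) ≤ L * (z * dist x y)
      have := dist_triangle (U x) (U (f t)) (U (f z))
      nlinarith
  have := h ⟨zero_le_one, le_rfl⟩
  simpa [hf] using this

lemma tendsto_eLpNorm_of_dominated {α E : Type*} [MeasurableSpace α] {μ : Measure α}
    [IsFiniteMeasure μ] [NormedAddCommGroup E] {f : ℕ → α → E} (C : ℝ≥0)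
    (hm : ∀ n, AEStronglyMeasurable (f n) μ) (hb : ∀ n, ∀ᵐ x ∂μ, ‖f n x‖ ≤ C)
    (hl : ∀ᵐ x ∂μ, Filter.Tendsto (fun n => f n x) Filter.atTop (nhds 0)) :
    Filter.Tendsto (fun n => eLpNorm (f n) 2 μ) Filter.atTop (nhds 0) := by
  have h1 : Filter.Tendsto (fun n => ∫⁻ x, ‖f n x‖ₑ ^ (2 : ℝ) ∂μ) Filter.atTop
      (nhds (∫⁻ _, 0 ∂μ)) := by
    refine tendsto_lintegral_of_dominated_convergence' (fun _ => (C : ℝ≥0∞) ^ (2 : ℝ))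
      (fun n => (hm n).enorm.pow_const _) (fun n => ?_) ?_ ?_
    · filter_upwards [hb n] with x hx
      refine ENNReal.rpow_le_rpow ?_ (by norm_num)
      rw [enorm_le_coe]
      exact hx
    · rw [lintegral_const]
      exact ENNReal.mul_ne_top (ENNReal.rpow_ne_top_of_nonneg (by norm_num) ENNReal.coe_ne_top)
        (measure_ne_top _ _)
    · filter_upwards [hl] with x hx
      have h2 : Filter.Tendsto (fun n => ‖f n x‖ₑ) Filter.atTop (nhds 0) := by
        simpa using hx.enorm
      simpa using h2.ennrpow_const 2
  have h2 := h1.ennrpow_const (1 / 2 : ℝ)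
  rw [lintegral_zero, ENNReal.zero_rpow_of_pos (by norm_num)] at h2
  refine h2.congr fun n => ?_
  rw [eLpNorm_eq_lintegral_rpow_enorm_toReal two_ne_zero ENNReal.ofNat_ne_top]
  norm_num

/-- Mollification. -/
lemma exists_mollification {V : Point d → ℝ} (hV : Continuous V) {ρ : ℝ} (hρ : 0 < ρ) :
    ∃ φ : Point d → ℝ, ContDiff ℝ ((⊤ : ℕ∞) : WithTop ℕ∞) φ ∧ ∀ (y y' : Point d) (a l c : ℝ),
      (∀ t ∈ Metric.ball (0 : Point d) ρ, |V (y - t) - a * V (y' - t) - l| ≤ c) →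
        |φ y - a * φ y' - l| ≤ c := by
  -- A bump of mass one supported in the ρ-ball, so averaging preserves every bound that is uniform
  -- over the shifts. The parameters `a`, `l` cover the support, the distance to `V`, and Lipschitz
  -- bounds after subtraction of a linear function.
  let b : ContDiffBump (0 : Point d) := ⟨ρ / 2, ρ, half_pos hρ, half_lt_self hρ⟩
  refine ⟨_, (b.hasCompactSupport_normed (μ := volume)).contDiff_convolution_left (ContinuousLinearMap.lsmul ℝ ℝ)
    b.contDiff_normed (hV.locallyIntegrable (μ := volume)), fun y y' a l c h => ?_⟩
  have hi : ∀ {f : Point d → ℝ}, Continuous f → Integrable (fun t => b.normed volume t * f t) :=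
    fun hf => (b.continuous_normed.mul hf).integrable_of_hasCompactSupport
      b.hasCompactSupport_normed.mul_right
  have h1 : ∀ y, convolution (b.normed volume) V (ContinuousLinearMap.lsmul ℝ ℝ) volume y =
      ∫ t, b.normed volume t * V (y - t) := fun y => rfl
  have h2 : ∫ t, b.normed volume t * l = l := by
    rw [integral_mul_const, b.integral_normed, one_mul]
  have e1 : Continuous fun t => V (y - t) := by fun_prop
  have e2 : Continuous fun t => a * V (y' - t) := by fun_prop
  have h3 : a * ∫ t, b.normed volume t * V (y' - t) = ∫ t, b.normed volume t * (a * V (y' - t)) := by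
    rw [← integral_const_mul]
    simp only [mul_left_comm]
  have h5 : ∫ t, b.normed volume t * (V (y - t) - a * V (y' - t) - l) =
      (∫ t, b.normed volume t * V (y - t)) - (∫ t, b.normed volume t * (a * V (y' - t))) -
        ∫ t, b.normed volume t * l := by
    have h6 : Integrable fun t => b.normed volume t * V (y - t) -
        b.normed volume t * (a * V (y' - t)) := (hi e1).sub (hi e2)
    simp only [mul_sub]
    rw [integral_sub h6 (hi continuous_const), integral_sub (hi e1) (hi e2)]
  have h4 : ∫ t, b.normed volume t * c = c := by
    rw [integral_mul_const, b.integral_normed, one_mul]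
  rw [h1, h1, h3]
  conv_lhs => rw [← h2]
  rw [← h5, ← h4, ← Real.norm_eq_abs]
  refine norm_integral_le_of_norm_le (hi continuous_const) (Filter.Eventually.of_forall fun t => ?_)
  rw [norm_mul, Real.norm_of_nonneg (b.nonneg_normed t), Real.norm_eq_abs]
  by_cases ht : t ∈ Metric.ball (0 : Point d) ρ
  · exact mul_le_mul_of_nonneg_left (h t ht) (b.nonneg_normed t)
  · have : b.normed volume t = 0 := by
      rw [← Function.notMem_support, b.support_normed_eq]
      exact ht
    simp [this]

/-- After subtraction of the linear function with gradient `g` the rest is Lipschitz with constant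
`c` near `x`. -/
lemma norm_gradient_sub_le {φ : Point d → ℝ} (hφ : Differentiable ℝ φ) {x g : Point d} {c : ℝ≥0}
    {S : Set (Point d)} (hS : S ∈ nhds x)
    (h : ∀ y ∈ S, ∀ y' ∈ S, |φ y - φ y' - ⟪g, y - y'⟫_ℝ| ≤ c * dist y y') :
    ‖gradient φ x - g‖ ≤ c := by
  have h1 : HasGradientAt (fun y => φ y - ⟪g, y⟫_ℝ) (gradient φ x - g) x := by
    have h2 : HasGradientAt (fun y => ⟪g, y⟫_ℝ) g x := by
      rw [hasGradientAt_iff_hasFDerivAt]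
      exact (innerSL ℝ g).hasFDerivAt
    rw [hasGradientAt_iff_hasFDerivAt, map_sub]
    exact (hφ x).hasGradientAt.hasFDerivAt.sub h2.hasFDerivAt
  have h2 : LipschitzOnWith c (fun y => φ y - ⟪g, y⟫_ℝ) S := LipschitzOnWith.of_dist_le_mul fun y hy y' hy' => by
    rw [Real.dist_eq]
    convert h y hy y' hy' using 2
    rw [inner_sub_right]; ring
  have h3 := norm_fderiv_le_of_lipschitzOn ℝ hS h2
  rwa [h1.hasFDerivAt.fderiv, LinearIsometryEquiv.norm_map] at h3

end Approximation

/-! ### Membership in H¹₀ by truncation and mollification -/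

section Approximation

variable {d : ℕ} {Ω : Set (Point d)}

lemma continuous_gradient {φ : Point d → ℝ} (hφ : ContDiff ℝ ((⊤ : ℕ∞) : WithTop ℕ∞) φ) :
    Continuous (gradient φ) :=
  (InnerProductSpace.toDual ℝ (Point d)).symm.continuous.comp
    (hφ.continuous_fderiv (by simp))

lemma norm_le_of_hasStrictFDerivAt {V : Point d → ℝ} {L : ℝ≥0} (hV : LipschitzWith L V)
    {x g : Point d} (h : HasStrictFDerivAt V (innerSL ℝ g) x) : ‖g‖ ≤ L := by
  have := norm_fderiv_le_of_lipschitz ℝ hV (x₀ := x)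
  rwa [h.hasFDerivAt.fderiv, innerSL_apply_norm] at this

/-- Mollification of Lipschitz functions with compact support in a domain. -/
lemma exists_smooth_approx (hΩ : IsOpen Ω) (hb : Bornology.IsBounded Ω) {V : Point d → ℝ} {L : ℝ≥0}
    (hV : LipschitzWith L V) (hc : HasCompactSupport V) (hs : tsupport V ⊆ Ω)
    {G : Point d → Point d} (hG : ∀ᵐ x, HasStrictFDerivAt V (innerSL ℝ (G x)) x) :
    ∃ φ : ℕ → Point d → ℝ, (∀ n, ContDiff ℝ ((⊤ : ℕ∞) : WithTop ℕ∞) (φ n) ∧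
        HasCompactSupport (φ n) ∧ tsupport (φ n) ⊆ Ω) ∧
      AEStronglyMeasurable G ∧
      Filter.Tendsto (fun n => eLpNorm (fun x => φ n x - V x) 2 (volume.restrict Ω))
        Filter.atTop (nhds 0) ∧
      Filter.Tendsto (fun n => eLpNorm (fun x => gradient (φ n) x - G x) 2 (volume.restrict Ω))
        Filter.atTop (nhds 0) := by
  have : IsFiniteMeasure (volume.restrict Ω) :=
    ⟨by rw [Measure.restrict_apply_univ]; exact hb.measure_lt_top⟩
  obtain ⟨δ, hδ, hthick⟩ := hc.isCompact.exists_cthickening_subset_open hΩ hs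
  let ρ : ℕ → ℝ := fun n => δ / (n + 1)
  have hρ : ∀ n, 0 < ρ n := fun n => by positivity
  have hρδ : ∀ n, ρ n ≤ δ := fun n => div_le_self hδ.le (by linarith [n.cast_nonneg (α := ℝ)])
  have hρ0 : Filter.Tendsto ρ Filter.atTop (nhds 0) := by
    simpa [ρ, div_eq_mul_inv] using tendsto_one_div_add_atTop_nhds_zero_nat.const_mul δ
  choose φ hφ hmoll using fun n => exists_mollification hV.continuous (hρ n)
  have hsub : ∀ n, tsupport (φ n) ⊆ Metric.cthickening δ (tsupport V) := by
    intro n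
    refine closure_minimal (fun y hy => ?_) Metric.isClosed_cthickening
    by_contra hnot
    refine hy ?_
    have := hmoll n y y 0 0 0 fun t ht => ?_
    · simpa using this
    · rw [zero_mul, sub_zero, sub_zero]
      by_contra h0
      refine hnot (Metric.mem_cthickening_of_dist_le y (y - t) δ _ (subset_tsupport V ?_) ?_)
      · intro h; rw [h] at h0; simp at h0
      · rw [dist_eq_norm, sub_sub_cancel]
        exact (mem_ball_zero_iff.1 ht).le.trans (hρδ n)
  have hlip : ∀ n y y', |φ n y - φ n y' - ⟪(0 : Point d), y - y'⟫_ℝ| ≤ L * dist y y' := by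
    intro n y y'
    rw [inner_zero_left]
    have := hmoll n y y' 1 0 (L * dist y y') fun t _ => ?_
    · simpa using this
    · rw [one_mul, sub_zero, ← Real.dist_eq]
      refine (hV.dist_le_mul _ _).trans_eq ?_
      rw [dist_sub_right]
  have hgb : ∀ n x, ‖gradient (φ n) x‖ ≤ L := fun n x => by
    simpa using norm_gradient_sub_le ((hφ n).differentiable (by simp)) Filter.univ_mem
      fun y _ y' _ => hlip n y y'
  have hclose : ∀ n y, |φ n y - V y| ≤ L * ρ n := by
    intro n y
    have := hmoll n y y 0 (V y) (L * ρ n) fun t ht => ?_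
    · simpa using this
    · rw [zero_mul, sub_zero, ← Real.dist_eq]
      refine (hV.dist_le_mul _ _).trans (mul_le_mul_of_nonneg_left ?_ L.coe_nonneg)
      rw [dist_eq_norm, sub_sub_cancel_left, norm_neg]
      exact (mem_ball_zero_iff.1 ht).le
  -- Strict differentiability means that `V` minus its linearization has an arbitrarily small
  -- Lipschitz constant near `x`; mollification with a small radius keeps it.
  have hlim : ∀ᵐ x, Filter.Tendsto (fun n => gradient (φ n) x) Filter.atTop (nhds (G x)) := by
    filter_upwards [hG] with x hx
    rw [tendsto_iff_norm_sub_tendsto_zero, Metric.tendsto_nhds]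
    intro ε hε
    let c : ℝ≥0 := ⟨ε / 2, by positivity⟩
    obtain ⟨S, hS, happ⟩ := hx.approximates_deriv_on_nhds (c := c) (Or.inr (by
      rw [← NNReal.coe_pos]; exact half_pos hε))
    obtain ⟨r, hr, hball⟩ := Metric.mem_nhds_iff.1 hS
    filter_upwards [(tendsto_order.1 hρ0).2 (r / 2) (half_pos hr)] with n hn
    have h1 : ‖gradient (φ n) x - G x‖ ≤ c := by
      refine norm_gradient_sub_le ((hφ n).differentiable (by simp))
        (Metric.ball_mem_nhds x (half_pos hr)) fun y hy y' hy' => ?_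
      have := hmoll n y y' 1 ⟪G x, y - y'⟫_ℝ (c * dist y y') fun t ht => ?_
      · simpa using this
      · have ht' := mem_ball_zero_iff.1 ht
        have hmem : ∀ w ∈ Metric.ball x (r / 2), w - t ∈ S := fun w hw => hball (by
          rw [Metric.mem_ball] at hw ⊢
          calc dist (w - t) x ≤ dist (w - t) w + dist w x := dist_triangle _ _ _
            _ < r := by rw [dist_eq_norm, sub_sub_cancel_left, norm_neg]; linarith)
        have h2 := happ _ (hmem y hy) _ (hmem y' hy')
        rw [sub_sub_sub_cancel_right, innerSL_apply_apply, Real.norm_eq_abs] at h2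
        rwa [one_mul, dist_eq_norm]
    rw [Real.dist_eq, sub_zero, abs_norm]
    refine h1.trans_lt ?_
    show ε / 2 < ε
    linarith
  have hGm : AEStronglyMeasurable G :=
    aestronglyMeasurable_of_tendsto_ae Filter.atTop
      (fun n => (continuous_gradient (hφ n)).aestronglyMeasurable) hlim
  refine ⟨φ, fun n => ⟨hφ n, ?_, (hsub n).trans hthick⟩, hGm, ?_, ?_⟩
  · exact hc.isCompact.cthickening.of_isClosed_subset (isClosed_tsupport _) (hsub n)
  · refine tendsto_eLpNorm_of_dominated (L * ⟨δ, hδ.le⟩)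
      (fun n => ((hφ n).continuous.sub hV.continuous).aestronglyMeasurable)
      (fun n => Filter.Eventually.of_forall fun x => ?_)
      (Filter.Eventually.of_forall fun x => ?_)
    · exact (hclose n x).trans (mul_le_mul_of_nonneg_left (hρδ n) L.coe_nonneg)
    · rw [tendsto_zero_iff_norm_tendsto_zero]
      refine squeeze_zero (fun _ => norm_nonneg _) (fun n => hclose n x) ?_
      simpa using hρ0.const_mul (L : ℝ)
  · refine tendsto_eLpNorm_of_dominated (L + L)
      (fun n => (continuous_gradient (hφ n)).aestronglyMeasurable.sub hGm.restrict)
      (fun n => ae_restrict_of_ae ?_) (ae_restrict_of_ae ?_)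
    · filter_upwards [hG] with x hx
      exact (norm_sub_le _ _).trans (add_le_add (hgb n x) (norm_le_of_hasStrictFDerivAt hV hx))
    · filter_upwards [hlim] with x hx
      simpa using hx.sub_const (G x)

/-- Soft thresholding. -/
def shrink (δ t : ℝ) : ℝ := t - max (-δ) (min δ t)

lemma abs_shrink_sub_le (δ s t : ℝ) : |shrink δ s - shrink δ t| ≤ |s - t| := by
  simp only [shrink]
  rcases le_total δ s with h1 | h1 <;> rcases le_total δ t with h2 | h2 <;>
    simp only [min_eq_left, min_eq_right, h1, h2] <;>
    rcases max_cases (-δ) s with ⟨h3, h3'⟩ | ⟨h3, h3'⟩ <;>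
    rcases max_cases (-δ) t with ⟨h4, h4'⟩ | ⟨h4, h4'⟩ <;>
    rcases max_cases (-δ) δ with ⟨h5, h5'⟩ | ⟨h5, h5'⟩ <;>
    simp only [h3, h4, h5] <;>
    rcases abs_cases (s - t) with ⟨h6, h6'⟩ | ⟨h6, h6'⟩ <;> rw [h6, abs_le] <;>
    constructor <;> linarith

lemma abs_shrink_sub_self_le {δ : ℝ} (hδ : 0 ≤ δ) (t : ℝ) : |shrink δ t - t| ≤ δ := by
  rw [shrink, sub_sub_cancel_left, abs_neg, abs_le]
  exact ⟨le_max_left _ _, max_le (by linarith) (min_le_left _ _)⟩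

lemma shrink_eq_zero {δ t : ℝ} (h : |t| ≤ δ) : shrink δ t = 0 := by
  obtain ⟨h1, h2⟩ := abs_le.1 h
  rw [shrink, min_eq_right h2, max_eq_right h1, sub_self]

lemma shrink_of_lt {δ t : ℝ} (hδ : 0 ≤ δ) (h : δ < t) : shrink δ t = t - δ := by
  rw [shrink, min_eq_left h.le, max_eq_right (by linarith)]

lemma shrink_of_gt {δ t : ℝ} (hδ : 0 ≤ δ) (h : t < -δ) : shrink δ t = t + δ := by
  rw [shrink, min_eq_right (by linarith), max_eq_left h.le, sub_neg_eq_add]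

/-- The kinks at |U| = δ are harmless where the gradient vanishes: soft thresholding does not
increase differences, so they remain of smaller order. -/
lemma hasStrictFDerivAt_shrink {U : Point d → ℝ} (hU : Continuous U) {x g : Point d}
    (h : HasStrictFDerivAt U (innerSL ℝ g) x) {δ : ℝ} (hδ : 0 ≤ δ) (h0 : |U x| = δ → g = 0) :
    HasStrictFDerivAt (fun y => shrink δ (U y)) (innerSL ℝ (if δ < |U x| then g else 0)) x := by
  rcases lt_trichotomy δ |U x| with hlt | heq | hgt
  · rw [if_pos hlt]
    rcases lt_abs.1 hlt with h1 | h1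
    · refine (h.sub_const δ).congr_of_eventuallyEq ?_
      filter_upwards [hU.continuousAt.eventually (lt_mem_nhds h1)] with y hy
      rw [shrink_of_lt hδ hy]
    · refine (h.add_const δ).congr_of_eventuallyEq ?_
      have h1 : U x < -δ := by linarith
      filter_upwards [hU.continuousAt.eventually (gt_mem_nhds h1)] with y hy
      rw [shrink_of_gt hδ hy]
  · rw [if_neg heq.not_lt]
    rw [h0 heq.symm] at h
    refine HasStrictFDerivAt.of_isLittleO (Asymptotics.IsBigO.trans_isLittleO ?_ h.isLittleO)
    refine Asymptotics.isBigO_of_le _ fun y => ?_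
    simpa using abs_shrink_sub_le δ (U y.1) (U y.2)
  · rw [if_neg hgt.not_gt, map_zero]
    refine (hasStrictFDerivAt_const (0 : ℝ) x).congr_of_eventuallyEq ?_
    filter_upwards [hU.abs.continuousAt.eventually (gt_mem_nhds hgt)] with y hy
    rw [shrink_eq_zero (le_of_lt hy)]

/-- Lipschitz functions that vanish outside a bounded domain are in `H¹₀`. -/
lemma memH10_of_lipschitzWith (hΩ : IsOpen Ω) (hb : Bornology.IsBounded Ω) {U : Point d → ℝ}
    {L : ℝ≥0} (hU : LipschitzWith L U) (hout : ∀ x ∉ Ω, U x = 0) {g : Point d → Point d}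
    (hg : ∀ᵐ x, HasStrictFDerivAt U (innerSL ℝ (g x)) x)
    (h0 : ∀ c : ℝ, ∀ᵐ x, U x = c → g x = 0) : MemH10 Ω U := by
  have : IsFiniteMeasure (volume.restrict Ω) :=
    ⟨by rw [Measure.restrict_apply_univ]; exact hb.measure_lt_top⟩
  let δ : ℕ → ℝ := fun n => 1 / ((n : ℝ) + 1)
  have hδ : ∀ n, 0 < δ n := fun n => by positivity
  have hδ0 : Filter.Tendsto δ Filter.atTop (nhds 0) := tendsto_one_div_add_atTop_nhds_zero_nat
  -- Thresholding confines the support to the set where |U| ≥ δ n, which is closed, bounded and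
  -- contained in Ω.
  let V : ℕ → Point d → ℝ := fun n x => shrink (δ n) (U x)
  let G : ℕ → Point d → Point d := fun n x => if δ n < |U x| then g x else 0
  have hVlip : ∀ n, LipschitzWith L (V n) := fun n => LipschitzWith.of_dist_le_mul fun x y =>
    (abs_shrink_sub_le _ _ _).trans (hU.dist_le_mul x y)
  have hclosed : ∀ n, IsClosed {x | δ n ≤ |U x|} := fun n =>
    isClosed_le continuous_const hU.continuous.abs
  have hsub : ∀ n, {x | δ n ≤ |U x|} ⊆ Ω := fun n x hx => by
    by_contra h
    have hx : δ n ≤ |U x| := hx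
    rw [hout x h, abs_zero] at hx
    exact (hδ n).not_ge hx
  have hVsupp : ∀ n, tsupport (V n) ⊆ {x | δ n ≤ |U x|} := fun n =>
    closure_minimal (fun x hx => by
      by_contra h
      exact hx (shrink_eq_zero (not_le.1 h).le)) (hclosed n)
  have hVc : ∀ n, HasCompactSupport (V n) := fun n =>
    (Metric.isCompact_of_isClosed_isBounded (hclosed n) (hb.subset (hsub n))).of_isClosed_subset
      (isClosed_tsupport _) (hVsupp n)
  -- The hypothesis on level sets is used at the kinks ±δ n, and below at 0, where it makes the
  -- truncated gradients converge.
  have hVG : ∀ n, ∀ᵐ x, HasStrictFDerivAt (V n) (innerSL ℝ (G n x)) x := fun n => by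
    filter_upwards [hg, h0 (δ n), h0 (-δ n)] with x hx h1 h2
    exact hasStrictFDerivAt_shrink hU.continuous hx (hδ n).le fun h =>
      (eq_or_eq_neg_of_abs_eq h).elim h1 h2
  choose φ hφ hGm hφV hφG using fun n =>
    exists_smooth_approx hΩ hb (hVlip n) (hVc n) ((hVsupp n).trans (hsub n)) (hVG n)
  have hlim : ∀ᵐ x, Filter.Tendsto (fun n => G n x) Filter.atTop (nhds (g x)) := by
    filter_upwards [h0 0] with x hx
    refine tendsto_nhds_of_eventually_eq ?_
    by_cases hUx : U x = 0
    · exact Filter.Eventually.of_forall fun n => by simp [G, hx hUx]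
    · filter_upwards [(tendsto_order.1 hδ0).2 _ (abs_pos.2 hUx)] with n hn
      exact if_pos hn
  have hgm : AEStronglyMeasurable g := aestronglyMeasurable_of_tendsto_ae Filter.atTop hGm hlim
  have hgb : ∀ᵐ x, ‖g x‖ ≤ L := hg.mono fun x hx => norm_le_of_hasStrictFDerivAt hU hx
  have hVU : Filter.Tendsto (fun n => eLpNorm (fun x => V n x - U x) 2 (volume.restrict Ω))
      Filter.atTop (nhds 0) := by
    have hle : ∀ n x, ‖V n x - U x‖ ≤ δ n := fun n x => abs_shrink_sub_self_le (hδ n).le _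
    refine tendsto_eLpNorm_of_dominated 1
      (fun n => ((hVlip n).continuous.sub hU.continuous).aestronglyMeasurable)
      (fun n => Filter.Eventually.of_forall fun x => (hle n x).trans ?_)
      (Filter.Eventually.of_forall fun x => ?_)
    · rw [NNReal.coe_one]
      exact div_le_one_of_le₀ (by linarith [n.cast_nonneg (α := ℝ)]) (by positivity)
    · rw [tendsto_zero_iff_norm_tendsto_zero]
      exact squeeze_zero (fun _ => norm_nonneg _) (fun n => hle n x) hδ0
  have hGg : Filter.Tendsto (fun n => eLpNorm (fun x => G n x - g x) 2 (volume.restrict Ω))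
      Filter.atTop (nhds 0) := by
    refine tendsto_eLpNorm_of_dominated L (fun n => (hGm n).restrict.sub hgm.restrict)
      (fun n => ae_restrict_of_ae ?_) (ae_restrict_of_ae ?_)
    · filter_upwards [hgb] with x hx
      by_cases h : δ n < |U x| <;> simp [G, h, hx]
    · filter_upwards [hlim] with x hx
      simpa using hx.sub_const (g x)
  have hcpt : IsCompact (closure Ω) := hb.isCompact_closure
  obtain ⟨M, hM⟩ := hcpt.exists_bound_of_continuousOn hU.continuous.continuousOn
  refine ⟨MemLp.of_bound hU.continuous.aestronglyMeasurable M
      ((ae_restrict_mem hΩ.measurableSet).mono fun x hx => hM x (subset_closure hx)), g,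
    MemLp.of_bound hgm.restrict L (ae_restrict_of_ae hgb), fun ε hε => ?_⟩
  have hε2 : 0 < ENNReal.ofReal (ε / 2) := ENNReal.ofReal_pos.2 (half_pos hε)
  have hadd : ENNReal.ofReal ε = ENNReal.ofReal (ε / 2) + ENNReal.ofReal (ε / 2) := by
    rw [← ENNReal.ofReal_add (by positivity) (by positivity), add_halves]
  -- The truncation is fixed before the mollification radius, which depends on it.
  obtain ⟨n, hn1, hn2⟩ := (((tendsto_order.1 hVU).2 _ hε2).and ((tendsto_order.1 hGg).2 _ hε2)).exists
  obtain ⟨m, hm1, hm2⟩ :=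
    (((tendsto_order.1 (hφV n)).2 _ hε2).and ((tendsto_order.1 (hφG n)).2 _ hε2)).exists
  obtain ⟨h1, h2, h3⟩ := hφ n m
  refine ⟨φ n m, h1, h2, h3, ?_, ?_⟩
  · have e : (fun x => φ n m x - U x) = (fun x => φ n m x - V n x) + fun x => V n x - U x := by
      ext x; simp
    rw [e, hadd]
    exact (eLpNorm_add_le (h1.continuous.sub (hVlip n).continuous).aestronglyMeasurable
      ((hVlip n).continuous.sub hU.continuous).aestronglyMeasurable one_le_two).trans
      (add_le_add hm1.le hn1.le)
  · have e : (fun x => gradient (φ n m) x - g x) =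
        (fun x => gradient (φ n m) x - G n x) + fun x => G n x - g x := by
      ext x; simp
    rw [e, hadd]
    exact (eLpNorm_add_le ((continuous_gradient h1).aestronglyMeasurable.sub (hGm n).restrict)
      ((hGm n).restrict.sub hgm.restrict) one_le_two).trans (add_le_add hm2.le hn2.le)

end Approximation

/-! ### Conforming element-wise polynomials are in H¹₀ -/

section Conformity

variable {d : ℕ}

/-- Almost everywhere on a level set of a polynomial, the gradient vanishes. -/
lemma ae_grad_eq_zero (q : Poly d) (c : ℝ) : ∀ᵐ x, ev q x = c → grad q x = 0 := by
  have h : ∀ i : Fin d, ∀ᵐ x : Point d, x ∈ {x | ev q x = c → ev (MvPolynomial.pderiv i q) x = 0} := by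
    intro i
    have hs : MeasurableSet {x : Point d | ev q x = c → ev (MvPolynomial.pderiv i q) x = 0} := by
      have h1 : MeasurableSet {x : Point d | ev q x = c} :=
        (isClosed_singleton.preimage (continuous_ev q)).measurableSet
      have h2 : MeasurableSet {x : Point d | ev (MvPolynomial.pderiv i q) x = 0} :=
        (isClosed_singleton.preimage (continuous_ev _)).measurableSet
      exact h1.imp h2
    set e : Point d := EuclideanSpace.single i 1 with he
    -- Fubini along lines in the i-th direction: on each line the polynomial either is constantly
    -- `c`, with zero derivative, or takes the value `c` finitely often.
    refine ae_mem_of_ae_add_linearMap_mem (LinearMap.toSpanSingleton ℝ (Point d) e)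
      (volume : Measure ℝ) volume hs fun y => ?_
    obtain ⟨P, -, hP⟩ := exists_line_polynomial (mem_polySpace_natCast.2 le_rfl : q ∈ polySpace d q.totalDegree) y e
    have hd : ∀ t, ev (MvPolynomial.pderiv i q) (y + t • e) = P.derivative.eval t := by
      intro t
      have h1 := hasDerivAt_ev_line q y e t
      have h2 := (P.hasDerivAt t).congr_of_eventuallyEq
        (f₁ := fun s => ev q (y + s • e)) (Filter.Eventually.of_forall fun s => (hP s).symm)
      rw [h2.unique h1, he, EuclideanSpace.inner_single_right]
      simp [grad_apply]
    by_cases hc : P = Polynomial.C c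
    · refine Filter.Eventually.of_forall fun t _ => ?_
      simp only [LinearMap.toSpanSingleton_apply] at *
      rw [hd, hc]
      simp
    · have hfin : {t : ℝ | (P - Polynomial.C c).IsRoot t}.Finite :=
        Polynomial.finite_setOfPred_isRoot (sub_ne_zero.2 hc)
      filter_upwards [hfin.measure_zero volume |> compl_mem_ae_iff.2] with t ht htc
      simp only [LinearMap.toSpanSingleton_apply] at *
      refine absurd ?_ ht
      show (P - Polynomial.C c).IsRoot t
      simp [hP, htc]
  filter_upwards [ae_all_iff.2 h] with x hx hc
  ext i
  exact hx i hc

variable {Ω : Set (Point d)} {T : Mesh d Ω}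

namespace Mesh

lemma toFun_of_notMem (u : T.CellPoly) {x : Point d} (hx : x ∉ closure Ω) : T.toFun u x = 0 := by
  rw [toFun, dif_neg fun h => hx (T.mem_closure_iff.2 h)]

namespace Conforming

variable {u : T.CellPoly}

lemma toFun_eq_zero (hu : T.Conforming u) (hΩ : IsOpen Ω) {x : Point d} (hx : x ∉ Ω) : T.toFun u x = 0 := by
  by_cases h : x ∈ closure Ω
  · obtain ⟨K, hK⟩ := T.mem_closure_iff.1 h
    rw [hu.toFun_eq hK]
    refine hu.vanish K x hK ?_
    rw [frontier, hΩ.interior_eq]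
    exact ⟨h, hx⟩
  · exact toFun_of_notMem u h

lemma exists_lipschitzWith (hu : T.Conforming u) (hΩ : IsOpen Ω) : ∃ L, LipschitzWith L (T.toFun u) := by
  have hG : ∀ K : T.Cell, ∃ G : ℝ≥0, ∀ x ∈ hull K.1, ‖grad (u K) x‖ ≤ G := fun K => by
    obtain ⟨G, hG⟩ := (isCompact_hull K.1).exists_bound_of_continuousOn
      (continuous_grad (u K)).continuousOn
    exact ⟨G.toNNReal, fun x hx => (hG x hx).trans (Real.le_coe_toNNReal G)⟩
  choose G hG using hG
  -- The cells and the closure of the exterior form a finite closed cover; on the latter the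
  -- function vanishes.
  let A : Option T.Cell → Set (Point d) := fun i => i.elim (closure (closure Ω)ᶜ) fun K => hull K.1
  refine ⟨∑ K, G K, lipschitzWith_of_closed_cover (A := A) ?_ ?_ ?_⟩
  · rintro (_ | K)
    · exact isClosed_closure
    · exact isClosed_hull K.1
  · rw [Set.eq_univ_iff_forall]
    intro x
    rw [Set.mem_iUnion]
    by_cases h : x ∈ closure Ω
    · obtain ⟨K, hK⟩ := T.mem_closure_iff.1 h
      exact ⟨some K, hK⟩
    · exact ⟨none, subset_closure h⟩
  · rintro (_ | K)
    · have h0 : ∀ x ∈ closure (closure Ω)ᶜ, T.toFun u x = 0 := fun x hx => by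
        refine hu.toFun_eq_zero hΩ fun h => ?_
        obtain ⟨y, hy, hyc⟩ := _root_.mem_closure_iff.1 hx Ω hΩ h
        exact hyc (subset_closure hy)
      refine LipschitzOnWith.of_dist_le_mul fun x hx y hy => ?_
      rw [h0 x hx, h0 y hy, dist_self]
      positivity
    · refine LipschitzOnWith.of_dist_le_mul fun x hx y hy => ?_
      have hx : x ∈ hull K.1 := hx
      have hy : y ∈ hull K.1 := hy
      rw [hu.toFun_eq hx, hu.toFun_eq hy, dist_comm, Real.dist_eq, dist_comm, dist_eq_norm]
      refine (abs_ev_sub_le (convex_hull K.1) (u K) (hG K) hx hy).trans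
        (mul_le_mul_of_nonneg_right ?_ (norm_nonneg _))
      exact_mod_cast Finset.single_le_sum (f := G) (fun _ _ => zero_le) (Finset.mem_univ K)

/-- Continuous element-wise polynomials that vanish on the boundary are in `H¹₀`. -/
lemma memH10 (hu : T.Conforming u) (hΩ : IsOpen Ω) (hb : Bornology.IsBounded Ω) : MemH10 Ω (T.toFun u) := by
  obtain ⟨L, hL⟩ := hu.exists_lipschitzWith hΩ
  let g : Point d → Point d := fun x =>
    if h : ∃ K : T.Cell, x ∈ interior (hull K.1) then grad (u h.choose) x else 0
  have hgK : ∀ (K : T.Cell) (x : Point d), x ∈ interior (hull K.1) → g x = grad (u K) x := by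
    intro K x hx
    have h : ∃ K : T.Cell, x ∈ interior (hull K.1) := ⟨K, hx⟩
    simp only [g, dif_pos h]
    rw [T.cell_eq_of_mem_interior h.choose_spec (interior_subset hx)]
  -- The skeleton is a null set, being the union of frontiers of convex sets; off it the function is
  -- locally a polynomial or zero.
  have hfr : ∀ᵐ x : Point d, ∀ K : T.Cell, x ∉ frontier (hull K.1) :=
    ae_all_iff.2 fun K => measure_eq_zero_iff_ae_notMem.1 ((convex_hull K.1).addHaar_frontier volume)
  have hpoly : ∀ c : ℝ, ∀ᵐ x : Point d, ∀ K : T.Cell, ev (u K) x = c → grad (u K) x = 0 := fun c =>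
    ae_all_iff.2 fun K => ae_grad_eq_zero (u K) c
  refine memH10_of_lipschitzWith hΩ hb hL (fun x hx => hu.toFun_eq_zero hΩ hx) (g := g) ?_ fun c => ?_
  · filter_upwards [hfr] with x hx
    by_cases h : ∃ K : T.Cell, x ∈ interior (hull K.1)
    · obtain ⟨K, hK⟩ := h
      rw [hgK K x hK]
      have h1 : HasStrictFDerivAt (ev (u K)) (innerSL ℝ (grad (u K) x)) x := by
        refine hasStrictFDerivAt_of_hasFDerivAt_of_continuousAt
          (Filter.Eventually.of_forall fun y => hasFDerivAt_ev (u K) y) ?_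
        exact ((innerSL ℝ).continuous.comp (continuous_grad (u K))).continuousAt
      refine h1.congr_of_eventuallyEq ?_
      filter_upwards [isOpen_interior.mem_nhds hK] with y hy
      exact (hu.toFun_eq (interior_subset hy)).symm
    · have hxc : x ∉ closure Ω := fun hxc => by
        obtain ⟨K, hK⟩ := T.mem_closure_iff.1 hxc
        refine hx K ?_
        rw [frontier, (isClosed_hull K.1).closure_eq]
        exact ⟨hK, fun hi => h ⟨K, hi⟩⟩
      simp only [g, dif_neg h, map_zero]
      refine (hasStrictFDerivAt_const (0 : ℝ) x).congr_of_eventuallyEq ?_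
      filter_upwards [isClosed_closure.isOpen_compl.mem_nhds hxc] with y hy
      exact (toFun_of_notMem u hy).symm
  · filter_upwards [hpoly c] with x hx hc
    by_cases h : ∃ K : T.Cell, x ∈ interior (hull K.1)
    · obtain ⟨K, hK⟩ := h
      rw [hgK K x hK]
      exact hx K (by rw [← hc, hu.toFun_eq (interior_subset hK)])
    · simp only [g, dif_neg h]

end Conforming

end Mesh

end Conformity

/-! ### Reconstruction against averaging -/

namespace Mesh

section Estimates

variable {d : ℕ} {Ω : Set (Point d)}

/-- A mesh with regular cells of a domain with Lipschitz boundary. -/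
structure Regular (T : Mesh d Ω) (γ : ℝ) : Prop where
  two_le : 2 ≤ d
  isOpen : IsOpen Ω
  lipschitz : HasLipschitzBoundary Ω
  shapeRegular : ∀ K : T.Cell, ShapeRegular γ K.1
  nonneg : 0 ≤ γ

/-- The contribution of a cell to the stabilization. -/
def faceSum (T : Mesh d Ω) (s : T.CellPoly × T.FacePoly) (K : T.Cell) : ℝ :=
  ∑ F ∈ T.facesOf K, (size F.1)⁻¹ * faceInt F.1 (fun x => (ev (s.2 F) x - ev (s.1 K) x) ^ 2)

/-- `D K` bounds the difference of the face and the cell polynomials on the boundary of `K`. -/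
structure FaceBound (T : Mesh d Ω) (s : T.CellPoly × T.FacePoly) (D : T.Cell → ℝ) : Prop where
  nonneg : ∀ K, 0 ≤ D K
  le : ∀ (K : T.Cell) (F : T.Face), F.1 ⊆ K.1 → ∀ x ∈ hull F.1,
    |ev (s.2 F) x - ev (s.1 K) x| ≤ D K

/-- The cells that can be reached from a cell through faces that contain a point. -/
def reach (T : Mesh d Ω) (z : Point d) (K : T.Cell) : Finset T.Cell :=
  Finset.univ.filter fun K' => (T.faceGraph z).Reachable K K'

/-- The sum of a cell-wise quantity over the cells near to a cell. -/
def nodeSum (T : Mesh d Ω) (m : ℕ) (D : T.Cell → ℝ) (K : T.Cell) : ℝ :=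
  ∑ z ∈ lagrangeNodes m K.1, ∑ K' ∈ T.reach z K, D K'

variable (T : Mesh d Ω)

lemma mem_facesOf {K : T.Cell} {F : T.Face} : F ∈ T.facesOf K ↔ F.1 ⊆ K.1 := by simp [facesOf]

lemma mem_reach {z : Point d} {K K' : T.Cell} :
    K' ∈ T.reach z K ↔ (T.faceGraph z).Reachable K K' := by simp [reach]

lemma self_mem_reach (z : Point d) (K : T.Cell) : K ∈ T.reach z K :=
  T.mem_reach.2 (SimpleGraph.Reachable.refl _)

lemma reach_subset_patch {z : Point d} {K : T.Cell} (hz : z ∈ hull K.1) :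
    T.reach z K ⊆ T.patch z := fun _ hK' =>
  T.mem_patch.2 (T.mem_hull_of_reachable hz (T.mem_reach.1 hK'))

lemma card_facesOf_le (K : T.Cell) : (T.facesOf K).card ≤ d + 1 := by
  have h : (T.facesOf K).card ≤ (K.1.powersetCard d).card :=
    Finset.card_le_card_of_injOn Subtype.val
      (fun F hF => Finset.mem_coe.2 (Finset.mem_powersetCard.2 ⟨T.mem_facesOf.1 hF, T.face_card F⟩))
      Subtype.val_injective.injOn
  rwa [Finset.card_powersetCard, (T.isSimplex K).card, Nat.choose_succ_self_right] at h

lemma faceSum_term_nonneg (s : T.CellPoly × T.FacePoly) (K : T.Cell) (F : T.Face) :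
    0 ≤ (size F.1)⁻¹ * faceInt F.1 (fun x => (ev (s.2 F) x - ev (s.1 K) x) ^ 2) :=
  mul_nonneg (inv_nonneg.2 (size_nonneg _)) (integral_nonneg fun _ => sq_nonneg _)

lemma faceSum_nonneg (s : T.CellPoly × T.FacePoly) (K : T.Cell) : 0 ≤ T.faceSum s K :=
  Finset.sum_nonneg fun F _ => T.faceSum_term_nonneg s K F

/-- On `F` a value satisfies u²|F| ≤ C∫u² ≤ C h_K S, with S the stabilization on `K`. As |F| is at
least a multiple of h_K^(d-1), this leaves the scaling S/h_K^(d-2). -/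
lemma exists_faceBound (d p : ℕ) (γ : ℝ) : ∃ C : ℝ, 0 ≤ C ∧ ∀ (Ω : Set (Point d)) (T : Mesh d Ω),
    T.Regular γ → ∀ s ∈ T.hhoSpace p,
      T.FaceBound s fun K => √(C * (T.faceSum s K / size K.1 ^ (d - 2))) := by
  obtain ⟨C, hC, hmain⟩ := exists_sq_mul_area_le_integral_sq (d - 1) p
  set V := (volume : Measure (Point d)).real (Metric.ball 0 1) with hV
  refine ⟨C * |γ| ^ d / (d * V), by positivity, fun Ω T hT s hs => ⟨fun K => Real.sqrt_nonneg _,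
    fun K F hF x hx => Real.abs_le_sqrt ?_⟩⟩
  have hd := hT.two_le
  have hd0 : d ≠ 0 := by omega
  have hK := T.isSimplex K
  obtain ⟨x₀, r, hr, hb, hsz⟩ := (hT.shapeRegular K).exists_ball
  obtain ⟨a, ha, hFa⟩ := hK.exists_erase_eq hF (T.face_card F)
  have hγ := (hT.shapeRegular K).pos hd0
  have hV0 : 0 < V := ENNReal.toReal_pos (Metric.measure_ball_pos _ _ one_pos).ne'
    measure_ball_lt_top.ne
  have hh := hK.size_pos hd0
  have hF0 : 0 < size F.1 := by
    have := hK.radius_le_size_face hd ha hr hb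
    rw [← hFa] at this
    linarith
  have h1 := hmain d K.1 F.1 hK hF (by rw [T.face_card]; omega) (s.2 F - s.1 K)
    (Submodule.sub_mem _ (hs.2.1 F) (hs.1 K)) x hx
  simp only [ev_sub] at h1
  set u := ev (s.2 F) x - ev (s.1 K) x
  set I := faceInt F.1 (fun x => (ev (s.2 F) x - ev (s.1 K) x) ^ 2) with hI
  have h1 : u ^ 2 * area (d - 1) F.1 ≤ C * I := h1
  have h2 : (size F.1)⁻¹ * I ≤ T.faceSum s K :=
    Finset.single_le_sum (f := fun F : T.Face => (size F.1)⁻¹ * faceInt F.1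
      (fun x => (ev (s.2 F) x - ev (s.1 K) x) ^ 2)) (fun F _ => T.faceSum_term_nonneg s K F)
      (T.mem_facesOf.2 hF)
  rw [inv_mul_le_iff₀ hF0] at h2
  have hS := T.faceSum_nonneg s K
  have h3 : I ≤ size K.1 * T.faceSum s K := h2.trans (mul_le_mul_of_nonneg_right (size_mono hF) hS)
  -- |F| = d‖∇λ_a‖|K|, with ‖∇λ_a‖ h_K ≥ 1 and |K| at least the volume of the inscribed ball.
  have h4 : d * (V * r ^ d) ≤ area (d - 1) F.1 * size K.1 := by
    rw [hFa, hK.area_mul_eq hd0 ha]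
    have e1 := IsSimplex.radius_pow_le_area hr hb
    have e2 := hK.one_le_norm_baryGrad_mul_size hd0 ha
    calc (d : ℝ) * (V * r ^ d) ≤ d * area d K.1 := mul_le_mul_of_nonneg_left e1 (by positivity)
      _ ≤ d * area d K.1 * (‖baryGrad K.1 a‖ * size K.1) :=
        le_mul_of_one_le_right (mul_nonneg (by positivity) hK.area_self_pos.le) e2
      _ = _ := by ring
  have h5 : size K.1 ^ d ≤ γ ^ d * r ^ d := by
    rw [← mul_pow]; exact pow_le_pow_left₀ hh.le hsz d
  have hpow : size K.1 ^ d = size K.1 ^ 2 * size K.1 ^ (d - 2) := by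
    rw [← pow_add]; congr 1; omega
  rw [abs_of_pos hγ, div_mul_div_comm, le_div_iff₀ (by positivity)]
  have h6 : u ^ 2 * (d * V * size K.1 ^ d) ≤ C * γ ^ d * T.faceSum s K * size K.1 ^ 2 := by
    calc u ^ 2 * (d * V * size K.1 ^ d) ≤ u ^ 2 * (d * V * (γ ^ d * r ^ d)) := by gcongr
      _ = γ ^ d * (u ^ 2 * (d * (V * r ^ d))) := by ring
      _ ≤ γ ^ d * (u ^ 2 * (area (d - 1) F.1 * size K.1)) := by gcongr
      _ = γ ^ d * ((u ^ 2 * area (d - 1) F.1) * size K.1) := by ring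
      _ ≤ γ ^ d * ((C * (size K.1 * T.faceSum s K)) * size K.1) :=
        mul_le_mul_of_nonneg_left (mul_le_mul_of_nonneg_right
          (h1.trans (mul_le_mul_of_nonneg_left h3 hC.le)) hh.le) (by positivity)
      _ = _ := by ring
  rw [hpow] at h6
  refine le_of_mul_le_mul_right ?_ (by positivity : 0 < size K.1 ^ 2)
  linarith

lemma exists_abs_reconstruction_sub_cell_le (d p : ℕ) (γ : ℝ) : ∃ C : ℝ, 0 ≤ C ∧
    ∀ (Ω : Set (Point d)) (T : Mesh d Ω), T.Regular γ → ∀ s ∈ T.hhoSpace p,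
      ∀ D, T.FaceBound s D → ∀ K : T.Cell, ∀ x ∈ hull K.1,
        |ev (T.reconstruction p s K) x - ev (s.1 K) x| ≤ C * D K := by
  by_cases hd : d = 0
  · exact ⟨0, le_rfl, fun Ω T hT => absurd hT.two_le (by omega)⟩
  obtain ⟨C, hC, hmain⟩ := exists_abs_reconstruction_sub_le d p hd γ
  refine ⟨C, hC.le, fun Ω T hT s hs D hD K x hx => ?_⟩
  obtain ⟨h1, h2, h3⟩ := T.reconstruction_spec p hd s K
  have hK := T.isSimplex K
  have hF : ∀ a ∈ K.1, K.1.erase a ∈ T.faces := fun a ha =>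
    T.mem_faces (K := K) (Finset.erase_subset a _)
      (by rw [Finset.card_erase_of_mem ha, hK.card, Nat.add_sub_cancel])
  -- Faces are re-indexed by the opposite vertex; the default 0 is never taken for vertices of `K`.
  let t : Point d → Poly d := fun a =>
    if h : K.1.erase a ∈ T.faces then s.2 ⟨K.1.erase a, h⟩ else 0
  have ht : ∀ a (ha : a ∈ K.1), t a = s.2 ⟨K.1.erase a, hF a ha⟩ := fun a ha => dif_pos (hF a ha)
  refine hmain K.1 (hT.shapeRegular K) (s.1 K) _ t (hs.1 K) h1 (fun q hq => ?_) h3 (D K)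
    (fun a ha y hy => ?_) x hx
  · rw [h2 q hq]
    congr 1
    symm
    refine Finset.sum_bij (fun a ha => ⟨K.1.erase a, hF a ha⟩) (fun a ha => ?_)
      (fun a ha b hb h => ?_) (fun F hFK => ?_) fun a ha => ?_
    · exact T.mem_facesOf.2 (Finset.erase_subset a _)
    · by_contra hne
      have h' : K.1.erase a = K.1.erase b := congrArg Subtype.val h
      have : a ∈ K.1.erase b := Finset.mem_erase.2 ⟨hne, ha⟩
      rw [← h'] at this
      exact Finset.notMem_erase a _ this
    · obtain ⟨a, ha, h⟩ := hK.exists_erase_eq (T.mem_facesOf.1 hFK) (T.face_card F)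
      exact ⟨a, ha, Subtype.ext h.symm⟩
    · rw [ht a ha]
  · rw [ht a ha]
    exact hD.le K ⟨_, hF a ha⟩ (Finset.erase_subset a _) y hy

lemma averaging_mem (p : ℕ) (s : T.CellPoly × T.FacePoly) (K : T.Cell) :
    T.averaging p s K ∈ polySpace d (p + 1 : ℕ) := by
  refine Submodule.sum_mem _ fun z _ => ?_
  rw [← MvPolynomial.smul_eq_C_mul]
  exact Submodule.smul_mem _ _ ((T.isSimplex K).lagrangeBasis_mem p.succ_ne_zero z)

lemma ev_averaging_node (p : ℕ) (s : T.CellPoly × T.FacePoly) {K : T.Cell} {z : Point d}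
    (hz : z ∈ lagrangeNodes (p + 1) K.1) : ev (T.averaging p s K) z =
      if z ∈ frontier Ω then 0 else ((T.patch z).card : ℝ)⁻¹ *
        ∑ K₁ ∈ T.patch z, ev (T.reconstruction p s K₁) z := by
  have h1 : ∀ y, ev (lagrangeBasis (p + 1) K.1 y) z = if z = y then 1 else 0 := fun y =>
    ((T.isSimplex K).lagrangeBasis_spec p.succ_ne_zero y).2 z hz
  simp only [averaging, ev_sum, ev_mul, ev_C, h1, mul_ite, mul_one, mul_zero, Finset.sum_ite_eq]
  have h2 : z ∈ T.interiorNodes (p + 1) ↔ z ∉ frontier Ω := by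
    rw [interiorNodes, Finset.mem_filter, and_iff_right]
    exact Finset.mem_biUnion.2 ⟨K.1, K.2, hz⟩
  simp only [h2, ite_not]

lemma abs_sub_mean_le {ι : Type*} {s : Finset ι} (hs : s.Nonempty) {f : ι → ℝ} {a M : ℝ}
    (h : ∀ i ∈ s, |a - f i| ≤ M) : |a - (s.card : ℝ)⁻¹ * ∑ i ∈ s, f i| ≤ M := by
  have hc : (0 : ℝ) < s.card := by exact_mod_cast hs.card_pos
  have e : a - (s.card : ℝ)⁻¹ * ∑ i ∈ s, f i = (s.card : ℝ)⁻¹ * ∑ i ∈ s, (a - f i) := by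
    rw [Finset.sum_sub_distrib, Finset.sum_const, nsmul_eq_mul]
    field_simp
  rw [e, abs_mul, abs_of_pos (inv_pos.2 hc), inv_mul_le_iff₀ hc]
  refine (Finset.abs_sum_le_sum_abs _ _).trans ((Finset.sum_le_sum h).trans_eq ?_)
  rw [Finset.sum_const, nsmul_eq_mul]

/-- The difference of the reconstruction and of its average at a node. -/
lemma exists_abs_reconstruction_sub_averaging_node_le (d p : ℕ) (γ : ℝ) : ∃ C : ℝ, 0 ≤ C ∧
    ∀ (Ω : Set (Point d)) (T : Mesh d Ω), T.Regular γ → ∀ s ∈ T.hhoSpace p,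
      ∀ D, T.FaceBound s D → ∀ K : T.Cell, ∀ z ∈ lagrangeNodes (p + 1) K.1,
        |ev (T.reconstruction p s K) z - ev (T.averaging p s K) z| ≤ C * ∑ K' ∈ T.reach z K, D K' := by
  obtain ⟨c, hc, hrec⟩ := exists_abs_reconstruction_sub_cell_le d p γ
  refine ⟨(2 * |γ| ^ d + 1) * (c + 1), by positivity, fun Ω T hT s hs D hD K z hz => ?_⟩
  have hd0 : d ≠ 0 := by have := hT.two_le; omega
  have hzK : z ∈ hull K.1 := lagrangeNodes_subset_hull p.succ_ne_zero hz
  set f : T.Cell → ℝ := fun K => ev (T.reconstruction p s K) z with hf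
  set M := ∑ K' ∈ T.reach z K, D K' with hM
  have hDM : ∀ K', (T.faceGraph z).Reachable K K' → D K' ≤ M := fun K' hK' =>
    Finset.single_le_sum (fun K _ => hD.nonneg K) (T.mem_reach.2 hK')
  have hM0 : 0 ≤ M := Finset.sum_nonneg fun K _ => hD.nonneg K
  -- The single-valued σ_Σ on the face is the intermediary between neighbouring cells: both
  -- reconstructions are close to it.
  have hface : ∀ (K' : T.Cell) (F : T.Face), F.1 ⊆ K'.1 → z ∈ hull F.1 →
      |f K' - ev (s.2 F) z| ≤ (c + 1) * D K' := fun K' F hF hzF => by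
    have h1 := hrec Ω T hT s hs D hD K' z (hull_mono hF hzF)
    have h2 := hD.le K' F hF z hzF
    rw [abs_sub_comm] at h2
    calc |f K' - ev (s.2 F) z| ≤ _ := abs_sub_le _ (ev (s.1 K') z) _
      _ ≤ c * D K' + D K' := add_le_add h1 h2
      _ = _ := by ring
  have hjump : ∀ K₁ K₂, (T.faceGraph z).Reachable K K₁ → (T.faceGraph z).Adj K₁ K₂ →
      |f K₁ - f K₂| ≤ 2 * (c + 1) * M := by
    intro K₁ K₂ hr hadj
    have hr₂ := hr.trans hadj.reachable
    obtain ⟨-, F, h1, h2, h3, h4⟩ := hadj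
    have e1 := hface K₁ ⟨F, T.mem_faces h1 h3⟩ h1 h4
    have e2 := hface K₂ ⟨F, T.mem_faces h1 h3⟩ h2 h4
    rw [abs_sub_comm] at e2
    calc |f K₁ - f K₂| ≤ _ := abs_sub_le _ _ _
      _ ≤ (c + 1) * D K₁ + (c + 1) * D K₂ := add_le_add e1 e2
      _ ≤ (c + 1) * M + (c + 1) * M := by
        gcongr
        · exact hDM _ hr
        · exact hDM _ hr₂
      _ = _ := by ring
  -- The jumps are summed along a walk whose length is at most the number of cells at `z`, hence at
  -- most γ^d.
  have hchain : ∀ K', (T.faceGraph z).Reachable K K' →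
      |f K - f K'| ≤ 2 * |γ| ^ d * ((c + 1) * M) := by
    intro K' hK'
    obtain ⟨w, hw⟩ := T.exists_walk hzK hK'
    refine (T.abs_sub_le_of_walk w hjump).trans ?_
    have h1 : (w.length : ℝ) ≤ |γ| ^ d := by
      rw [abs_of_nonneg hT.nonneg]
      exact (Nat.cast_le.2 hw).trans (T.card_patch_le hT.nonneg hT.shapeRegular hd0 z)
    calc (w.length : ℝ) * (2 * (c + 1) * M) ≤ |γ| ^ d * (2 * (c + 1) * M) := by gcongr
      _ = _ := by ring
  rw [T.ev_averaging_node p s hz]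
  have hcM : 0 ≤ (c + 1) * M := by positivity
  split_ifs with hfr
  -- At a boundary node the average is 0, and the chain ends at a boundary face on which the face
  -- polynomial vanishes.
  · obtain ⟨K', hK', F, hF, hzF, hi⟩ := T.exists_reachable_not_isInterface hT.isOpen hT.lipschitz hfr hzK
    have h1 := hface K' F hF hzF
    rw [hs.2.2 F (T.isBoundaryFace_of_not_isInterface hT.isOpen hi) z hzF] at h1
    calc |f K - 0| ≤ |f K - f K'| + |f K' - 0| := abs_sub_le _ _ _
      _ ≤ 2 * |γ| ^ d * ((c + 1) * M) + (c + 1) * D K' := add_le_add (hchain K' hK') h1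
      _ ≤ 2 * |γ| ^ d * ((c + 1) * M) + (c + 1) * M := by gcongr; exact hDM K' hK'
      _ = _ := by ring
  · have hzΩ : z ∈ Ω := by
      by_contra h
      refine hfr ?_
      rw [frontier, hT.isOpen.interior_eq]
      exact ⟨T.hull_subset_closure K hzK, h⟩
    refine (abs_sub_mean_le ⟨K, T.mem_patch.2 hzK⟩ fun K' hK' =>
      hchain K' (T.reachable_of_mem hT.isOpen hzΩ hzK (T.mem_patch.1 hK'))).trans ?_
    linarith

lemma lagrangeNodes_nonempty {K : Finset (Point d)} (hK : IsSimplex K) {m : ℕ} (hm : m ≠ 0) :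
    (lagrangeNodes m K).Nonempty := by
  by_contra h
  rw [Finset.not_nonempty_iff_eq_empty] at h
  have := hK.eq_sum_lagrangeBasis hm (one_mem_polySpace (Nat.cast_nonneg m))
  rw [h, Finset.sum_empty] at this
  exact one_ne_zero this

lemma nodeSum_nonneg {D : T.Cell → ℝ} (hD : ∀ K, 0 ≤ D K) (m : ℕ) (K : T.Cell) :
    0 ≤ T.nodeSum m D K := Finset.sum_nonneg fun _ _ => Finset.sum_nonneg fun K _ => hD K

lemma le_nodeSum {D : T.Cell → ℝ} (hD : ∀ K, 0 ≤ D K) {m : ℕ} (hm : m ≠ 0) (K : T.Cell) :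
    D K ≤ T.nodeSum m D K := by
  obtain ⟨z, hz⟩ := lagrangeNodes_nonempty (T.isSimplex K) hm
  exact (Finset.single_le_sum (fun K _ => hD K) (T.self_mem_reach z K)).trans
    (Finset.single_le_sum (f := fun z => ∑ K' ∈ T.reach z K, D K')
      (fun z _ => Finset.sum_nonneg fun K _ => hD K) hz)

/-- Both polynomials have degree at most p + 1, so nodal bounds pass to the cell through the bounded
Lagrange basis. -/
lemma exists_abs_reconstruction_sub_averaging_le (d p : ℕ) (γ : ℝ) : ∃ C : ℝ, 0 ≤ C ∧
    ∀ (Ω : Set (Point d)) (T : Mesh d Ω), T.Regular γ → ∀ s ∈ T.hhoSpace p,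
      ∀ D, T.FaceBound s D → ∀ K : T.Cell, ∀ x ∈ hull K.1,
        |ev (T.reconstruction p s K) x - ev (T.averaging p s K) x| ≤ C * T.nodeSum (p + 1) D K := by
  obtain ⟨c, hc, hnode⟩ := exists_abs_reconstruction_sub_averaging_node_le d p γ
  refine ⟨c * ((p + 1 : ℕ) : ℝ) ^ (p + 1), by positivity, fun Ω T hT s hs D hD K x hx => ?_⟩
  have hd0 : d ≠ 0 := by have := hT.two_le; omega
  have hK := T.isSimplex K
  have h1 := (T.reconstruction_spec p hd0 s K).1
  have h2 : T.reconstruction p s K - T.averaging p s K ∈ polySpace d (p + 1 : ℕ) :=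
    Submodule.sub_mem _ (by push_cast; exact h1) (T.averaging_mem p s K)
  rw [← ev_sub, hK.eq_sum_lagrangeBasis p.succ_ne_zero h2, ev_sum, nodeSum, Finset.mul_sum]
  refine (Finset.abs_sum_le_sum_abs _ _).trans (Finset.sum_le_sum fun z hz => ?_)
  rw [ev_mul, ev_C, abs_mul, ev_sub, mul_right_comm]
  exact mul_le_mul (hnode Ω T hT s hs D hD K z hz) (hK.abs_lagrangeBasis_le p.succ_ne_zero z hx)
    (abs_nonneg _) (mul_nonneg hc (Finset.sum_nonneg fun K _ => hD.nonneg K))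

end Estimates

end Mesh

/-! ### Maximum norm bound for the smoother -/

namespace Mesh

section SmootherEstimates

variable {d : ℕ} {Ω : Set (Point d)} (T : Mesh d Ω)

/-- The normalization factor κ ≥ 1 of a bubble only strengthens the left-hand side, so it may be
dropped. -/
lemma exists_abs_le_of_bubble_moment (n m : ℕ) : ∃ C : ℝ, 0 ≤ C ∧
    ∀ (d : ℕ) (K S : Finset (Point d)), IsSimplex K → S ⊆ K → S.card = n + 1 →
      ∀ b ∈ polySpace d m, ∀ (v : Poly d) (M κ : ℝ), 1 ≤ κ → (∀ x ∈ hull S, |ev v x| ≤ M) →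
      ∫ x in hull S, ev b x * ev b x * (κ * ∏ p ∈ S, ev (baryCoord K p) x)
        ∂(μHE[n] : Measure (Point d)) =
        ∫ x in hull S, ev b x * ev v x ∂(μHE[n] : Measure (Point d)) →
      ∀ x ∈ hull S, |ev b x| ≤ C * M := by
  obtain ⟨C, hC, h⟩ := exists_abs_le_of_weighted_moment n m
  refine ⟨C, hC.le, fun d K S hK hS hn b hb v M κ hκ hM heq => h d K S hK hS hn b hb v M hM ?_⟩
  rw [← heq]
  have e : ∀ x, ev b x * ev b x * (κ * ∏ p ∈ S, ev (baryCoord K p) x) =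
      κ * (ev b x ^ 2 * ∏ p ∈ S, ev (baryCoord K p) x) := fun x => by ring
  simp only [e, integral_const_mul]
  exact le_mul_of_one_le_left (setIntegral_nonneg (measurableSet_hull S) fun x hx =>
    mul_nonneg (sq_nonneg _) (hK.weight_mem_Icc hS hx).1) hκ

lemma faceBubble_mem (K : T.Cell) (F : T.Face) : faceBubble K.1 F.1 ∈ polySpace d d := by
  rw [faceBubble]
  split_ifs with h
  · rw [← MvPolynomial.smul_eq_C_mul]
    refine Submodule.smul_mem _ _ ?_
    have := prod_mem_polySpace F.1 (m := fun _ => 1) fun a ha => by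
      exact_mod_cast (T.isSimplex K).baryCoord_mem (h ha)
    simpa [T.face_card] using this
  · exact Submodule.zero_mem _

lemma elementBubble_mem (K : T.Cell) : elementBubble K.1 ∈ polySpace d (d + 1) := by
  rw [elementBubble, ← MvPolynomial.smul_eq_C_mul]
  refine Submodule.smul_mem _ _ ?_
  have := prod_mem_polySpace K.1 (m := fun _ => 1) fun a ha => by
    exact_mod_cast (T.isSimplex K).baryCoord_mem ha
  simpa [(T.isSimplex K).card] using this

lemma abs_faceBubble_le {K : T.Cell} {F : Finset (Point d)} (hF : F ⊆ K.1) {x : Point d}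
    (hx : x ∈ hull K.1) : |ev (faceBubble K.1 F) x| ≤ (d : ℝ) ^ d := by
  have hK := T.isSimplex K
  have h0 : 0 ≤ ∏ a ∈ F, ev (baryCoord K.1 a) x :=
    Finset.prod_nonneg fun a ha => hK.baryCoord_nonneg hx (hF ha)
  have h1 : ∏ a ∈ F, ev (baryCoord K.1 a) x ≤ 1 :=
    Finset.prod_le_one (fun a ha => hK.baryCoord_nonneg hx (hF ha))
      fun a ha => hK.baryCoord_le_one hx (hF ha)
  rw [ev_faceBubble hF, abs_of_nonneg (by positivity)]
  exact mul_le_of_le_one_right (by positivity) h1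

lemma abs_elementBubble_le {K : T.Cell} {x : Point d} (hx : x ∈ hull K.1) :
    |ev (elementBubble K.1) x| ≤ ((d : ℝ) + 1) ^ (d + 1) := by
  obtain ⟨h0, h1⟩ := (T.isSimplex K).weight_mem_Icc subset_rfl hx
  rw [ev_elementBubble, abs_of_nonneg (by positivity)]
  exact mul_le_of_le_one_right (by positivity) h1

lemma skeletonOf_mem (p : ℕ) {b : T.FacePoly} (hb : ∀ F, b F ∈ polySpace d p) (K : T.Cell) :
    T.skeletonOf p b K ∈ polySpace d (p + d : ℕ) := by
  push_cast
  by_cases hp : p = 0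
  · simp only [skeletonOf, hp, if_true]
    exact Submodule.sum_mem _ fun F _ => mul_mem_polySpace (hp ▸ hb F) (T.faceBubble_mem K F)
  · simp only [skeletonOf, hp, if_false]
    refine Submodule.sum_mem _ fun F _ => Submodule.sum_mem _ fun z _ =>
      mul_mem_polySpace ?_ (T.faceBubble_mem K F)
    rw [← MvPolynomial.smul_eq_C_mul]
    exact Submodule.smul_mem _ _ ((T.isSimplex K).lagrangeBasis_mem hp z)

/-- The factors count the faces of `K`, the nodes of `K`, and bound a basis function and a face
bubble. For p = 0 the formula is right because 0^0 = 1. -/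
lemma abs_skeletonOf_le (hd : d ≠ 0) (p : ℕ) {b : T.FacePoly} (hb : ∀ F, b F ∈ polySpace d p)
    {K : T.Cell} {B : ℝ} (hB0 : 0 ≤ B)
    (hB : ∀ F : T.Face, F.1 ⊆ K.1 → ∀ x ∈ hull F.1, |ev (b F) x| ≤ B) {x : Point d}
    (hx : x ∈ hull K.1) : |ev (T.skeletonOf p b K) x| ≤
      ((d : ℝ) + 1) * (((p : ℝ) + 1) ^ (d + 1) * (p : ℝ) ^ p * (d : ℝ) ^ d) * B := by
  have hK := T.isSimplex K
  set c : ℝ := ((p : ℝ) + 1) ^ (d + 1) * (p : ℝ) ^ p * B with hc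
  have hc0 : 0 ≤ c := by positivity
  obtain ⟨g, hg, hgle⟩ : ∃ g : T.Face → ℝ, ev (T.skeletonOf p b K) x =
      ∑ F ∈ T.interfaces, g F * ev (faceBubble K.1 F.1) x ∧ ∀ F : T.Face, F.1 ⊆ K.1 → |g F| ≤ c := by
    by_cases hp : p = 0
    · refine ⟨fun F => ev (b F) x, by simp [skeletonOf, hp], fun F hF => ?_⟩
      obtain ⟨e, he⟩ := eq_C_of_mem (hp ▸ hb F : b F ∈ polySpace d (0 : ℕ))
      obtain ⟨y, hy⟩ := T.face_nonempty hd F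
      have := hB F hF y (subset_hull _ hy)
      rw [he, ev_C] at this
      simpa [hc, hp, he] using this
    · refine ⟨fun F => ∑ z ∈ (T.nodes p).filter (fun z => z ∈ hull F.1),
        ev (b F) z * ev (lagrangeBasis p K.1 z) x, ?_, fun F hF => ?_⟩
      · simp only [skeletonOf, hp, if_false, ev_sum, ev_mul, ev_C, ← Finset.sum_mul]
      · have h1 : ∀ z ∈ (T.nodes p).filter (fun z => z ∈ hull F.1),
            |ev (b F) z * ev (lagrangeBasis p K.1 z) x| ≤
              if z ∈ lagrangeNodes p K.1 then B * (p : ℝ) ^ p else 0 := by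
          intro z hz
          split_ifs with h
          · rw [abs_mul]
            exact mul_le_mul (hB F hF z (Finset.mem_filter.1 hz).2)
              (hK.abs_lagrangeBasis_le hp z hx) (abs_nonneg _) hB0
          · rw [hK.lagrangeBasis_eq_zero hp h]; simp
        refine (Finset.abs_sum_le_sum_abs _ _).trans ((Finset.sum_le_sum h1).trans ?_)
        rw [Finset.sum_ite_mem, Finset.sum_const, nsmul_eq_mul]
        have h2 : ((((T.nodes p).filter fun z => z ∈ hull F.1) ∩ lagrangeNodes p K.1).card : ℝ) ≤
            ((p : ℝ) + 1) ^ (d + 1) := by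
          have := (Finset.card_le_card (Finset.inter_subset_right
            (s₁ := (T.nodes p).filter fun z => z ∈ hull F.1) (s₂ := lagrangeNodes p K.1))).trans
            (card_lagrangeNodes_le p K.1)
          rw [hK.card] at this
          exact_mod_cast this
        calc _ ≤ ((p : ℝ) + 1) ^ (d + 1) * (B * (p : ℝ) ^ p) := by gcongr
          _ = c := by rw [hc]; ring
  rw [hg]
  have h1 : ∀ F ∈ T.interfaces, |g F * ev (faceBubble K.1 F.1) x| ≤
      if F ∈ T.facesOf K then c * (d : ℝ) ^ d else 0 := by
    intro F _
    split_ifs with h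
    · rw [T.mem_facesOf] at h
      rw [abs_mul]
      exact mul_le_mul (hgle F h) (T.abs_faceBubble_le h hx) (abs_nonneg _) hc0
    · rw [T.mem_facesOf] at h
      simp [faceBubble, h]
  refine (Finset.abs_sum_le_sum_abs _ _).trans ((Finset.sum_le_sum h1).trans ?_)
  rw [Finset.sum_ite_mem, Finset.sum_const, nsmul_eq_mul]
  have h2 : ((T.interfaces ∩ T.facesOf K).card : ℝ) ≤ (d : ℝ) + 1 := by
    exact_mod_cast (Finset.card_le_card Finset.inter_subset_right).trans (T.card_facesOf_le K)
  calc _ ≤ ((d : ℝ) + 1) * (c * (d : ℝ) ^ d) := by gcongr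
    _ = _ := by rw [hc]; ring

/-- The difference of the reconstruction and the smoother in the maximum norm. -/
lemma exists_abs_reconstruction_sub_smoother_le (d p : ℕ) (γ : ℝ) : ∃ C : ℝ, 0 ≤ C ∧
    ∀ (Ω : Set (Point d)) (T : Mesh d Ω), T.Regular γ → ∀ s ∈ T.hhoSpace p,
      ∀ D, T.FaceBound s D → ∀ K : T.Cell, ∀ x ∈ hull K.1,
        |ev ((T.reconstruction p s - T.smoother p s) K) x| ≤ C * T.nodeSum (p + 1) D K := by
  obtain ⟨c₁, hc₁, hrec⟩ := exists_abs_reconstruction_sub_cell_le d p γ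
  obtain ⟨c₂, hc₂, havg⟩ := exists_abs_reconstruction_sub_averaging_le d p γ
  obtain ⟨c₃, hc₃, hface⟩ := exists_abs_le_of_bubble_moment (d - 1) p
  obtain ⟨c₄, hc₄, hcell⟩ := exists_abs_le_of_bubble_moment d p
  -- The bound for the face part: the norm of the extension from faces times that of B_F applied to
  -- the face residual, which is at most (1 + c₁ + c₂)Q.
  set a : ℝ := ((d : ℝ) + 1) * (((p : ℝ) + 1) ^ (d + 1) * (p : ℝ) ^ p * (d : ℝ) ^ d) *
    (c₃ * (1 + c₁ + c₂)) with ha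
  have ha0 : 0 ≤ a := by positivity
  refine ⟨c₂ + a + c₄ * (c₁ + c₂ + a) * ((d : ℝ) + 1) ^ (d + 1), by positivity,
    fun Ω T hT s hs D hD K x hx => ?_⟩
  have hd0 : d ≠ 0 := by have := hT.two_le; omega
  have hK := T.isSimplex K
  set Q := T.nodeSum (p + 1) D K with hQ
  have hDQ : D K ≤ Q := T.le_nodeSum hD.nonneg p.succ_ne_zero K
  have hQ0 : 0 ≤ Q := (hD.nonneg K).trans hDQ
  have h1 : ∀ y ∈ hull K.1, |ev (s.1 K) y - ev (T.averaging p s K) y| ≤ (c₁ + c₂) * Q := by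
    intro y hy
    have e1 := hrec Ω T hT s hs D hD K y hy
    have e2 := havg Ω T hT s hs D hD K y hy
    rw [abs_sub_comm] at e1
    calc _ ≤ _ := abs_sub_le _ (ev (T.reconstruction p s K) y) _
      _ ≤ c₁ * D K + c₂ * Q := add_le_add e1 e2
      _ ≤ c₁ * Q + c₂ * Q := by gcongr
      _ = _ := by ring
  have h2 : ∀ F : T.Face, F.1 ⊆ K.1 → ∀ y ∈ hull F.1,
      |ev (T.bubbleFace p F (ev (T.faceResidual p s F))) y| ≤ c₃ * ((1 + c₁ + c₂) * Q) := by
    intro F hF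
    obtain ⟨e1, e2⟩ := T.bubbleFace_spec p hd0 F (T.faceResidual p s F)
    have e3 := e2 K hF _ e1
    simp only [ev_faceBubble hF] at e3
    refine hface d K.1 F.1 hK hF (by rw [T.face_card]; omega) _ e1 (T.faceResidual p s F) _
      ((d : ℝ) ^ d) (one_le_pow₀ (by exact_mod_cast Nat.one_le_iff_ne_zero.2 hd0)) (fun y hy => ?_) e3
    rw [T.ev_faceResidual p hT.isOpen hT.lipschitz s hF hy]
    have e4 := hD.le K F hF y hy
    calc _ ≤ _ := abs_sub_le _ (ev (s.1 K) y) _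
      _ ≤ D K + (c₁ + c₂) * Q := add_le_add e4 (h1 y (hull_mono hF hy))
      _ ≤ Q + (c₁ + c₂) * Q := by gcongr
      _ = _ := by ring
  have h3 : ∀ y ∈ hull K.1, |ev (T.facePart p s K) y| ≤ a * Q := by
    intro y hy
    refine (T.abs_skeletonOf_le hd0 p (fun F => (T.bubbleFace_spec p hd0 F _).1)
      (by positivity) h2 hy).trans_eq ?_
    rw [ha]; ring
  have h4 : ∀ y ∈ hull K.1, |ev (T.bubbleCell p K (ev (T.cellResidual p s K))) y| ≤
      c₄ * ((c₁ + c₂ + a) * Q) := by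
    obtain ⟨e1, e2⟩ := T.bubbleCell_spec p K (T.cellResidual p s K)
    have e3 := e2 _ e1
    simp only [ev_elementBubble, cellInt_eq] at e3
    refine hcell d K.1 K.1 hK subset_rfl hK.card _ (polySpace_mono (by omega) e1)
      (T.cellResidual p s K) _ (((d : ℝ) + 1) ^ (d + 1))
      (one_le_pow₀ (by linarith [d.cast_nonneg (α := ℝ)])) (fun y hy => ?_) e3
    rw [cellResidual, Pi.sub_apply, Pi.sub_apply, ev_sub, ev_sub]
    calc _ ≤ _ := abs_sub _ _
      _ ≤ (c₁ + c₂) * Q + a * Q := add_le_add (h1 y hy) (h3 y hy)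
      _ = _ := by ring
  have h5 : |ev (T.cellPart p s K) x| ≤ c₄ * ((c₁ + c₂ + a) * Q) * ((d : ℝ) + 1) ^ (d + 1) := by
    rw [cellPart, ev_mul, abs_mul]
    exact mul_le_mul (h4 x hx) (T.abs_elementBubble_le hx) (abs_nonneg _) (by positivity)
  have h6 := havg Ω T hT s hs D hD K x hx
  have e : ev ((T.reconstruction p s - T.smoother p s) K) x =
      (ev (T.reconstruction p s K) x - ev (T.averaging p s K) x) - ev (T.facePart p s K) x -
        ev (T.cellPart p s K) x := by
    rw [T.smoother_eq p hT.isOpen hT.lipschitz]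
    simp only [Pi.sub_apply, Pi.add_apply, ev_sub, ev_add]
    ring
  rw [e]
  calc _ ≤ |ev (T.reconstruction p s K) x - ev (T.averaging p s K) x - ev (T.facePart p s K) x| +
        |ev (T.cellPart p s K) x| := abs_sub _ _
    _ ≤ |ev (T.reconstruction p s K) x - ev (T.averaging p s K) x| + |ev (T.facePart p s K) x| +
        |ev (T.cellPart p s K) x| := by gcongr; exact abs_sub _ _
    _ ≤ c₂ * Q + a * Q + c₄ * ((c₁ + c₂ + a) * Q) * ((d : ℝ) + 1) ^ (d + 1) :=
      add_le_add (add_le_add h6 (h3 x hx)) h5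
    _ = _ := by ring

/-- A degree depending only on `p` and `d` is what Markov's inequality requires; the element bubbles
contribute (p - 1) + (d + 1). -/
lemma reconstruction_sub_smoother_mem (hd : d ≠ 0) (hΩ : IsOpen Ω) (hL : HasLipschitzBoundary Ω)
    (p : ℕ) (s : T.CellPoly × T.FacePoly) (K : T.Cell) :
    (T.reconstruction p s - T.smoother p s) K ∈ polySpace d (p + d + 1 : ℕ) := by
  rw [T.smoother_eq p hΩ hL]
  have h1 := (T.reconstruction_spec p hd s K).1
  have h4 := mul_mem_polySpace (T.bubbleCell_spec p K (T.cellResidual p s K)).1 (T.elementBubble_mem K)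
  refine Submodule.sub_mem _ (polySpace_mono (by push_cast; omega) h1) (Submodule.add_mem _
    (polySpace_mono (by push_cast; omega) (T.averaging_mem p s K)) (Submodule.add_mem _
    (polySpace_mono (by push_cast; omega) (T.skeletonOf_mem p
      (fun F => (T.bubbleFace_spec p hd F _).1) K)) (polySpace_mono (by push_cast; omega) h4)))

end SmootherEstimates

end Mesh

/-! ### The global energy estimate -/

namespace Mesh

section GlobalEstimate

variable {d : ℕ} {Ω : Set (Point d)} (T : Mesh d Ω)

/-- Cauchy–Schwarz over the nodes of the cell and over the cells reached at each node. -/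
lemma nodeSum_sq_le {γ : ℝ} (hT : T.Regular γ) {m : ℕ} (hm : m ≠ 0) (D : T.Cell → ℝ) (K : T.Cell) :
    T.nodeSum m D K ^ 2 ≤ ((m : ℝ) + 1) ^ (d + 1) * γ ^ d * T.nodeSum m (fun K => D K ^ 2) K := by
  have hd0 : d ≠ 0 := by have := hT.two_le; omega
  have h1 : ((lagrangeNodes m K.1).card : ℝ) ≤ ((m : ℝ) + 1) ^ (d + 1) := by
    have := card_lagrangeNodes_le m K.1
    rw [(T.isSimplex K).card] at this
    exact_mod_cast this
  have h2 : ∀ z ∈ lagrangeNodes m K.1, (∑ K' ∈ T.reach z K, D K') ^ 2 ≤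
      γ ^ d * ∑ K' ∈ T.reach z K, D K' ^ 2 := fun z hz => by
    refine sq_sum_le_card_mul_sum_sq.trans (mul_le_mul_of_nonneg_right ?_
      (Finset.sum_nonneg fun _ _ => sq_nonneg _))
    refine le_trans ?_ (T.card_patch_le hT.nonneg hT.shapeRegular hd0 z)
    exact_mod_cast Finset.card_le_card (T.reach_subset_patch (lagrangeNodes_subset_hull hm hz))
  rw [nodeSum, nodeSum]
  calc _ ≤ ((lagrangeNodes m K.1).card : ℝ) *
        ∑ z ∈ lagrangeNodes m K.1, (∑ K' ∈ T.reach z K, D K') ^ 2 := sq_sum_le_card_mul_sum_sq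
    _ ≤ ((m : ℝ) + 1) ^ (d + 1) *
        ∑ z ∈ lagrangeNodes m K.1, γ ^ d * ∑ K' ∈ T.reach z K, D K' ^ 2 :=
      mul_le_mul h1 (Finset.sum_le_sum h2) (Finset.sum_nonneg fun _ _ => sq_nonneg _) (by positivity)
    _ = _ := by rw [← Finset.mul_sum, mul_assoc]

lemma size_le_of_reach {γ : ℝ} (hT : T.Regular γ) {z : Point d} {K K' : T.Cell}
    (hz : z ∈ hull K.1) (hK' : K' ∈ T.reach z K) :
    size K.1 ≤ (2 * γ) ^ ⌊γ ^ d⌋₊ * size K'.1 := by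
  have hd0 : d ≠ 0 := by have := hT.two_le; omega
  obtain ⟨w, hw⟩ := T.exists_walk hz (T.mem_reach.1 hK')
  refine (T.size_le_of_walk hT.shapeRegular hT.two_le w).trans
    (mul_le_mul_of_nonneg_right ?_ (size_nonneg _))
  refine pow_le_pow_right₀ ((hT.shapeRegular K).one_le hT.two_le) (hw.trans (Nat.le_floor ?_))
  exact T.card_patch_le hT.nonneg hT.shapeRegular hd0 z

/-- Finite overlap: after exchanging the sums, S K' is counted at most once for each node `z` of
`K'` and each cell at `z`. -/
lemma sum_nodeSum_le {γ : ℝ} (hT : T.Regular γ) {m : ℕ} (hm : m ≠ 0) {S : T.Cell → ℝ}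
    (hS : ∀ K, 0 ≤ S K) :
    ∑ K, T.nodeSum m S K ≤ ((m : ℝ) + 1) ^ (d + 1) * γ ^ d * ∑ K, S K := by
  have hd0 : d ≠ 0 := by have := hT.two_le; omega
  have h1 : ∀ K, T.nodeSum m S K ≤
      ∑ K' : T.Cell, ∑ z ∈ lagrangeNodes m K'.1, if z ∈ hull K.1 then S K' else 0 := by
    intro K
    have e1 : T.nodeSum m S K ≤
        ∑ z ∈ lagrangeNodes m K.1, ∑ K' : T.Cell, if z ∈ hull K'.1 then S K' else 0 := by
      refine Finset.sum_le_sum fun z hz => ?_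
      rw [← Finset.sum_filter]
      exact Finset.sum_le_sum_of_subset_of_nonneg
        (T.reach_subset_patch (lagrangeNodes_subset_hull hm hz)) fun K _ _ => hS K
    rw [Finset.sum_comm] at e1
    refine e1.trans (Finset.sum_le_sum fun K' _ => ?_)
    rw [← Finset.sum_filter, ← Finset.sum_filter]
    refine Finset.sum_le_sum_of_subset_of_nonneg (fun z hz => ?_) fun _ _ _ => hS K'
    obtain ⟨hz, hzK'⟩ := Finset.mem_filter.1 hz
    have hzK := lagrangeNodes_subset_hull hm hz
    -- By matching, a node of `K` that lies in `K'` is also a node of `K'`, so the count can be made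
    -- from `K'`.
    have hzi : z ∈ hull (K.1 ∩ K'.1) := T.hull_inter K K' ▸ ⟨hzK, hzK'⟩
    exact Finset.mem_filter.2 ⟨lagrangeNodes_mono Finset.inter_subset_right
      ((T.isSimplex K).mem_lagrangeNodes_of_mem_hull hm Finset.inter_subset_left hz hzi), hzK⟩
  refine (Finset.sum_le_sum fun K _ => h1 K).trans ?_
  rw [Finset.sum_comm, Finset.mul_sum]
  refine Finset.sum_le_sum fun K' _ => ?_
  rw [Finset.sum_comm]
  have h2 : ∀ z ∈ lagrangeNodes m K'.1, (∑ K : T.Cell, if z ∈ hull K.1 then S K' else 0) ≤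
      γ ^ d * S K' := fun z _ => by
    rw [← Finset.sum_filter, Finset.sum_const, nsmul_eq_mul]
    exact mul_le_mul_of_nonneg_right (T.card_patch_le hT.nonneg hT.shapeRegular hd0 z) (hS K')
  refine (Finset.sum_le_sum h2).trans ?_
  rw [Finset.sum_const, nsmul_eq_mul, mul_assoc]
  refine mul_le_mul_of_nonneg_right ?_ (mul_nonneg (pow_nonneg hT.nonneg d) (hS K'))
  have := card_lagrangeNodes_le m K'.1
  rw [(T.isSimplex K').card] at this
  exact_mod_cast this

/-- The smoother is close to the reconstruction in the broken energy norm. -/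
lemma exists_brokenGradSq_le (d p : ℕ) (γ : ℝ) : ∃ C : ℝ, 0 ≤ C ∧
    ∀ (Ω : Set (Point d)) (T : Mesh d Ω), T.Regular γ → ∀ s ∈ T.hhoSpace p,
      T.brokenGradSq (T.reconstruction p s - T.smoother p s) ≤ C * ∑ K : T.Cell, T.faceSum s K := by
  obtain ⟨c₁, hc₁, hface⟩ := exists_faceBound d p γ
  obtain ⟨c₂, hc₂, hsup⟩ := exists_abs_reconstruction_sub_smoother_le d p γ
  obtain ⟨c₃, hc₃, hinv⟩ := exists_norm_grad_le (p + d + 1)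
  set V := (volume : Measure (Point d)).real (Metric.ball 0 1) with hV
  set N : ℝ := (((p + 1 : ℕ) : ℝ) + 1) ^ (d + 1) * |γ| ^ d with hN
  set Θ : ℝ := (2 * |γ|) ^ ⌊|γ| ^ d⌋₊ with hΘ
  refine ⟨V * (c₃ * c₂ * |γ|) ^ 2 * (N * (c₁ * Θ ^ (d - 2)) * N), by positivity,
    fun Ω T hT s hs => ?_⟩
  have hd := hT.two_le
  have hd0 : d ≠ 0 := by omega
  have hγ : |γ| = γ := abs_of_nonneg hT.nonneg
  rw [hγ] at hN hΘ ⊢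
  set S := T.faceSum s with hS
  set D : T.Cell → ℝ := fun K => √(c₁ * (S K / size K.1 ^ (d - 2))) with hD
  have hDb : T.FaceBound s D := hface Ω T hT s hs
  have hS0 : ∀ K, 0 ≤ S K := T.faceSum_nonneg s
  have hN0 : 0 ≤ N := by
    rw [hN]; exact mul_nonneg (by positivity) (pow_nonneg hT.nonneg d)
  have hloc : ∀ K : T.Cell, cellInt K.1 (fun x => ev (gradDot ((T.reconstruction p s - T.smoother p s) K)
      ((T.reconstruction p s - T.smoother p s) K)) x) ≤
        V * (c₃ * c₂ * γ) ^ 2 * (N * (c₁ * Θ ^ (d - 2))) * T.nodeSum (p + 1) S K := by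
    intro K
    set w := (T.reconstruction p s - T.smoother p s) K with hw
    have hK := T.isSimplex K
    have hh := hK.size_pos hd0
    obtain ⟨x₀, r, hr, hb, hsz⟩ := (hT.shapeRegular K).exists_ball
    set Q := T.nodeSum (p + 1) D K with hQ
    have hQ0 : 0 ≤ Q := T.nodeSum_nonneg hDb.nonneg _ K
    have h1 := hinv d (hull K.1) (convex_hull K.1) x₀ r hr hb w
      (T.reconstruction_sub_smoother_mem hd0 hT.isOpen hT.lipschitz p s K) (c₂ * Q)
      (hsup Ω T hT s hs D hDb K)
    have h2 : ∀ x ∈ hull K.1, ev (gradDot w w) x ≤ (c₃ * c₂ * γ) ^ 2 * (Q ^ 2 / size K.1 ^ 2) := by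
      intro x hx
      rw [ev_gradDot_self]
      have e1 : c₃ * (c₂ * Q) / r ≤ c₃ * c₂ * γ * (Q / size K.1) := by
        rw [mul_div_assoc', div_le_div_iff₀ hr hh]
        calc c₃ * (c₂ * Q) * size K.1 ≤ c₃ * (c₂ * Q) * (γ * r) := by gcongr
          _ = _ := by ring
      calc ‖grad w x‖ ^ 2 ≤ (c₃ * c₂ * γ * (Q / size K.1)) ^ 2 :=
            pow_le_pow_left₀ (norm_nonneg _) ((h1 x hx).trans e1) 2
        _ = _ := by ring
    refine (IsSimplex.cellInt_le_area_mul (continuous_ev _) h2).trans ?_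
    have hpow : size K.1 ^ d = size K.1 ^ (d - 2) * size K.1 ^ 2 := by
      rw [← pow_add]; congr 1; omega
    have h3 : Q ^ 2 * size K.1 ^ (d - 2) ≤ N * (c₁ * Θ ^ (d - 2)) * T.nodeSum (p + 1) S K := by
      have e1 : Q ^ 2 ≤ N * T.nodeSum (p + 1) (fun K => D K ^ 2) K := by
        rw [hN]; exact T.nodeSum_sq_le hT (by omega) D K
      -- D K'² carries the weight of the size of `K'`; sizes of cells connected at a node are
      -- comparable up to Θ, which trades it for that of `K`.
      have e2 : T.nodeSum (p + 1) (fun K => D K ^ 2) K * size K.1 ^ (d - 2) ≤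
          c₁ * Θ ^ (d - 2) * T.nodeSum (p + 1) S K := by
        simp only [nodeSum, Finset.sum_mul, Finset.mul_sum]
        refine Finset.sum_le_sum fun z hz => Finset.sum_le_sum fun K' hK' => ?_
        have hh' := (T.isSimplex K').size_pos hd0
        have e3 := pow_le_pow_left₀ hh.le (T.size_le_of_reach hT
          (lagrangeNodes_subset_hull p.succ_ne_zero hz) hK') (d - 2)
        rw [← hΘ, mul_pow] at e3
        have hq : 0 ≤ c₁ * (S K' / size K'.1 ^ (d - 2)) :=
          mul_nonneg hc₁ (div_nonneg (hS0 K') (by positivity))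
        rw [hD, Real.sq_sqrt hq]
        calc c₁ * (S K' / size K'.1 ^ (d - 2)) * size K.1 ^ (d - 2)
            ≤ c₁ * (S K' / size K'.1 ^ (d - 2)) * (Θ ^ (d - 2) * size K'.1 ^ (d - 2)) := by gcongr
          _ = _ := by field_simp
      calc Q ^ 2 * size K.1 ^ (d - 2)
          ≤ N * T.nodeSum (p + 1) (fun K => D K ^ 2) K * size K.1 ^ (d - 2) := by gcongr
        _ = N * (T.nodeSum (p + 1) (fun K => D K ^ 2) K * size K.1 ^ (d - 2)) := by ring
        _ ≤ N * (c₁ * Θ ^ (d - 2) * T.nodeSum (p + 1) S K) := by gcongr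
        _ = _ := by ring
    -- Volume h^d against the inverse inequality h^(-2) leaves h^(d-2), exactly the power absorbed
    -- by the scaling of D².
    calc area d K.1 * ((c₃ * c₂ * γ) ^ 2 * (Q ^ 2 / size K.1 ^ 2))
        ≤ V * size K.1 ^ d * ((c₃ * c₂ * γ) ^ 2 * (Q ^ 2 / size K.1 ^ 2)) := by
          gcongr
          exact hK.area_le_size_pow
      _ = V * (c₃ * c₂ * γ) ^ 2 * (Q ^ 2 * size K.1 ^ (d - 2)) := by
          rw [hpow]; field_simp
      _ ≤ V * (c₃ * c₂ * γ) ^ 2 * (N * (c₁ * Θ ^ (d - 2)) * T.nodeSum (p + 1) S K) := by gcongr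
      _ = _ := by ring
  have hΘ0 : 0 ≤ Θ := by rw [hΘ]; exact pow_nonneg (by linarith [hT.nonneg]) _
  rw [brokenGradSq]
  refine (Finset.sum_le_sum fun K _ => hloc K).trans ?_
  rw [← Finset.mul_sum]
  calc _ ≤ V * (c₃ * c₂ * γ) ^ 2 * (N * (c₁ * Θ ^ (d - 2))) * (N * ∑ K, S K) := by
        gcongr
        rw [hN]; exact T.sum_nodeSum_le hT (by omega) hS0
    _ = _ := by ring

lemma regular (hd : 2 ≤ d) (hΩ : IsOpen Ω) (hL : HasLipschitzBoundary Ω) {γ : ℝ}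
    (hγ : 2 * T.shapeParameter ≤ γ) : T.Regular γ where
  two_le := hd
  isOpen := hΩ
  lipschitz := hL
  shapeRegular K := by
    obtain ⟨h1, x, r, hr, hb, hsz⟩ := T.shapeRegular (by omega) K
    exact ⟨h1, x, r, hr, hb, hsz.trans (mul_le_mul_of_nonneg_right hγ hr.le)⟩
  nonneg := (mul_nonneg zero_le_two T.shapeParameter_nonneg).trans hγ

end GlobalEstimate

end Mesh

/-! ### Assembling the constant -/

/-- A constant that is monotone in the shape parameter and in the degree. -/
lemma exists_monotone_constant {B : ℕ → ℕ → ℕ → ℝ} (hB : ∀ d k j, 0 ≤ B d k j) :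
    ∃ C : ℝ → ℕ → ℝ, (∀ p : ℕ, Monotone fun γ : ℝ => C γ p) ∧ (∀ γ : ℝ, Monotone fun p : ℕ => C γ p) ∧
      ∀ d : ℕ, d = 2 ∨ d = 3 → ∀ (γ : ℝ) (p : ℕ), B d ⌈γ⌉₊ p ≤ C γ p := by
  -- Summing the nonnegative bounds over all smaller indices and over both dimensions enforces
  -- monotonicity without knowing how the original constants vary.
  refine ⟨fun γ p => ∑ k ∈ Finset.range (⌈γ⌉₊ + 1), ∑ j ∈ Finset.range (p + 1), (B 2 k j + B 3 k j),
    fun p γ γ' h => ?_, fun γ p p' h => ?_, fun d hd γ p => ?_⟩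
  · exact Finset.sum_le_sum_of_subset_of_nonneg
      (Finset.range_subset_range.2 (Nat.add_le_add_right (Nat.ceil_mono h) 1)) fun k _ _ =>
      Finset.sum_nonneg fun j _ => add_nonneg (hB 2 k j) (hB 3 k j)
  · exact Finset.sum_le_sum fun k _ => Finset.sum_le_sum_of_subset_of_nonneg
      (Finset.range_subset_range.2 (Nat.add_le_add_right h 1)) fun j _ _ =>
      add_nonneg (hB 2 k j) (hB 3 k j)
  · have h1 : B d ⌈γ⌉₊ p ≤ B 2 ⌈γ⌉₊ p + B 3 ⌈γ⌉₊ p := by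
      rcases hd with rfl | rfl
      · exact le_add_of_nonneg_right (hB _ _ _)
      · exact le_add_of_nonneg_left (hB _ _ _)
    refine h1.trans ((Finset.single_le_sum (f := fun j => B 2 ⌈γ⌉₊ j + B 3 ⌈γ⌉₊ j)
      (fun j _ => add_nonneg (hB _ _ _) (hB _ _ _)) (Finset.self_mem_range_succ p)).trans
      (Finset.single_le_sum (f := fun k => ∑ j ∈ Finset.range (p + 1), (B 2 k j + B 3 k j))
        (fun k _ => Finset.sum_nonneg fun j _ => add_nonneg (hB _ _ _) (hB _ _ _))
        (Finset.self_mem_range_succ _)))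

end HHO

end

theorem mainTheorem3 :
    ∃ C : ℝ → ℕ → ℝ,
      (∀ p : ℕ, Monotone fun γ : ℝ => C γ p) ∧ (∀ γ : ℝ, Monotone fun p : ℕ => C γ p) ∧
      ∀ (d : ℕ), d = 2 ∨ d = 3 →
      ∀ (Ω : Set (HHO.Point d)), IsOpen Ω → Bornology.IsBounded Ω →
        HHO.HasLipschitzBoundary Ω →
      ∀ (T : HHO.Mesh d Ω) (p : ℕ),
        IsLinearMap ℝ (fun σ : T.hhoSpace p => T.smoother p σ.1) ∧
        ∀ σ ∈ T.hhoSpace p,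
          HHO.MemH10 Ω (T.toFun (T.smoother p σ)) ∧
          (∀ K : T.Cell, ∀ q ∈ HHO.polySpace d ((p : ℤ) - 1),
            HHO.cellInt K.1 (fun x => HHO.ev q x * HHO.ev (T.smoother p σ K) x) =
              HHO.cellInt K.1 (fun x => HHO.ev q x * HHO.ev (σ.1 K) x)) ∧
          (∀ F : T.Face, T.IsInterface F → ∀ K : T.Cell, F.1 ⊆ K.1 →
            ∀ r ∈ HHO.polySpace d p,
              HHO.faceInt F.1 (fun x => HHO.ev r x * HHO.ev (T.smoother p σ K) x) =
                HHO.faceInt F.1 (fun x => HHO.ev r x * HHO.ev (σ.2 F) x)) ∧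
          T.brokenGradSq (T.reconstruction p σ - T.smoother p σ) ≤
            C T.shapeParameter p *
              ∑ K : T.Cell, ∑ F ∈ T.facesOf K,
                (HHO.size F.1)⁻¹ *
                  HHO.faceInt F.1
                    (fun x => (HHO.ev (σ.2 F) x - HHO.ev (σ.1 K) x) ^ 2) := by
  -- The shape parameter is rounded up to an integer, to make the constants a family over naturals;
  -- the 2 is the loss in replacing the inradius by an actual ball.
  choose B hB hmain using fun d k p => HHO.Mesh.exists_brokenGradSq_le d p (2 * (k : ℕ))
  obtain ⟨C, hC₁, hC₂, hC⟩ := HHO.exists_monotone_constant hB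
  refine ⟨C, hC₁, hC₂, fun d hd Ω hΩ hb hL T p => ?_⟩
  have hd0 : d ≠ 0 := by omega
  refine ⟨⟨fun s t => (T.isLinearMap_smoother p hd0 hΩ hL).map_add s.1 t.1,
    fun c s => (T.isLinearMap_smoother p hd0 hΩ hL).map_smul c s.1⟩, fun σ hσ =>
    ⟨(T.conforming_smoother p hΩ hL σ).memH10 hΩ hb,
      fun K q hq => T.smoother_cell_moment p hΩ hL σ K hq,
      fun F hF K hK r hr => T.smoother_face_moment p hd0 hΩ hL σ hF hK hr, ?_⟩⟩
  refine (hmain d ⌈T.shapeParameter⌉₊ p Ω T (T.regular (by omega) hΩ hL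
    (mul_le_mul_of_nonneg_left (Nat.le_ceil _) zero_le_two)) σ hσ).trans ?_
  exact mul_le_mul_of_nonneg_right (hC d hd _ _) (Finset.sum_nonneg fun K _ => T.faceSum_nonneg σ K)
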